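/- **Setting.** Let $\mathsf G=(\mathsf G_1\rightrightarrows \mathsf G_0)$ be a smooth étale groupoid: $\mathsf G_0,\mathsf G_1$ are smooth $n$-manifolds, $\mathsf G_0$ is Hausdorff and paracompact, and all structure maps (source $s$, target $t$, unit, inverse, composition) are local diffeomorphisms. For $k\ge 0$ let $\mathsf G_k$ be the space of strings $x_0\xrightarrow{g_1}x_1\to\cdots\xrightarrow{g_k}x_k$ of $k$ composable arrows, with faces $d_i:\mathsf G_k\to\mathsf G_{k-1}$ and last-object map $\epsilon_k:\mathsf G_k\to \mathsf G_0$. Assume that $\mathsf G$ is a Leray description, i.e. every $\mathsf G_k$ is a disjoint union of contractible spaces. An abelian $\mathsf G$-sheaf is a sheaf of abelian groups on $\mathsf G_0$ (an étalé space) with a continuous right action $a\mapsto ag$, $F_{s(g)}\to F_{t(g)}$, of the arrows by additive maps. Let $\mathbb C^\times_{\mathsf G}$ and $\mathcal A^1_{\mathsf G}$ be the $\mathsf G$-sheaves of germs of smooth $\mathbb C^\times$-valued functions and of smooth complex-valued 1-forms on $\mathsf G_0$, an arrow acting by pull-back along the inverse of the local diffeomorphism from $s(g)$ to $t(g)$ that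 it defines, and let $\mathbb C^\times(2)_{\mathsf G}$ be the complex $\mathbb C^\times_{\mathsf G}\xrightarrow{d\log}\mathcal A^1_{\mathsf G}$ in degrees $0,1$. For a complex $K^\bullet$ of abelian $\mathsf G$-sheaves in degrees $\ge 0$, the Čech complex $\check C(\mathsf G,K)$ is the total complex of the double complex $C^{k,l}=\Gamma(\mathsf G_k,\epsilon_k^*K^l)$ with total differential $d+(-1)^{l+1}\delta$ on $C^{k,l}$, where $\delta=\sum_{i=0}^{k+1}(-1)^i\delta_i:C^{k,l}\to C^{k+1,l}$, $(\delta_i\sigma)(q)=\sigma(d_iq)$ for $i\le k$ and $(\delta_{k+1}\sigma)(g_1,\dots,g_{k+1})=\sigma(g_1,\dots,g_k)\cdot g_{k+1}$. The hypercohomology $\mathbb H^m(\mathsf G,K)$ is the $m$-th cohomology of $\Gamma_{inv}(\mathsf G,T^\bullet)$, where $j:K\to T^\bullet$ is a quasi-isomorphism into a complex of injective abelian $\mathsf G$-sheaves and $\Gamma_{inv}$ denotes the invariant global sections. A line bundle with connection over $\mathsf G$ is a pair $(\rho,A)$ of a smooth morphism of groupoids $\rho$ from $\mathsf G$ to the one-object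 groupoid $*\times\mathbb C^\times\rightrightarrows *$, with map on arrows $\rho_1:\mathsf G_1\to\mathbb C^\times$, and a smooth complex 1-form $A$ on $\mathsf G_0$ such that $s^*A-t^*A=d\log\rho_1$. An isomorphism $(\rho,A)\to(\rho',A')$ is a smooth $f:\mathsf G_0\to\mathbb C^\times$ with $f(s(g))\,\rho'_1(g)=\rho_1(g)\,f(t(g))$ for all $g$ and $A'=A-d\log f$. The tensor product is $(\rho\rho',A+A')$. **Proposition.** 1. For every line bundle with connection, $(\rho,A)$, with $\rho_1$ regarded as a section of $\epsilon_1^*\mathbb C^\times_{\mathsf G}=t^*\mathbb C^\times_{\mathsf G}$ over $\mathsf G_1$, is a 1-cocycle of $\check C(\mathsf G,\mathbb C^\times(2)_{\mathsf G})$, and every 1-cocycle arises in this way from exactly one line bundle with connection. Two line bundles with connection are isomorphic if and only if their cocycles are cohomologous in $\check C(\mathsf G,\mathbb C^\times(2)_{\mathsf G})$. 2. A quasi-isomorphism $j:\mathbb C^\times(2)_{\mathsf G}\to T^\bullet$ into a complex of injective abelian $\mathsf G$-sheaves in degrees $\ge 0$ exists. For every such $j$ there is a bijection $\Phi$ from the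 set of isomorphism classes of line bundles with connection over $\mathsf G$ onto $\mathbb H^1(\mathsf G,\mathbb C^\times_{\mathsf G}\xrightarrow{d\log}\mathcal A^1_{\mathsf G})=H^1(\Gamma_{inv}(\mathsf G,T^\bullet))$ which takes tensor products to sums and sends $(\rho,A)$ to the class it represents: for every invariant 1-cocycle $\tau\in\Gamma_{inv}(\mathsf G,T^1)$, $\Phi[(\rho,A)]=[\tau]$ if and only if $\tau$, regarded as an element of $\Gamma(\mathsf G_0,T^1)=C^{0,1}$, and $j(\rho,A)$ are cohomologous in $\check C(\mathsf G,T)$. -/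

import Mathlib

open CategoryTheory TopologicalSpace Topology Manifold ContDiff Filter Bundle

universe u v

/-- A small category in which every arrow is invertible, as a set of objects, a set of arrows and
structure maps; `m g h` is the composite of `g : x → y`
and `h : y → z`. -/
structure AlgGroupoid (Ob : Type u) (Ar : Type v) where
  s : Ar → Ob
  t : Ar → Ob
  e : Ob → Ar
  i : Ar → Ar
  m : ∀ g h : Ar, t g = s h → Ar
  s_e : ∀ x, s (e x) = x
  t_e : ∀ x, t (e x) = x
  s_i : ∀ g, s (i g) = t g
  t_i : ∀ g, t (i g) = s g
  s_m : ∀ g h w, s (m g h w) = s g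
  t_m : ∀ g h w, t (m g h w) = t h
  assoc : ∀ g h k (w : t g = s h) (w' : t h = s k),
    m (m g h w) k ((t_m g h w).trans w') = m g (m h k w') (w.trans (s_m h k w').symm)
  e_m : ∀ g, m (e (s g)) g (t_e _) = g
  m_e : ∀ g, m g (e (t g)) (s_e _).symm = g
  i_m : ∀ g, m (i g) g (t_i g) = e (t g)
  m_i : ∀ g, m g (i g) (s_i g).symm = e (s g)

/-- A morphism of groupoids: a pair of maps commuting with the structure maps. -/
structure AlgGroupoid.Hom {Ob : Type*} {Ar : Type*} {Ob' : Type*} {Ar' : Type*}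
    (G : AlgGroupoid Ob Ar) (H : AlgGroupoid Ob' Ar') where
  obj : Ob → Ob'
  arr : Ar → Ar'
  s_arr : ∀ g, H.s (arr g) = obj (G.s g)
  t_arr : ∀ g, H.t (arr g) = obj (G.t g)
  arr_e : ∀ x, arr (G.e x) = H.e (obj x)
  arr_i : ∀ g, arr (G.i g) = H.i (arr g)
  arr_m : ∀ g h (w : G.t g = G.s h),
    arr (G.m g h w) = H.m (arr g) (arr h) (by rw [t_arr, s_arr, w])

/-- The groupoid `* × ℂˣ ⇉ *` of the group `ℂˣ`. -/
def unitsGroupoid : AlgGroupoid PUnit.{1} ℂˣ where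
  s _ := PUnit.unit
  t _ := PUnit.unit
  e _ := 1
  i g := g⁻¹
  m g h _ := g * h
  s_e _ := rfl
  t_e _ := rfl
  s_i _ := rfl
  t_i _ := rfl
  s_m _ _ _ := rfl
  t_m _ _ _ := rfl
  assoc _ _ _ _ _ := mul_assoc _ _ _
  e_m _ := one_mul _
  m_e _ := mul_one _
  i_m _ := inv_mul_cancel _
  m_i _ := mul_inv_cancel _

/-- A smooth étale groupoid of dimension `n`.  The space of composable pairs is given the subspace
topology.  Since `s (m g h) = s g` and the source map is a local diffeomorphism, a continuous `m`
is automatically a local diffeomorphism for the smooth structure of the space of composable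
pairs. -/
structure EtaleGroupoid (n : ℕ) (G₀ G₁ : Type u)
    [TopologicalSpace G₀] [ChartedSpace (EuclideanSpace ℝ (Fin n)) G₀]
    [TopologicalSpace G₁] [ChartedSpace (EuclideanSpace ℝ (Fin n)) G₁]
    extends AlgGroupoid G₀ G₁ where
  s_loc : IsLocalDiffeomorph (𝓡 n) (𝓡 n) ∞ s
  t_loc : IsLocalDiffeomorph (𝓡 n) (𝓡 n) ∞ t
  e_loc : IsLocalDiffeomorph (𝓡 n) (𝓡 n) ∞ e
  i_loc : IsLocalDiffeomorph (𝓡 n) (𝓡 n) ∞ i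
  continuous_m : Continuous fun p : {p : G₁ × G₁ // t p.1 = s p.2} => m p.1.1 p.1.2 p.2

/-- The total space of a family of stalks. -/
structure Etale {X : Type u} (S : X → Type u) where
  pt : X
  val : S pt

namespace EtaleGroupoid

variable {n : ℕ} {G₀ G₁ : Type u}
  [TopologicalSpace G₀] [ChartedSpace (EuclideanSpace ℝ (Fin n)) G₀]
  [TopologicalSpace G₁] [ChartedSpace (EuclideanSpace ℝ (Fin n)) G₁]

/-- An abelian `G`-sheaf: an étalé space `p : E → G₀` whose fibres are abelian groups with
continuous operations, with a continuous right action of the arrows,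
`E_{s g} → E_{t g}`, `a ↦ a g`, by additive maps. -/
structure Shf (G : EtaleGroupoid n G₀ G₁) where
  stalk : G₀ → Type u
  [grp : ∀ x, AddCommGroup (stalk x)]
  [top : TopologicalSpace (Etale stalk)]
  isLocalHomeomorph_pt : IsLocalHomeomorph (Etale.pt : Etale stalk → G₀)
  continuous_zero : Continuous fun x : G₀ => (⟨x, 0⟩ : Etale stalk)
  continuous_neg : Continuous fun a : Etale stalk => (⟨a.pt, -a.val⟩ : Etale stalk)
  continuous_add : Continuous fun p : {p : Etale stalk × Etale stalk // p.1.pt = p.2.pt} =>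
    (⟨p.1.2.pt, (p.2 ▸ p.1.1.val) + p.1.2.val⟩ : Etale stalk)
  /-- `act g hs ht a` is `a g`, for `g : x → y` and `a` in the stalk at `x` -/
  act : ∀ (g : G₁) {x y : G₀}, G.s g = x → G.t g = y → stalk x →+ stalk y
  continuous_act : Continuous fun p : {p : Etale stalk × G₁ // G.s p.2 = p.1.pt} =>
    (⟨G.t p.1.2, act p.1.2 p.2 rfl p.1.1.val⟩ : Etale stalk)
  act_e : ∀ (x : G₀) (a : stalk x), act (G.e x) (G.s_e x) (G.t_e x) a = a
  act_m : ∀ (g h : G₁) {x y z : G₀} (hs : G.s g = x) (ht : G.t g = y) (hs' : G.s h = y)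
    (ht' : G.t h = z) (a : stalk x),
    act (G.m g h (ht.trans hs'.symm)) ((G.s_m _ _ _).trans hs) ((G.t_m _ _ _).trans ht') a =
      act h hs' ht' (act g hs ht a)

attribute [instance] Shf.grp Shf.top

variable {G : EtaleGroupoid n G₀ G₁}

namespace Shf

/-- A morphism of abelian `G`-sheaves. -/
@[ext] structure Hom (A B : Shf G) where
  app : ∀ x, A.stalk x →+ B.stalk x
  continuous_app : Continuous fun a : Etale A.stalk => (⟨a.pt, app a.pt a.val⟩ : Etale B.stalk)
  app_act : ∀ (g : G₁) {x y : G₀} (hs : G.s g = x) (ht : G.t g = y) (a : A.stalk x),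
    app y (A.act g hs ht a) = B.act g hs ht (app x a)

instance : Category (Shf G) where
  Hom := Hom
  id A := ⟨fun _ => AddMonoidHom.id _, continuous_id, fun _ _ _ _ _ _ => rfl⟩
  comp f g := ⟨fun x => (g.app x).comp (f.app x), g.continuous_app.comp f.continuous_app,
    fun k _ _ hs ht a => by simp [f.app_act k hs ht, g.app_act k hs ht]⟩

theorem continuous_pt (A : Shf G) : Continuous (Etale.pt : Etale A.stalk → G₀) :=
  A.isLocalHomeomorph_pt.continuous

instance : Limits.HasZeroMorphisms (Shf G) where
  zero A B := ⟨⟨fun _ => 0, B.continuous_zero.comp A.continuous_pt, fun _ _ _ _ _ _ => by simp⟩⟩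
  comp_zero _ _ := Hom.ext (by funext x; exact AddMonoidHom.zero_comp _)
  zero_comp _ _ _ f := Hom.ext (by funext x; exact AddMonoidHom.comp_zero (f.app x))

/-- The stalk functor at `x`. -/
def stalkFunctor (x : G₀) : Shf G ⥤ AddCommGrpCat.{u} where
  obj A := AddCommGrpCat.of (A.stalk x)
  map f := AddCommGrpCat.ofHom (f.app x)

instance (x : G₀) : (stalkFunctor (G := G) x).PreservesZeroMorphisms where

/-- The zero `G`-sheaf, with total space `G₀`. -/
def zeroShf (G : EtaleGroupoid n G₀ G₁) : Shf G where
  stalk _ := PUnit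
  top := TopologicalSpace.induced Etale.pt inferInstance
  isLocalHomeomorph_pt := by
    let _ : TopologicalSpace (Etale fun _ : G₀ => PUnit.{u+1}) :=
      TopologicalSpace.induced Etale.pt inferInstance
    exact (Homeomorph.mk ⟨Etale.pt, fun x => ⟨x, PUnit.unit⟩, fun _ => rfl, fun _ => rfl⟩
      continuous_induced_dom (continuous_induced_rng.2 continuous_id)).isLocalHomeomorph
  continuous_zero := continuous_induced_rng.2 continuous_id
  continuous_neg := continuous_induced_rng.2 continuous_induced_dom
  continuous_add := by
    let _ : TopologicalSpace (Etale fun _ : G₀ => PUnit.{u+1}) := TopologicalSpace.induced Etale.pt inferInstance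
    exact continuous_induced_rng.2 (continuous_induced_dom.comp
      (continuous_snd.comp continuous_subtype_val))
  act _ _ _ _ _ := 0
  continuous_act := by
    let _ : TopologicalSpace (Etale fun _ : G₀ => PUnit.{u+1}) := TopologicalSpace.induced Etale.pt inferInstance
    exact continuous_induced_rng.2 (G.t_loc.contMDiff.continuous.comp
      (continuous_snd.comp continuous_subtype_val))
  act_e _ _ := rfl
  act_m _ _ _ _ _ _ _ _ _ _ := rfl

end Shf

/-- The space `G_k` of composable strings `x₀ → x₁ → ⋯ → x_k` of `k` arrows. -/
@[ext] structure Nerve (G : EtaleGroupoid n G₀ G₁) (k : ℕ) where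
  obj : Fin (k + 1) → G₀
  arr : Fin k → G₁
  s_arr : ∀ j, G.s (arr j) = obj j.castSucc
  t_arr : ∀ j, G.t (arr j) = obj j.succ

namespace Nerve

instance (k : ℕ) : TopologicalSpace (Nerve G k) :=
  TopologicalSpace.induced (fun q => (q.obj, q.arr)) inferInstance

/-- The last object `ε_k(g₁, …, g_k) = t(g_k)`. -/
def last {k : ℕ} (q : Nerve G k) : G₀ := q.obj (Fin.last k)

theorem continuous_obj {k : ℕ} (j : Fin (k + 1)) : Continuous fun q : Nerve G k => q.obj j :=
  (continuous_apply j).comp (continuous_fst.comp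
    (continuous_induced_dom (f := fun q : Nerve G k => (q.obj, q.arr))))

theorem continuous_arr {k : ℕ} (j : Fin k) : Continuous fun q : Nerve G k => q.arr j :=
  (continuous_apply j).comp (continuous_snd.comp
    (continuous_induced_dom (f := fun q : Nerve G k => (q.obj, q.arr))))

theorem continuous_last {k : ℕ} : Continuous fun q : Nerve G k => q.last := continuous_obj _

theorem composable {k : ℕ} (q : Nerve G (k + 1)) (j : Fin k) :
    G.t (q.arr j.castSucc) = G.s (q.arr j.succ) := by
  rw [q.t_arr, q.s_arr, Fin.succ_castSucc]

/-- The `i`-th face: the object `x_i` is dropped, so that the first or last arrow is dropped for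
`i = 0` and `i = k + 1`, and the two arrows at `x_i` are composed otherwise. -/
def face {k : ℕ} (i : Fin (k + 2)) (q : Nerve G (k + 1)) : Nerve G k where
  obj j := q.obj (i.succAbove j)
  arr j :=
    if (j : ℕ) + 1 < i then q.arr j.castSucc
    else if (j : ℕ) + 1 = i then G.m (q.arr j.castSucc) (q.arr j.succ) (q.composable j)
    else q.arr j.succ
  s_arr j := by
    split_ifs with h1 h2
    · rw [q.s_arr]; congr 1
      rw [Fin.succAbove_of_castSucc_lt]; rw [Fin.lt_def]; simp; omega
    · rw [G.s_m, q.s_arr]; congr 1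
      rw [Fin.succAbove_of_castSucc_lt]; rw [Fin.lt_def]; simp; omega
    · rw [q.s_arr]; congr 1
      rw [Fin.succAbove_of_le_castSucc]; · rfl
      rw [Fin.le_def]; simp; omega
  t_arr j := by
    split_ifs with h1 h2
    · rw [q.t_arr]; congr 1
      rw [Fin.succAbove_of_castSucc_lt]; · rfl
      rw [Fin.lt_def]; simp; omega
    · rw [G.t_m, q.t_arr]; congr 1
      rw [Fin.succAbove_of_le_castSucc]; rw [Fin.le_def]; simp; omega
    · rw [q.t_arr]; congr 1
      rw [Fin.succAbove_of_le_castSucc]; rw [Fin.le_def]; simp; omega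

theorem continuous_face {k : ℕ} (i : Fin (k + 2)) :
    Continuous (face i : Nerve G (k + 1) → Nerve G k) := by
  refine continuous_induced_rng.2 (Continuous.prodMk ?_ ?_)
  · exact continuous_pi fun j => continuous_obj _
  · refine continuous_pi fun j => ?_
    by_cases h1 : (j : ℕ) + 1 < i
    · simpa [face, h1] using continuous_arr _
    by_cases h2 : (j : ℕ) + 1 = i
    · have : Continuous fun q : Nerve G (k + 1) =>
          (⟨(q.arr j.castSucc, q.arr j.succ), q.composable j⟩ :
            {p : G₁ × G₁ // G.t p.1 = G.s p.2}) :=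
        ((continuous_arr _).prodMk (continuous_arr _)).subtype_mk _
      simpa [face, h1, h2] using! G.continuous_m.comp this
    · simpa [face, h1, h2] using continuous_arr _

theorem last_face {k : ℕ} (i : Fin (k + 1)) (q : Nerve G (k + 1)) :
    (face i.castSucc q).last = q.last := by
  simp only [last, face]
  congr 1
  rw [Fin.succAbove_of_le_castSucc]; · rfl
  simp [Fin.le_last]

theorem last_face_last {k : ℕ} (q : Nerve G (k + 1)) :
    (face (Fin.last (k + 1)) q).last = G.s (q.arr (Fin.last k)) := by
  rw [q.s_arr]; simp [last, face]

end Nerve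

/-- Sections over `G_k` of the pulled back sheaf `ε_k^* F`: continuous lifts of `ε_k` to the étalé
space of `F`. -/
def Cochain (F : Shf G) (k : ℕ) : AddSubgroup (∀ q : Nerve G k, F.stalk q.last) where
  carrier := {σ | Continuous fun q => (⟨q.last, σ q⟩ : Etale F.stalk)}
  zero_mem' := show Continuous _ from F.continuous_zero.comp Nerve.continuous_last
  neg_mem' (h : Continuous _) := show Continuous _ from F.continuous_neg.comp h
  add_mem' (ha : Continuous _) (hb : Continuous _) := show Continuous _ from
    F.continuous_add.comp ((Continuous.prodMk ha hb).subtype_mk fun _ => rfl)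

end EtaleGroupoid
/-- A natural sheaf of `V`-valued functions on `M`: a local condition `good f y`, read as `f` is
smooth at `y`, and a pull-back operation along smooth maps. -/
structure Coeff (n : ℕ) (M : Type u) [TopologicalSpace M]
    [ChartedSpace (EuclideanSpace ℝ (Fin n)) M] where
  V : Type
  [grp : AddCommGroup V]
  good : (M → V) → M → Prop
  good_congr : ∀ {f g : M → V} {y : M}, f =ᶠ[𝓝 y] g → good f y → good g y
  good_zero : ∀ y, good 0 y
  good_neg : ∀ {f : M → V} {y : M}, good f y → good (-f) y
  good_add : ∀ {f g : M → V} {y : M}, good f y → good g y → good (f + g) y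
  pull : (M → M) → (M → V) → M → V
  pull_congr : ∀ {φ ψ : M → M} {f g : M → V} {y : M}, φ =ᶠ[𝓝 y] ψ → f =ᶠ[𝓝 (φ y)] g →
    pull φ f y = pull ψ g y
  pull_id : ∀ (f : M → V), pull id f = f
  pull_comp : ∀ {φ ψ : M → M} (f : M → V) {y : M}, ContMDiffAt (𝓡 n) (𝓡 n) ∞ ψ y →
    ContMDiffAt (𝓡 n) (𝓡 n) ∞ φ (ψ y) → pull (φ ∘ ψ) f y = pull ψ (pull φ f) y
  pull_add : ∀ (φ : M → M) (f g : M → V), pull φ (f + g) = pull φ f + pull φ g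
  good_pull : ∀ {φ : M → M} {f : M → V} {y : M}, ContMDiffAt (𝓡 n) (𝓡 n) ∞ φ y →
    good f (φ y) → good (pull φ f) y

namespace Coeff

attribute [instance] Coeff.grp

variable {n : ℕ} {M : Type u} [TopologicalSpace M] [ChartedSpace (EuclideanSpace ℝ (Fin n)) M]
  (C : Coeff n M)

/-- `f` is good on a neighbourhood of `x`. -/
def GoodNear (f : M → C.V) (x : M) : Prop := ∀ᶠ y in 𝓝 x, C.good f y

/-- The germs at `x` of functions that are good near `x`. -/
def stalk (x : M) : AddSubgroup (Germ (𝓝 x) C.V) where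
  carrier := {γ | ∃ f : M → C.V, C.GoodNear f x ∧ (f : Germ (𝓝 x) C.V) = γ}
  zero_mem' := ⟨0, .of_forall C.good_zero, rfl⟩
  neg_mem' := by
    rintro _ ⟨f, hf, rfl⟩
    exact ⟨-f, hf.mono fun _ => C.good_neg, rfl⟩
  add_mem' := by
    rintro _ _ ⟨f, hf, rfl⟩ ⟨g, hg, rfl⟩
    exact ⟨f + g, (hf.and hg).mono fun _ h => C.good_add h.1 h.2, rfl⟩

/-- The germ of `f` at `x`. -/
def germ (f : M → C.V) (x : M) (h : C.GoodNear f x) : C.stalk x := ⟨(f : Germ (𝓝 x) C.V), f, h, rfl⟩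

variable {C}

theorem exists_germ {x : M} (a : C.stalk x) : ∃ f h, a = C.germ f x h := by
  obtain ⟨_, f, h, rfl⟩ := a
  exact ⟨f, h, rfl⟩

theorem germ_eq {f g : M → C.V} {x : M} {hf : C.GoodNear f x} {hg : C.GoodNear g x} :
    C.germ f x hf = C.germ g x hg ↔ f =ᶠ[𝓝 x] g :=
  Subtype.ext_iff.trans Germ.coe_eq

theorem GoodNear.eventually {f : M → C.V} {x : M} (h : C.GoodNear f x) :
    ∀ᶠ y in 𝓝 x, C.GoodNear f y := eventually_eventually_nhds.2 h

theorem GoodNear.add {f g : M → C.V} {x : M} (hf : C.GoodNear f x) (hg : C.GoodNear g x) :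
    C.GoodNear (f + g) x := (hf.and hg).mono fun _ h => C.good_add h.1 h.2

theorem GoodNear.neg {f : M → C.V} {x : M} (hf : C.GoodNear f x) :
    C.GoodNear (-f) x := hf.mono fun _ h => C.good_neg h

variable (C)

/-- The étalé space of germs. -/
abbrev Space := Etale fun x : M => C.stalk x

/-- The germ of `f` at `x`, as a point of the étalé space. -/
def pgerm (f : M → C.V) (x : M) (h : C.GoodNear f x) : C.Space := ⟨x, C.germ f x h⟩

/-- The topology of the étalé space: the finest one for which all local sections
`x ↦ germ of f at x` are continuous. -/
instance : TopologicalSpace C.Space where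
  IsOpen S := ∀ (f : M → C.V) (x : M) (h : C.GoodNear f x), C.pgerm f x h ∈ S →
    ∀ᶠ y in 𝓝 x, ∀ h' : C.GoodNear f y, C.pgerm f y h' ∈ S
  isOpen_univ _ _ _ _ := .of_forall fun _ _ => trivial
  isOpen_inter S T hS hT f x h hx := ((hS f x h hx.1).and (hT f x h hx.2)).mono
    fun _ hy h' => ⟨hy.1 h', hy.2 h'⟩
  isOpen_sUnion 𝒮 h𝒮 f x h := by
    rintro ⟨S, hS, hx⟩
    exact (h𝒮 S hS f x h hx).mono fun _ hy h' => ⟨S, hS, hy h'⟩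

variable {C}

theorem exists_pgerm (a : C.Space) : ∃ f h, a = C.pgerm f a.pt h := by
  obtain ⟨x, a⟩ := a
  obtain ⟨f, h, rfl⟩ := exists_germ a
  exact ⟨f, h, rfl⟩

theorem pgerm_congr {f g : M → C.V} {x : M} {hf : C.GoodNear f x} {hg : C.GoodNear g x}
    (h : f =ᶠ[𝓝 x] g) : C.pgerm f x hf = C.pgerm g x hg := by
  rw [pgerm, pgerm, germ_eq.2 h]

theorem pgerm_eq {f g : M → C.V} {x : M} {hf : C.GoodNear f x} {hg : C.GoodNear g x}
    (h : C.pgerm f x hf = C.pgerm g x hg) : f =ᶠ[𝓝 x] g := by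
  simpa [pgerm, germ_eq] using h

theorem isOpen_section (f : M → C.V) {U : Set M} (hU : IsOpen U) :
    IsOpen {a : C.Space | a.pt ∈ U ∧ ∃ h, a = C.pgerm f a.pt h} := by
  rintro g x hg ⟨hx, hf, e⟩
  have e' : g =ᶠ[𝓝 x] f := pgerm_eq e
  filter_upwards [eventually_eventually_nhds.2 e', hU.mem_nhds hx,
    hf.eventually] with y hy hyU hfy hgy
  exact ⟨hyU, hfy, pgerm_congr hy⟩

theorem continuous_pt : Continuous (Etale.pt : C.Space → M) := by
  refine continuous_def.2 fun U hU f x h hx => ?_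
  filter_upwards [hU.mem_nhds hx] with y hy _ using hy

theorem eventually_pgerm (a : C.Space) (f : M → C.V) (h : C.GoodNear f a.pt)
    (ha : a = C.pgerm f a.pt h) : ∀ᶠ b in 𝓝 a, ∃ h', b = C.pgerm f b.pt h' :=
  mem_of_superset ((isOpen_section f isOpen_univ).mem_nhds ⟨trivial, h, ha⟩) fun _ hb => hb.2

theorem continuousAt_of {X : Type*} [TopologicalSpace X] {F : X → C.Space} {x : X} (f : M → C.V)
    (p : X → M) (hp : ContinuousAt p x)
    (hF : ∀ᶠ y in 𝓝 x, ∃ h, F y = C.pgerm f (p y) h) : ContinuousAt F x := by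
  intro S hS
  obtain ⟨T, hTS, hT, hxT⟩ := mem_nhds_iff.1 hS
  obtain ⟨h, e⟩ := hF.self_of_nhds
  rw [e] at hxT
  refine mem_map.2 ?_
  filter_upwards [hF, hp.eventually (hT f _ h hxT)] with y ⟨h', hy⟩ hy'
  exact hTS (hy ▸ hy' h')

theorem isLocalHomeomorph_pt : IsLocalHomeomorph (Etale.pt : C.Space → M) := by
  refine IsLocalHomeomorph.mk _ fun a => ?_
  obtain ⟨f, h, ha⟩ := exists_pgerm a
  obtain ⟨U, hUf, hU, haU⟩ := eventually_nhds_iff.1 h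
  have good : ∀ y ∈ U, C.GoodNear f y := fun y hy => by
    filter_upwards [hU.mem_nhds hy] with z hz using hUf z hz
  classical
  let σ : M → C.Space := fun y => if hy : C.GoodNear f y then C.pgerm f y hy else C.pgerm 0 y
    (.of_forall C.good_zero)
  have hσ : ∀ y (hy : C.GoodNear f y), σ y = C.pgerm f y hy := fun y hy => dif_pos hy
  exact ⟨{  toFun := Etale.pt, invFun := σ
            source := {a | a.pt ∈ U ∧ ∃ h, a = C.pgerm f a.pt h}, target := U
            map_source' := fun _ hb => hb.1
            map_target' := fun y hy => by
              rw [hσ y (good y hy)]; exact ⟨hy, good y hy, rfl⟩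
            left_inv' := fun b ⟨hb, h', e⟩ => by rw [hσ _ h', ← e]
            right_inv' := fun y hy => by rw [hσ y (good y hy)]; rfl
            open_source := isOpen_section f hU
            open_target := hU
            continuousOn_toFun := continuous_pt.continuousOn
            continuousOn_invFun := fun y hy => ContinuousAt.continuousWithinAt <|
              continuousAt_of f id continuousAt_id (by
                filter_upwards [hU.mem_nhds hy] with z hz using ⟨good z hz, hσ z _⟩) },
          ⟨haU, h, ha⟩, fun _ _ => rfl⟩

/-- `φ` is smooth on a neighbourhood of `y`. -/
def _root_.SmoothNear (φ : M → M) (y : M) : Prop := ∀ᶠ z in 𝓝 y, ContMDiffAt (𝓡 n) (𝓡 n) ∞ φ z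

theorem GoodNear.pull {φ : M → M} {f : M → C.V} {y : M} (hφ : SmoothNear (n := n) φ y)
    (h : C.GoodNear f (φ y)) : C.GoodNear (C.pull φ f) y := by
  filter_upwards [hφ, hφ.self_of_nhds.continuousAt.eventually h] with z h1 h2
  exact C.good_pull h1 h2

theorem pull_eventuallyEq {φ ψ : M → M} {f g : M → C.V} {y : M} (hc : ContinuousAt φ y)
    (hφ : φ =ᶠ[𝓝 y] ψ) (hf : f =ᶠ[𝓝 (φ y)] g) : C.pull φ f =ᶠ[𝓝 y] C.pull ψ g := by
  filter_upwards [eventually_eventually_nhds.2 hφ,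
    hc.eventually (eventually_eventually_nhds.2 hf)] with z h1 h2
  exact C.pull_congr h1 h2

/-- Pull-back of germs along a smooth map. -/
def pullGerm (φ : M → M) {x y : M} (h : φ y = x) (hφ : SmoothNear (n := n) φ y) :
    C.stalk x →+ C.stalk y where
  toFun a := ⟨Germ.map' (C.pull φ) (fun f g hfg => pull_eventuallyEq hφ.self_of_nhds.continuousAt
      .rfl (h ▸ hfg)) a.1, by
    obtain ⟨f, hf, rfl⟩ := exists_germ a
    exact ⟨C.pull φ f, GoodNear.pull hφ (h ▸ hf), rfl⟩⟩
  map_zero' := by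
    refine Subtype.ext (congrArg (fun f : M → C.V => (f : Germ (𝓝 y) C.V)) (?_ : C.pull φ 0 = 0))
    simpa using C.pull_add φ 0 0
  map_add' a b := by
    obtain ⟨f, hf, rfl⟩ := exists_germ a
    obtain ⟨g, hg, rfl⟩ := exists_germ b
    exact Subtype.ext (congrArg (fun f : M → C.V => (f : Germ (𝓝 y) C.V)) (C.pull_add φ f g))

theorem pullGerm_germ (φ : M → M) {x y : M} (h : φ y = x) (hφ : SmoothNear (n := n) φ y)
    (f : M → C.V) (hf : C.GoodNear f x) :
    pullGerm φ h hφ (C.germ f x hf) = C.germ (C.pull φ f) y (GoodNear.pull hφ (h ▸ hf)) := rfl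

end Coeff

namespace EtaleGroupoid

variable {n : ℕ} {G₀ G₁ : Type u}
  [TopologicalSpace G₀] [ChartedSpace (EuclideanSpace ℝ (Fin n)) G₀]
  [TopologicalSpace G₁] [ChartedSpace (EuclideanSpace ℝ (Fin n)) G₁]
  (G : EtaleGroupoid n G₀ G₁)

/-- The local inverse of `t` near `g`. -/
noncomputable def tInv (g : G₁) : G₀ → G₁ := (G.t_loc g).localInverse

/-- The local diffeomorphism of `G₀` defined by `g : x → y`: the map `s ∘ (t near g)⁻¹`, sending
`y` to `x`. -/
noncomputable def flow (g : G₁) : G₀ → G₀ := G.s ∘ G.tInv g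

theorem tInv_t (g : G₁) : G.tInv g (G.t g) = g :=
  (G.t_loc g).localInverse_left_inv (G.t_loc g).localInverse_mem_target

theorem flow_t (g : G₁) : G.flow g (G.t g) = G.s g := by
  rw [flow, Function.comp_apply, tInv_t]

theorem flow_of_eq {g : G₁} {x y : G₀} (hs : G.s g = x) (ht : G.t g = y) : G.flow g y = x := by
  rw [← ht, flow_t, hs]

theorem tInv_smooth (g : G₁) : ∀ᶠ z in 𝓝 (G.t g), ContMDiffAt (𝓡 n) (𝓡 n) ∞ (G.tInv g) z := by
  have h := G.t_loc g
  filter_upwards [h.localInverse_open_source.mem_nhds h.localInverse_mem_source] with z hz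
  exact h.localInverse_contMDiffOn.contMDiffAt (h.localInverse_open_source.mem_nhds hz)

theorem flow_smooth (g : G₁) {y : G₀} (ht : G.t g = y) : SmoothNear (n := n) (G.flow g) y := by
  subst ht
  exact (G.tInv_smooth g).mono fun z hz => (G.s_loc.contMDiff _).comp z hz

/-- A continuous local section of `t` through `g` agrees with the local inverse. -/
theorem eq_tInv {σ : G₀ → G₁} {y : G₀} {g : G₁} (hg : σ y = g) (hc : ContinuousAt σ y)
    (hσ : ∀ᶠ z in 𝓝 y, G.t (σ z) = z) : σ =ᶠ[𝓝 y] G.tInv g := by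
  subst hg
  filter_upwards [hσ, hc.eventually (G.t_loc (σ y)).localInverse_eventuallyEq_left] with z h1 h2
  simp only [Function.comp_apply, id] at h2
  rw [h1] at h2
  exact h2.symm

theorem tInv_near (g : G₁) : ∀ᶠ h in 𝓝 g, G.tInv g =ᶠ[𝓝 (G.t h)] G.tInv h := by
  have hl := G.t_loc g
  have hc : ContinuousAt G.t g := (G.t_loc g).contMDiffAt.continuousAt
  filter_upwards [hl.localInverse_eventuallyEq_left,
    hc.eventually (hl.localInverse_open_source.mem_nhds hl.localInverse_mem_source),
    hc.eventually (G.tInv_smooth g)] with h h1 h2 h3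
  refine G.eq_tInv h1 h3.continuousAt ?_
  filter_upwards [hl.localInverse_open_source.mem_nhds h2] with z hz
  exact hl.localInverse_right_inv hz

theorem flow_near (g : G₁) : ∀ᶠ h in 𝓝 g, G.flow g =ᶠ[𝓝 (G.t h)] G.flow h :=
  (G.tInv_near g).mono fun _ h => h.mono fun z hz => by simp [flow, hz]

theorem t_tInv (g : G₁) : ∀ᶠ z in 𝓝 (G.t g), G.t (G.tInv g z) = z :=
  (G.t_loc g).localInverse_eventuallyEq_right

theorem flow_e (x : G₀) : G.flow (G.e x) =ᶠ[𝓝 x] id := by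
  have := G.eq_tInv (g := G.e x) rfl G.e_loc.contMDiff.continuous.continuousAt
    (.of_forall G.t_e)
  filter_upwards [this] with z hz
  rw [flow, Function.comp_apply, ← hz, G.s_e]; rfl

theorem flow_m (g h : G₁) (w : G.t g = G.s h) :
    G.flow (G.m g h w) =ᶠ[𝓝 (G.t h)] G.flow g ∘ G.flow h := by
  classical
  have hh := G.t_tInv h
  have hfc : ContinuousAt (G.flow h) (G.t h) :=
    (G.flow_smooth h rfl).self_of_nhds.continuousAt
  have hfh : G.flow h (G.t h) = G.t g := (G.flow_t h).trans w.symm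
  have hg : ∀ᶠ z in 𝓝 (G.t h), G.t (G.tInv g (G.flow h z)) = G.flow h z :=
    hfc.eventually (hfh ▸ G.t_tInv g)
  let P : G₀ → G₁ × G₁ := fun z => (G.tInv g (G.flow h z), G.tInv h z)
  let σ : G₀ → G₁ := fun z => if hz : G.t (P z).1 = G.s (P z).2 then G.m _ _ hz else G.m g h w
  have hPt : P (G.t h) = (g, h) := by
    simp only [P, hfh, tInv_t]
  have hPc : ContinuousAt P (G.t h) := by
    refine ContinuousAt.prodMk (ContinuousAt.comp ?_ hfc)
      (G.tInv_smooth h).self_of_nhds.continuousAt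
    rw [hfh]; exact (G.tInv_smooth g).self_of_nhds.continuousAt
  have hσt : σ (G.t h) = G.m g h w := by
    have : G.t (P (G.t h)).1 = G.s (P (G.t h)).2 := by rw [hPt]; exact w
    simp only [σ, dif_pos this]
    congr 1 <;> rw [hPt]
  have hσc : ContinuousAt σ (G.t h) := by
    have key : ∀ᶠ z in 𝓝 (G.t h), G.t (P z).1 = G.s (P z).2 := hg
    let Q : G₀ → {p : G₁ × G₁ // G.t p.1 = G.s p.2} := fun z =>
      if hz : G.t (P z).1 = G.s (P z).2 then ⟨P z, hz⟩ else ⟨(g, h), w⟩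
    have hQ : ContinuousAt Q (G.t h) := by
      refine Topology.IsInducing.subtypeVal.continuousAt_iff.2 (hPc.congr ?_)
      filter_upwards [key] with z hz
      simp only [Function.comp_apply, Q, dif_pos hz]
    refine (G.continuous_m.continuousAt.comp hQ).congr ?_
    filter_upwards [key] with z hz
    simp only [Function.comp_apply, Q, σ, dif_pos hz]
  have := G.eq_tInv hσt hσc (by
    filter_upwards [hh, hg] with z h1 h2
    have : G.t (P z).1 = G.s (P z).2 := h2
    simp only [σ, dif_pos this, G.t_m]
    exact h1)
  filter_upwards [this, hg] with z h1 h2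
  have hz : G.t (P z).1 = G.s (P z).2 := h2
  rw [flow, Function.comp_apply, ← h1]
  simp only [σ, dif_pos hz, G.s_m]
  rfl

/-- The `G`-sheaf of germs of a natural sheaf on `G₀`: an arrow `g : x → y` acts by pull-back along
the inverse of the local diffeomorphism from `x` to `y` that it defines. -/
noncomputable def coeffShf (C : Coeff n G₀) : Shf G where
  stalk x := C.stalk x
  top := inferInstanceAs (TopologicalSpace C.Space)
  isLocalHomeomorph_pt := C.isLocalHomeomorph_pt
  continuous_zero := continuous_iff_continuousAt.2 fun x =>
    Coeff.continuousAt_of (C := C) 0 id continuousAt_id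
      (.of_forall fun y => ⟨.of_forall C.good_zero, rfl⟩)
  continuous_neg := continuous_iff_continuousAt.2 fun a => by
    obtain ⟨f, h, ha⟩ := Coeff.exists_pgerm (C := C) a
    refine Coeff.continuousAt_of (C := C) (-f) Etale.pt Coeff.continuous_pt.continuousAt ?_
    filter_upwards [Coeff.eventually_pgerm a f h ha] with b ⟨hb, e⟩
    rw [e]
    exact ⟨hb.neg, rfl⟩
  continuous_add := continuous_iff_continuousAt.2 fun p => by
    obtain ⟨f, h, ha⟩ := Coeff.exists_pgerm (C := C) p.1.1
    obtain ⟨g, k, hb⟩ := Coeff.exists_pgerm (C := C) p.1.2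
    have hc1 : ContinuousAt (fun p : {p : C.Space × C.Space // p.1.pt = p.2.pt} => p.1.1) p :=
      (continuous_fst.comp continuous_subtype_val).continuousAt
    have hc2 : ContinuousAt (fun p : {p : C.Space × C.Space // p.1.pt = p.2.pt} => p.1.2) p :=
      (continuous_snd.comp continuous_subtype_val).continuousAt
    refine Coeff.continuousAt_of (C := C) (f + g)
      (fun p : {p : C.Space × C.Space // p.1.pt = p.2.pt} => p.1.2.pt)
      (Coeff.continuous_pt.continuousAt.comp hc2) ?_
    filter_upwards [hc1.eventually (Coeff.eventually_pgerm _ f h ha),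
      hc2.eventually (Coeff.eventually_pgerm _ g k hb)] with q ⟨h1, e1⟩ ⟨h2, e2⟩
    obtain ⟨⟨⟨x, a⟩, ⟨y, b⟩⟩, hxy⟩ := q
    obtain rfl : x = y := hxy
    simp only [Coeff.pgerm, Etale.mk.injEq, heq_eq_eq, true_and] at e1 e2
    exact ⟨h1.add h2, by rw [e1, e2]; rfl⟩
  act g x y hs ht := C.pullGerm (G.flow g) (G.flow_of_eq hs ht) (G.flow_smooth g ht)
  continuous_act := continuous_iff_continuousAt.2 fun p => by
    obtain ⟨f, h, ha⟩ := Coeff.exists_pgerm (C := C) p.1.1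
    have hc1 : ContinuousAt (fun p : {p : C.Space × G₁ // G.s p.2 = p.1.pt} => p.1.1) p :=
      (continuous_fst.comp continuous_subtype_val).continuousAt
    have hc2 : ContinuousAt (fun p : {p : C.Space × G₁ // G.s p.2 = p.1.pt} => p.1.2) p :=
      (continuous_snd.comp continuous_subtype_val).continuousAt
    refine Coeff.continuousAt_of (C := C) (C.pull (G.flow p.1.2) f)
      (fun p : {p : C.Space × G₁ // G.s p.2 = p.1.pt} => G.t p.1.2)
      (G.t_loc.contMDiff.continuous.continuousAt.comp hc2) ?_
    filter_upwards [hc1.eventually (Coeff.eventually_pgerm _ f h ha),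
      hc2.eventually (G.flow_near p.1.2)] with q ⟨h1, e1⟩ e2
    obtain ⟨⟨⟨x, a⟩, g⟩, hx⟩ := q
    obtain rfl : G.s g = x := hx
    simp only [Coeff.pgerm, Etale.mk.injEq, heq_eq_eq, true_and] at e1
    change C.GoodNear f (G.s g) at h1
    have e1' : a = C.germ f (G.s g) h1 := e1
    clear e1
    subst e1'
    have hk := Coeff.pull_eventuallyEq (C := C) (f := f)
      (G.flow_smooth g rfl).self_of_nhds.continuousAt e2.symm .rfl
    have hgood := (Coeff.GoodNear.pull (C := C) (f := f) (G.flow_smooth g rfl)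
      ((G.flow_t g).symm ▸ h1))
    have hgood' : C.GoodNear (C.pull (G.flow p.1.2) f) (G.t g) :=
      (hgood.and (eventually_eventually_nhds.2 hk)).mono fun z hz => C.good_congr hz.2 hz.1
    exact ⟨hgood', Coeff.pgerm_congr (C := C) (hf := hgood) (hg := hgood') hk⟩
  act_e x a := by
    obtain ⟨f, h, rfl⟩ := Coeff.exists_germ a
    rw [Coeff.pullGerm_germ, Coeff.germ_eq]
    refine (Coeff.pull_eventuallyEq (G.flow_smooth _ (G.t_e x)).self_of_nhds.continuousAt
      (G.flow_e x) .rfl).trans ?_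
    rw [C.pull_id]
  act_m g h x y z hs ht hs' ht' a := by
    obtain ⟨f, hf, rfl⟩ := Coeff.exists_germ a
    rw [Coeff.pullGerm_germ, Coeff.pullGerm_germ, Coeff.pullGerm_germ, Coeff.germ_eq]
    subst ht'
    refine (Coeff.pull_eventuallyEq (G.flow_smooth _ (G.t_m ..)).self_of_nhds.continuousAt
      (G.flow_m g h _) .rfl).trans ?_
    have hc := (G.flow_smooth h rfl).self_of_nhds.continuousAt
    have hgs : SmoothNear (n := n) (G.flow g) (G.flow h (G.t h)) := by
      rw [G.flow_t, hs']; exact G.flow_smooth g ht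
    exact ((G.flow_smooth h rfl).and (hc.eventually hgs)).mono fun w hw =>
      C.pull_comp f hw.1 hw.2

end EtaleGroupoid
section forms
variable {n : ℕ} {M : Type u} [TopologicalSpace M] [ChartedSpace (EuclideanSpace ℝ (Fin n)) M]

/-- Complex-valued 1-forms on an `n`-manifold. -/
abbrev CForm (n : ℕ) (M : Type u) [TopologicalSpace M]
    [ChartedSpace (EuclideanSpace ℝ (Fin n)) M] : Type u :=
  ∀ x : M, TangentSpace (𝓡 n) x →L[ℝ] ℂ

/-- The pull-back `φ^* α` of a 1-form. -/
noncomputable def CForm.pull {N : Type u} [TopologicalSpace N]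
    [ChartedSpace (EuclideanSpace ℝ (Fin n)) N] (φ : N → M) (α : CForm n M) : CForm n N :=
  fun z => (α (φ z)).comp (mfderiv (𝓡 n) (𝓡 n) φ z)

/-- The differential of a complex function. -/
noncomputable def CForm.d (f : M → ℂ) : CForm n M := fun z => mfderiv (𝓡 n) 𝓘(ℝ, ℂ) f z

/-- `dlog f = f⁻¹ df` -/
noncomputable def CForm.dlog (f : M → ℂˣ) : CForm n M := fun z =>
  ((f z : ℂ)⁻¹) • CForm.d (fun w => (f w : ℂ)) z

variable [IsManifold (𝓡 n) ∞ M]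


/-- The 1-form `α` is smooth at `y`, as a section of the bundle `Hom(TM, ℂ)`. -/
def CForm.SmoothAt (α : CForm n M) (y : M) : Prop :=
  ContMDiffAt (𝓡 n) ((𝓡 n).prod 𝓘(ℝ, EuclideanSpace ℝ (Fin n) →L[ℝ] ℂ)) ∞
    (fun z => TotalSpace.mk' (EuclideanSpace ℝ (Fin n) →L[ℝ] ℂ)
      (E := fun z : M => TangentSpace (𝓡 n) z →L[ℝ] Trivial M ℂ z) z (α z)) y

theorem CForm.smoothAt_iff (α : CForm n M) (y : M) : α.SmoothAt y ↔
    ContMDiffAt (𝓡 n) 𝓘(ℝ, EuclideanSpace ℝ (Fin n) →L[ℝ] ℂ) ∞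
      (fun z => (α z).comp ((trivializationAt (EuclideanSpace ℝ (Fin n)) (TangentSpace (𝓡 n)) y).symmL ℝ z)) y := by
  rw [CForm.SmoothAt, contMDiffAt_hom_bundle]
  refine (and_iff_right (contMDiffAt_id (x := y))).trans
    (Iff.of_eq (congrArg (fun f => ContMDiffAt _ _ _ f y) ?_))
  funext z
  ext v
  simp [ContinuousLinearMap.inCoordinates]

theorem CForm.SmoothAt.neg {α : CForm n M} {y : M} (h : α.SmoothAt y) :
    CForm.SmoothAt (-α) y := h.neg_section

theorem CForm.SmoothAt.add {α β : CForm n M} {y : M} (h : α.SmoothAt y) (h' : β.SmoothAt y) :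
    CForm.SmoothAt (α + β) y := h.add_section h'

theorem CForm.smoothAt_zero (y : M) : CForm.SmoothAt (0 : CForm n M) y :=
  contMDiffAt_zeroSection (𝕜 := ℝ) (E := fun z : M => TangentSpace (𝓡 n) z →L[ℝ] Trivial M ℂ z)
    (F := EuclideanSpace ℝ (Fin n) →L[ℝ] ℂ)

theorem CForm.SmoothAt.pull {φ : M → M} {α : CForm n M} {y : M}
    (hφ : ContMDiffAt (𝓡 n) (𝓡 n) ∞ φ y) (h : α.SmoothAt (φ y)) : (α.pull φ).SmoothAt y := by
  rw [CForm.smoothAt_iff] at h ⊢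
  have h1 := h.comp y hφ
  have h2 := hφ.mfderiv_const (m := ∞) (by simp)
  refine (h1.clm_comp h2).congr_of_eventuallyEq ?_
  have hb := hφ.continuousAt.eventually ((trivializationAt (EuclideanSpace ℝ (Fin n))
    (TangentSpace (𝓡 n)) (φ y)).open_baseSet.mem_nhds (mem_baseSet_trivializationAt _ _ (φ y)))
  filter_upwards [hb] with z hz
  ext v
  simp only [CForm.pull, inTangentCoordinates, ContinuousLinearMap.inCoordinates,
    ContinuousLinearMap.comp_apply, Function.comp_apply, id]
  congr 1
  exact (Trivialization.symmL_continuousLinearMapAt _ hz _).symm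

theorem CForm.dlog_smoothAt {f : M → ℂˣ} {y : M}
    (hf : ContMDiffAt (𝓡 n) 𝓘(ℝ, ℂ) ∞ (fun z => (f z : ℂ)) y) :
    (CForm.dlog f : CForm n M).SmoothAt y := by
  rw [CForm.smoothAt_iff]
  have h1 : ContMDiffAt (𝓡 n) 𝓘(ℝ, ℂ) ∞ (fun z => ((f z : ℂ))⁻¹) y :=
    (contDiffAt_inv ℝ (f y).ne_zero).contMDiffAt.comp y hf
  have h1' := (ContinuousLinearMap.mul ℝ ℂ).contMDiff.contMDiffAt.comp y h1
  have h2 := hf.mfderiv_const (m := ∞) (by simp)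
  refine (h1'.clm_comp h2).congr_of_eventuallyEq (.of_forall fun z => ?_)
  ext v
  simp [CForm.dlog, CForm.d, inTangentCoordinates, ContinuousLinearMap.inCoordinates]
  rfl
end forms

section coeffs

variable {n : ℕ} {M : Type u} [TopologicalSpace M] [ChartedSpace (EuclideanSpace ℝ (Fin n)) M]

/-- `dlog`, as an operator from `ℂˣ`-valued functions, written additively, to 1-forms. -/
noncomputable def dlogOp (f : M → Additive ℂˣ) : M → (EuclideanSpace ℝ (Fin n) →L[ℝ] ℂ) :=
  CForm.dlog (n := n) (M := M) fun z => (f z).toMul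

theorem dlogOp_congr {f g : M → Additive ℂˣ} {y : M} (h : f =ᶠ[𝓝 y] g) :
    (dlogOp f : M → (EuclideanSpace ℝ (Fin n) →L[ℝ] ℂ)) =ᶠ[𝓝 y] dlogOp g := by
  filter_upwards [eventually_eventually_nhds.2 h] with z hz
  have hz' : (fun w => ((f w).toMul : ℂ)) =ᶠ[𝓝 z] fun w => ((g w).toMul : ℂ) :=
    hz.mono fun w hw => by simp only [hw]
  have e : CForm.d (n := n) (M := M) (fun w => ((f w).toMul : ℂ)) z =
      CForm.d (n := n) (M := M) (fun w => ((g w).toMul : ℂ)) z := hz'.mfderiv_eq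
  simp only [dlogOp, CForm.dlog]
  rw [e, hz.self_of_nhds]

theorem dlogOp_add {f g : M → Additive ℂˣ} {y : M}
    (hf : ContMDiffAt (𝓡 n) 𝓘(ℝ, ℂ) ∞ (fun z => ((f z).toMul : ℂ)) y)
    (hg : ContMDiffAt (𝓡 n) 𝓘(ℝ, ℂ) ∞ (fun z => ((g z).toMul : ℂ)) y) :
    (dlogOp (f + g) y : EuclideanSpace ℝ (Fin n) →L[ℝ] ℂ) = dlogOp f y + dlogOp g y := by
  have h := ((hf.mdifferentiableAt (by simp)).hasMFDerivAt.mul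
    (hg.mdifferentiableAt (by simp)).hasMFDerivAt).mfderiv
  have e : CForm.d (n := n) (M := M) (fun w => (((f + g) w).toMul : ℂ)) y =
      ((f y).toMul : ℂ) • CForm.d (n := n) (M := M) (fun w => ((g w).toMul : ℂ)) y +
      ((g y).toMul : ℂ) • CForm.d (n := n) (M := M) (fun w => ((f w).toMul : ℂ)) y := h
  have key : ∀ (a b : ℂ) (A B : EuclideanSpace ℝ (Fin n) →L[ℝ] ℂ), a ≠ 0 → b ≠ 0 →
      (a * b)⁻¹ • (a • B + b • A) = a⁻¹ • A + b⁻¹ • B := by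
    intro a b A B ha hb
    ext v
    simp only [_root_.smul_apply, _root_.add_apply, smul_eq_mul]
    field_simp
    ring
  simp only [dlogOp, CForm.dlog]
  rw [e]
  exact key _ _ _ _ (f y).toMul.ne_zero (g y).toMul.ne_zero

theorem dlogOp_comp {φ : M → M} {f : M → Additive ℂˣ} {y : M}
    (hφ : ContMDiffAt (𝓡 n) (𝓡 n) ∞ φ y)
    (hf : ContMDiffAt (𝓡 n) 𝓘(ℝ, ℂ) ∞ (fun z => ((f z).toMul : ℂ)) (φ y)) :
    (dlogOp (f ∘ φ) y : EuclideanSpace ℝ (Fin n) →L[ℝ] ℂ) =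
      CForm.pull (M := M) φ (dlogOp f : M → (EuclideanSpace ℝ (Fin n) →L[ℝ] ℂ)) y := by
  have h := mfderiv_comp y (hf.mdifferentiableAt (by simp)) (hφ.mdifferentiableAt (by simp))
  have e : CForm.d (n := n) (M := M) (fun w => (((f ∘ φ) w).toMul : ℂ)) y =
    (CForm.d (n := n) (M := M) (fun w => ((f w).toMul : ℂ)) (φ y)).comp
      (mfderiv (𝓡 n) (𝓡 n) φ y) := h
  simp only [dlogOp, CForm.dlog, CForm.pull]
  rw [e]
  rfl

variable (M) [IsManifold (𝓡 n) ∞ M]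

/-- The sheaf of smooth functions to `ℂˣ`, written additively. -/
def unitsCoeff : Coeff n M where
  V := Additive ℂˣ
  good f y := ContMDiffAt (𝓡 n) 𝓘(ℝ, ℂ) ∞ (fun z => ((f z).toMul : ℂ)) y
  good_congr h hf := hf.congr_of_eventuallyEq (h.symm.mono fun z hz => by simp only [hz])
  good_zero y := contMDiffAt_const
  good_neg {f y} hf := by
    have h1 : ContMDiffAt (𝓡 n) 𝓘(ℝ, ℂ) ∞ (fun z => (((f z).toMul : ℂ))⁻¹) y :=
      (contDiffAt_inv ℝ (f y).toMul.ne_zero).contMDiffAt.comp y hf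
    simpa using h1
  good_add {f g y} hf hg := by
    simpa using! (contDiff_mul (𝕜 := ℝ) (𝔸 := ℂ)).contMDiff.contMDiffAt.comp y (hf.prodMk_space hg)
  pull φ f := f ∘ φ
  pull_congr {φ ψ f g y} h1 h2 := by
    rw [Function.comp_apply, Function.comp_apply, ← h1.self_of_nhds, h2.self_of_nhds]
  pull_id _ := rfl
  pull_comp _ _ _ _ := rfl
  pull_add _ _ _ := rfl
  good_pull {φ f y} hφ hf := hf.comp y hφ

/-- The sheaf of smooth complex-valued 1-forms, `T_z M` being by definition the model space. -/
noncomputable def formCoeff : Coeff n M where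
  V := EuclideanSpace ℝ (Fin n) →L[ℝ] ℂ
  good α y := CForm.SmoothAt (M := M) α y
  good_congr {f g y} h hf := by
    refine ContMDiffAt.congr_of_eventuallyEq hf ?_
    filter_upwards [h] with z hz
    rw [hz]
  good_zero y := CForm.smoothAt_zero y
  good_neg h := h.neg
  good_add h h' := h.add h'
  pull φ α := CForm.pull (M := M) φ α
  pull_congr {φ ψ f g y} h1 h2 := by
    have e : f (φ y) = g (ψ y) := by rw [← h1.self_of_nhds, h2.self_of_nhds]
    have e' : mfderiv (𝓡 n) (𝓡 n) φ y = mfderiv (𝓡 n) (𝓡 n) ψ y := h1.mfderiv_eq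
    change (f (φ y)).comp (mfderiv (𝓡 n) (𝓡 n) φ y : EuclideanSpace ℝ (Fin n) →L[ℝ] _) =
      (g (ψ y)).comp (mfderiv (𝓡 n) (𝓡 n) ψ y : EuclideanSpace ℝ (Fin n) →L[ℝ] _)
    rw [e]
    exact congrArg _ e'
  pull_id f := by
    funext z
    change (f z).comp (mfderiv (𝓡 n) (𝓡 n) id z : EuclideanSpace ℝ (Fin n) →L[ℝ] _) = f z
    rw [mfderiv_id]
    rfl
  pull_comp {φ ψ} f {y} h1 h2 := by
    change (f (φ (ψ y))).comp (mfderiv (𝓡 n) (𝓡 n) (φ ∘ ψ) y : EuclideanSpace ℝ (Fin n) →L[ℝ] _) =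
      ((f (φ (ψ y))).comp (mfderiv (𝓡 n) (𝓡 n) φ (ψ y) : EuclideanSpace ℝ (Fin n) →L[ℝ] _)).comp
        (mfderiv (𝓡 n) (𝓡 n) ψ y : EuclideanSpace ℝ (Fin n) →L[ℝ] _)
    rw [mfderiv_comp y (h2.mdifferentiableAt (by simp)) (h1.mdifferentiableAt (by simp))]
    rfl
  pull_add _ _ _ := rfl
  good_pull hφ h := h.pull hφ

variable {M}

theorem dlogOp_good {f : M → Additive ℂˣ} {x : M} (hf : (unitsCoeff (n := n) M).GoodNear f x) :
    (formCoeff (n := n) M).GoodNear (dlogOp f) x :=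
  Eventually.mono hf fun _ h => CForm.dlog_smoothAt h

/-- `dlog` on germs. -/
noncomputable def dlogGerm (x : M) :
    (unitsCoeff (n := n) M).stalk x →+ (formCoeff (n := n) M).stalk x where
  toFun a := ⟨Germ.map' (dlogOp (n := n)) (fun _ _ h => dlogOp_congr h) a.1, by
    obtain ⟨f, hf, rfl⟩ := Coeff.exists_germ a
    exact ⟨dlogOp f, dlogOp_good hf, rfl⟩⟩
  map_zero' := by
    refine Subtype.ext (Germ.coe_eq.2 (.of_forall fun z => ?_))
    have : (dlogOp (0 + 0) z : EuclideanSpace ℝ (Fin n) →L[ℝ] ℂ) = _ :=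
      dlogOp_add (f := 0) (g := 0) contMDiffAt_const contMDiffAt_const
    rw [add_zero, left_eq_add] at this
    exact this
  map_add' a b := by
    obtain ⟨f, hf, rfl⟩ := Coeff.exists_germ a
    obtain ⟨g, hg, rfl⟩ := Coeff.exists_germ b
    exact Subtype.ext (Germ.coe_eq.2 ((hf.and hg).mono fun z h => dlogOp_add h.1 h.2))

theorem dlogGerm_germ (x : M) (f : M → Additive ℂˣ) (hf : (unitsCoeff (n := n) M).GoodNear f x) :
    dlogGerm x ((unitsCoeff (n := n) M).germ f x hf) =
      (formCoeff (n := n) M).germ (dlogOp f) x (dlogOp_good hf) := rfl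

end coeffs

namespace EtaleGroupoid

variable {n : ℕ} {G₀ G₁ : Type u}
  [TopologicalSpace G₀] [ChartedSpace (EuclideanSpace ℝ (Fin n)) G₀] [IsManifold (𝓡 n) ∞ G₀]
  [TopologicalSpace G₁] [ChartedSpace (EuclideanSpace ℝ (Fin n)) G₁]
  (G : EtaleGroupoid n G₀ G₁)

/-- The `G`-sheaf `ℂˣ_G` of germs of smooth functions to `ℂˣ`, written additively. -/
noncomputable def unitsShf : Shf G := G.coeffShf (unitsCoeff G₀)

/-- The `G`-sheaf `𝒜¹` of germs of smooth complex-valued 1-forms. -/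
noncomputable def formShf : Shf G := G.coeffShf (formCoeff G₀)

/-- The morphism `dlog : ℂˣ_G → 𝒜¹`. -/
noncomputable def dlogHom : G.unitsShf ⟶ G.formShf where
  app x := dlogGerm x
  continuous_app := continuous_iff_continuousAt.2 fun a => by
    obtain ⟨f, h, ha⟩ := Coeff.exists_pgerm (C := unitsCoeff G₀) a
    refine Coeff.continuousAt_of (C := formCoeff G₀) (dlogOp f) Etale.pt
      (Coeff.continuous_pt (C := unitsCoeff G₀)).continuousAt ?_
    filter_upwards [Coeff.eventually_pgerm (C := unitsCoeff G₀) a f h ha] with b ⟨hb, e⟩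
    rw [e]
    exact ⟨dlogOp_good hb, rfl⟩
  app_act g x y hs ht a := by
    obtain ⟨f, hf, rfl⟩ := Coeff.exists_germ (C := unitsCoeff G₀) a
    refine (Coeff.germ_eq (C := formCoeff G₀) (hf := dlogOp_good (Coeff.GoodNear.pull
      (G.flow_smooth g ht) ((G.flow_of_eq hs ht).symm ▸ hf)))
      (hg := Coeff.GoodNear.pull (G.flow_smooth g ht)
        ((G.flow_of_eq hs ht).symm ▸ dlogOp_good hf))).2 ?_
    have hc := (G.flow_smooth g ht).self_of_nhds.continuousAt
    have hf' : (unitsCoeff (n := n) G₀).GoodNear f (G.flow g y) := (G.flow_of_eq hs ht).symm ▸ hf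
    exact ((G.flow_smooth g ht).and (hc.eventually hf')).mono fun z hz => dlogOp_comp hz.1 hz.2

end EtaleGroupoid

namespace EtaleGroupoid

section complexes

variable {n : ℕ} {G₀ G₁ : Type u}
  [TopologicalSpace G₀] [ChartedSpace (EuclideanSpace ℝ (Fin n)) G₀]
  [TopologicalSpace G₁] [ChartedSpace (EuclideanSpace ℝ (Fin n)) G₁]
  {G : EtaleGroupoid n G₀ G₁}

/-- Every `G_k`, `k ≥ 0`, is a disjoint union of contractible spaces. -/
def IsLeray (G : EtaleGroupoid n G₀ G₁) : Prop :=
  ∀ k : ℕ, ∃ (ι : Type u) (U : ι → Opens (Nerve G k)),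
    Pairwise (Function.onFun Disjoint U) ∧ (⨆ i, U i) = ⊤ ∧ ∀ i, ContractibleSpace (U i)

/-- Transport of stalks along an equality of points. -/
def Shf.tr (F : Shf G) {x y : G₀} (h : x = y) : F.stalk x →+ F.stalk y :=
  h ▸ AddMonoidHom.id (F.stalk x)

theorem Shf.mk_tr (F : Shf G) {x y : G₀} (h : x = y) (a : F.stalk x) :
    (⟨y, F.tr h a⟩ : Etale F.stalk) = ⟨x, a⟩ := by
  subst h; rfl

theorem Shf.mk_act (F : Shf G) (g : G₁) {x y : G₀} (hs : G.s g = x) (ht : G.t g = y)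
    (a : F.stalk x) :
    (⟨G.t g, F.act g hs rfl a⟩ : Etale F.stalk) = ⟨y, F.act g hs ht a⟩ := by
  subst ht; rfl

/-- `(δ_i σ)(q) = σ(d_i q)` for `i ≤ k`. -/
def Cochain.inner (F : Shf G) {k : ℕ} (i : Fin (k + 1)) : Cochain F k →+ Cochain F (k + 1) where
  toFun σ := ⟨fun q => F.tr (Nerve.last_face i q) (σ.1 (q.face i.castSucc)), by
    change Continuous _
    simp only [Shf.mk_tr]
    exact σ.2.comp (Nerve.continuous_face _)⟩
  map_zero' := by ext q; simp
  map_add' σ τ := by ext q; simp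

/-- `(δ_{k+1} σ)(g₁, …, g_{k+1}) = σ(g₁, …, g_k) · g_{k+1}`. -/
def Cochain.outer (F : Shf G) {k : ℕ} : Cochain F k →+ Cochain F (k + 1) where
  toFun σ := ⟨fun q => F.act (q.arr (Fin.last k)) (Nerve.last_face_last q).symm
      (q.t_arr (Fin.last k)) (σ.1 (q.face (Fin.last (k + 1)))), by
    have h1 : Continuous fun q : Nerve G (k + 1) =>
        (⟨((⟨(q.face (Fin.last (k + 1))).last, σ.1 (q.face (Fin.last (k + 1)))⟩ : Etale F.stalk),
          q.arr (Fin.last k)), (Nerve.last_face_last q).symm⟩ :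
          {p : Etale F.stalk × G₁ // G.s p.2 = p.1.pt}) :=
      ((σ.2.comp (Nerve.continuous_face _)).prodMk (Nerve.continuous_arr _)).subtype_mk _
    refine (F.continuous_act.comp h1).congr fun q => ?_
    exact F.mk_act _ _ (q.t_arr (Fin.last k)) _⟩
  map_zero' := by ext q; exact map_zero _
  map_add' σ τ := by ext q; exact map_add _ _ _

/-- The horizontal differential `δ = ∑ (-1)^i δ_i`. -/
def Cochain.delta (F : Shf G) (k : ℕ) : Cochain F k →+ Cochain F (k + 1) :=
  ∑ i : Fin (k + 1), (-1 : ℤ) ^ (i : ℕ) • Cochain.inner F i + (-1 : ℤ) ^ (k + 1) • Cochain.outer F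

/-- The map on cochains induced by a morphism of sheaves. -/
def Cochain.map {A B : Shf G} (f : A ⟶ B) (k : ℕ) : Cochain A k →+ Cochain B k where
  toFun σ := ⟨fun q => f.app _ (σ.1 q), f.continuous_app.comp σ.2⟩
  map_zero' := by ext q; simp
  map_add' σ τ := by ext q; simp

/-- The degree `m` part of the total complex of the Čech double complex `Γ(G_k, ε_k^* K^l)`. -/
abbrev Tot (K : CochainComplex (Shf G) ℕ) (m : ℕ) : Type u :=
  ∀ p : {p : ℕ × ℕ // p.1 + p.2 = m}, Cochain (K.X p.1.2) p.1.1

namespace Tot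

/-- The vertical part of the total differential. -/
def vert (K : CochainComplex (Shf G) ℕ) {m : ℕ} (c : Tot K m) :
    ∀ k l : ℕ, k + l = m + 1 → Cochain (K.X l) k
  | _, 0, _ => 0
  | k, l + 1, h => Cochain.map (K.d l (l + 1)) k (c ⟨(k, l), by omega⟩)

/-- The horizontal part of the total differential. -/
def horiz (K : CochainComplex (Shf G) ℕ) {m : ℕ} (c : Tot K m) :
    ∀ k l : ℕ, k + l = m + 1 → Cochain (K.X l) k
  | 0, _, _ => 0
  | k + 1, l, h => (-1 : ℤ) ^ (l + 1) • Cochain.delta (K.X l) k (c ⟨(k, l), by omega⟩)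

/-- The total differential, `d + (-1)^{l+1} δ` on `C^{k,l}`. -/
def D (K : CochainComplex (Shf G) ℕ) (m : ℕ) (c : Tot K m) : Tot K (m + 1) :=
  fun p => vert K c p.1.1 p.1.2 p.2 + horiz K c p.1.1 p.1.2 p.2

/-- The map of total complexes induced by a morphism of complexes of sheaves. -/
def map {K T : CochainComplex (Shf G) ℕ} (j : K ⟶ T) {m : ℕ} (c : Tot K m) : Tot T m :=
  fun p => Cochain.map (j.f p.1.2) p.1.1 (c p)

/-- The element of total degree 1 with components `a` in `C^{1,0}` and `b` in `C^{0,1}`. -/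
def pair {K : CochainComplex (Shf G) ℕ} (a : Cochain (K.X 0) 1) (b : Cochain (K.X 1) 0) :
    Tot K 1
  | ⟨(0, 1), _⟩ => b
  | ⟨(1, 0), _⟩ => a
  | ⟨(0, 0), h⟩ => absurd h (by omega)
  | ⟨(0, l + 2), h⟩ => absurd h (by simp)
  | ⟨(1, l + 1), h⟩ => absurd h (by simp)
  | ⟨(k + 2, l), h⟩ => absurd h (by simp; omega)

end Tot

/-- The group `Γ_inv(G, F)` of invariant sections. -/
def invSections (F : Shf G) : AddSubgroup (∀ x, F.stalk x) where
  carrier := {σ | Continuous (fun x => (⟨x, σ x⟩ : Etale F.stalk)) ∧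
    ∀ g : G₁, F.act g rfl rfl (σ (G.s g)) = σ (G.t g)}
  zero_mem' := ⟨F.continuous_zero, fun g => by simp⟩
  neg_mem' h := ⟨F.continuous_neg.comp h.1, fun g => by simp [h.2 g]⟩
  add_mem' {a b} ha hb := by
    have h : Continuous fun x => (⟨((⟨x, a x⟩ : Etale F.stalk), (⟨x, b x⟩ : Etale F.stalk)), rfl⟩ :
        {p : Etale F.stalk × Etale F.stalk // p.1.pt = p.2.pt}) :=
      (Continuous.prodMk ha.1 hb.1).subtype_mk _
    exact ⟨F.continuous_add.comp h, fun g => by simp [ha.2 g, hb.2 g]⟩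

namespace invSections

/-- The map on invariant sections induced by a morphism of sheaves. -/
def map {A B : Shf G} (f : A ⟶ B) : invSections A →+ invSections B where
  toFun σ := ⟨fun x => f.app x (σ.1 x), f.continuous_app.comp σ.2.1, fun g => by
    change B.act g rfl rfl (f.app _ (σ.1 (G.s g))) = f.app _ (σ.1 (G.t g))
    rw [← σ.2.2 g, f.app_act]⟩
  map_zero' := by ext q; simp
  map_add' σ τ := by ext q; simp

/-- The inclusion `Γ_inv(G, F) → Γ(G_0, F)`. -/
def toCochain {F : Shf G} (σ : invSections F) : Cochain F 0 :=
  ⟨fun q => σ.1 q.last, σ.2.1.comp Nerve.continuous_last⟩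

end invSections

/-- Cocycles of the complex `Γ_inv(G, T^•)`. -/
def invZ (T : CochainComplex (Shf G) ℕ) (m : ℕ) : AddSubgroup (invSections (T.X m)) :=
  (invSections.map (T.d m (m + 1))).ker

/-- Coboundaries of the complex `Γ_inv(G, T^•)`. -/
def invB (T : CochainComplex (Shf G) ℕ) : ∀ m, AddSubgroup (invSections (T.X m))
  | 0 => ⊥
  | m + 1 => (invSections.map (T.d m (m + 1))).range

/-- The cohomology of the complex `Γ_inv(G, T^•)`. -/
abbrev InvH (T : CochainComplex (Shf G) ℕ) (m : ℕ) : Type u :=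
  invZ T m ⧸ (invB T m).addSubgroupOf (invZ T m)

/-- `j : K → T` is a quasi-isomorphism into a complex of injective `G`-sheaves, so that
`InvH T m` is the hypercohomology `ℍ^m(G, K)`.  A morphism of complexes of sheaves is a
quasi-isomorphism if and only if it is one on all stalks. -/
structure IsInjRes {K T : CochainComplex (Shf G) ℕ} (j : K ⟶ T) : Prop where
  injective : ∀ m, Injective (T.X m)
  quasiIso : ∀ x : G₀,
    QuasiIso (((Shf.stalkFunctor (G := G) x).mapHomologicalComplex (ComplexShape.up ℕ)).map j)

end complexes

variable {n : ℕ} {G₀ G₁ : Type u}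
  [TopologicalSpace G₀] [ChartedSpace (EuclideanSpace ℝ (Fin n)) G₀] [IsManifold (𝓡 n) ∞ G₀]
  [TopologicalSpace G₁] [ChartedSpace (EuclideanSpace ℝ (Fin n)) G₁] [IsManifold (𝓡 n) ∞ G₁]
  (G : EtaleGroupoid n G₀ G₁)

/-- The terms of the complex `ℂˣ(2)_G`. -/
noncomputable def units2X : ℕ → Shf G
  | 0 => G.unitsShf
  | 1 => G.formShf
  | _ + 2 => Shf.zeroShf G

/-- The differentials of the complex `ℂˣ(2)_G`. -/
noncomputable def units2d : ∀ m, G.units2X m ⟶ G.units2X (m + 1)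
  | 0 => G.dlogHom
  | _ + 1 => 0

/-- The complex of `G`-sheaves `ℂˣ(2)_G`: `dlog : ℂˣ_G → 𝒜¹` in degrees 0 and 1. -/
noncomputable def units2 : CochainComplex (Shf G) ℕ :=
  CochainComplex.of G.units2X G.units2d fun m => by
    cases m <;> exact Limits.comp_zero

/-- A line bundle with connection over `G`: a smooth morphism of groupoids `ρ` from `G` to
`* × ℂˣ ⇉ *` and a smooth complex 1-form `A` on `G₀` with `s^* A - t^* A = dlog ρ₁`. -/
@[ext] structure LineBundle where
  ρ : AlgGroupoid.Hom G.toAlgGroupoid unitsGroupoid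
  smooth_ρ : ContMDiff (𝓡 n) 𝓘(ℝ, ℂ) ∞ fun g => (ρ.arr g : ℂ)
  A : CForm n G₀
  smooth_A : ∀ x, A.SmoothAt x
  compat : CForm.pull G.s A - CForm.pull G.t A = CForm.dlog ρ.arr

namespace LineBundle

variable {G}

/-- The tensor product of line bundles with connection. -/
noncomputable def tensor (L L' : LineBundle G) : LineBundle G where
  ρ :=
    { obj := fun _ => PUnit.unit
      arr := fun g => L.ρ.arr g * L'.ρ.arr g
      s_arr := fun _ => rfl
      t_arr := fun _ => rfl
      arr_e := fun x => by rw [L.ρ.arr_e, L'.ρ.arr_e]; exact mul_one 1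
      arr_i := fun g => by rw [L.ρ.arr_i, L'.ρ.arr_i]; exact (mul_inv _ _).symm
      arr_m := fun g h w => by
        rw [L.ρ.arr_m g h w, L'.ρ.arr_m g h w]; exact mul_mul_mul_comm _ _ _ _ }
  smooth_ρ := by
    simpa using! (contDiff_mul (𝕜 := ℝ) (𝔸 := ℂ)).contMDiff.comp
      (L.smooth_ρ.prodMk_space L'.smooth_ρ)
  A := L.A + L'.A
  smooth_A x := (L.smooth_A x).add (L'.smooth_A x)
  compat := by
    have h1 := congrFun L.compat
    have h2 := congrFun L'.compat
    funext g
    have h3 := dlogOp_add (n := n) (f := fun g => Additive.ofMul (L.ρ.arr g))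
      (g := fun g => Additive.ofMul (L'.ρ.arr g)) (L.smooth_ρ g) (L'.smooth_ρ g)
    refine Eq.trans ?_ (Eq.symm h3)
    refine Eq.trans ?_ (congrArg₂ (· + ·) (h1 g) (h2 g))
    exact add_sub_add_comm (CForm.pull G.s L.A g) (CForm.pull G.s L'.A g)
      (CForm.pull G.t L.A g) (CForm.pull G.t L'.A g)

/-- An isomorphism of line bundles with connection: a smooth natural isomorphism `f : ρ ⇒ ρ'`
compatible with the connections `d + A` and `d + A'`, that is, `(d + A') f = f (d + A)`. -/
def Iso (L L' : LineBundle G) : Prop :=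
  ∃ f : G₀ → ℂˣ, ContMDiff (𝓡 n) 𝓘(ℝ, ℂ) ∞ (fun x => (f x : ℂ)) ∧
    (∀ g, f (G.s g) * L'.ρ.arr g = L.ρ.arr g * f (G.t g)) ∧
    CForm.dlog f + L'.A = L.A

/-- The section `g ↦ germ at t(g) of ρ₁ ∘ (t near g)⁻¹` of `ε_1^* ℂˣ_G = t^* ℂˣ_G` over `G₁`. -/
noncomputable def ρCochain (L : LineBundle G) : Cochain G.unitsShf 1 :=
  ⟨fun q => (unitsCoeff (n := n) G₀).germ
      (fun z => Additive.ofMul (L.ρ.arr (G.tInv (q.arr 0) z))) q.last (by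
        have : q.last = G.t (q.arr 0) := (q.t_arr 0).symm
        rw [this]
        exact (G.tInv_smooth (q.arr 0)).mono fun z hz => (L.smooth_ρ _).comp z hz), by
    refine continuous_iff_continuousAt.2 fun q => ?_
    refine Coeff.continuousAt_of (C := unitsCoeff G₀)
      (fun z => Additive.ofMul (L.ρ.arr (G.tInv (q.arr 0) z))) Nerve.last
      Nerve.continuous_last.continuousAt ?_
    have hc : Continuous fun q : Nerve G 1 => q.arr 0 := Nerve.continuous_arr 0
    filter_upwards [hc.continuousAt.eventually (G.tInv_near (q.arr 0)),
      hc.continuousAt.eventually ((G.t_loc.contMDiff.continuous.continuousAt).eventually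
        (eventually_eventually_nhds.2 (G.tInv_smooth (q.arr 0))))] with r h1 h2
    have e : r.last = G.t (r.arr 0) := (r.t_arr 0).symm
    rw [← e] at h1 h2
    exact ⟨h2.mono fun z hz => (L.smooth_ρ _).comp z hz,
      Coeff.pgerm_congr (C := unitsCoeff G₀) (h1.symm.mono fun z hz => by
        change Additive.ofMul (L.ρ.arr _) = Additive.ofMul (L.ρ.arr _)
        rw [hz])⟩⟩

/-- The section `x ↦ germ of A at x` of `ε_0^* 𝒜¹ = 𝒜¹` over `G_0`. -/
noncomputable def ACochain (L : LineBundle G) : Cochain G.formShf 0 :=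
  ⟨fun q => (formCoeff (n := n) G₀).germ L.A q.last (.of_forall L.smooth_A), by
    refine continuous_iff_continuousAt.2 fun q => ?_
    exact Coeff.continuousAt_of (C := formCoeff G₀) L.A Nerve.last
      Nerve.continuous_last.continuousAt (.of_forall fun r => ⟨.of_forall L.smooth_A, rfl⟩)⟩

/-- The pair `(ρ, A)` as an element of total degree 1 of the Čech complex of `ℂˣ(2)_G`. -/
noncomputable def cochain (L : LineBundle G) : Tot G.units2 1 :=
  Tot.pair (K := G.units2) L.ρCochain L.ACochain

end LineBundle

theorem dlog_mul {f g : G₀ → ℂˣ}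
    (hf : ContMDiff (𝓡 n) 𝓘(ℝ, ℂ) ∞ fun x => (f x : ℂ))
    (hg : ContMDiff (𝓡 n) 𝓘(ℝ, ℂ) ∞ fun x => (g x : ℂ)) :
    (CForm.dlog (f * g) : CForm n G₀) = CForm.dlog f + CForm.dlog g :=
  funext fun x => dlogOp_add (n := n) (f := fun x => Additive.ofMul (f x))
    (g := fun x => Additive.ofMul (g x)) (hf x) (hg x)

theorem dlog_one : (CForm.dlog (1 : G₀ → ℂˣ) : CForm n G₀) = 0 := by
  have := dlog_mul (n := n) (G₀ := G₀) (f := 1) (g := 1) contMDiff_const contMDiff_const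
  rwa [mul_one, left_eq_add] at this

/-- Isomorphism of line bundles with connection is an equivalence relation. -/
def lineBundleSetoid : Setoid (LineBundle G) where
  r := LineBundle.Iso
  iseqv := by
    refine ⟨fun L => ⟨1, contMDiff_const, fun g => by simp, ?_⟩, ?_, ?_⟩
    · rw [dlog_one, zero_add]
    · rintro L L' ⟨f, hf, h, h'⟩
      have hi : ContMDiff (𝓡 n) 𝓘(ℝ, ℂ) ∞ fun x => ((f⁻¹ : G₀ → ℂˣ) x : ℂ) := fun x => by
        have : ContMDiffAt (𝓡 n) 𝓘(ℝ, ℂ) ∞ (fun z => ((f z : ℂ))⁻¹) x :=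
          (contDiffAt_inv ℝ (f x).ne_zero).contMDiffAt.comp x (hf x)
        simpa using this
      refine ⟨f⁻¹, hi, fun g => ?_, ?_⟩
      · rw [Pi.inv_apply, Pi.inv_apply, inv_mul_eq_iff_eq_mul, ← mul_assoc, h g,
          mul_inv_cancel_right]
      · have := dlog_mul (n := n) hf hi
        rw [mul_inv_cancel, dlog_one] at this
        rw [← h', ← add_assoc, add_comm (CForm.dlog f⁻¹), ← this, zero_add]
    · rintro L L' L'' ⟨f, hf, h, h'⟩ ⟨k, hk, e, e'⟩
      refine ⟨f * k, ?_, fun g => ?_, ?_⟩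
      · simpa using! (contDiff_mul (𝕜 := ℝ) (𝔸 := ℂ)).contMDiff.comp (hf.prodMk_space hk)
      · rw [Pi.mul_apply, Pi.mul_apply, mul_assoc, e g, ← mul_assoc, h g, mul_assoc]
      · rw [dlog_mul hf hk, add_assoc, e', h']

/-- The set of isomorphism classes of line bundles with connection over `G`. -/
abbrev LineBundleClass : Type u := Quotient G.lineBundleSetoid

end EtaleGroupoid

/-! Since `t` is a local diffeomorphism, a section of `t^* ℂˣ_G` over `G₁` is the same thing as a
smooth function `ρ : G₁ → ℂˣ`: its value at `g` is the germ at `t g` of `ρ` composed with the local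
inverse of `t`. In these terms a total 1-cocycle is a multiplicative `ρ`
(`Represents.delta_eq_zero_iff`) with a form `A` such that `s^* A - t^* A = dlog ρ`
(`Represents.dlog_add_delta_eq_zero_iff`), and a cochain cobounding the difference of two cocycles
is an isomorphism of bundles. This settles part 1.

Injective sheaves come from cofree ones: the functions to `J` on the arrows with source in an open
set form a `G`-sheaf, and a map into it is an arbitrary family of additive maps from the stalks to
`J`. It is injective when `J` is (`Cofree.injective_cofree`), and evaluation at unit arrows shows
that its Čech complex is exact in degree one. An injective sheaf is a retract of a cofree one and
inherits this exactness (`Cochain.exists_delta_eq_of_injective`).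

From a bundle to hypercohomology: write `j ρ = δ β` with `β` in `Γ(G₀, T⁰)`; then `τ = d β + j A` is
invariant and closed. Conversely, a closed invariant `τ` has to be written as `d β + j A` globally
over `G₀` (`TwoTermRes.exists_map_eq`). Locally this is possible because `j` is a quasi-isomorphism,
and the local choices differ by a `ℂˣ`-valued Čech cocycle on the manifold `G₀`. That cocycle splits
(`exists_smooth_units_split`): contracting the pieces of `G₀` yields logarithms that still satisfy
the cocycle identity, and a partition of unity splits these. Then `δ β` and `-δ A` together lift
uniquely to a cochain `ρ` (`Cohomologous.exists_cocycle`). Finally `Cohomologous.iff_exists` matches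
isomorphisms of bundles with coboundaries of invariant sections, so the correspondence descends to a
bijection of classes. -/

set_option linter.unusedSectionVars false

namespace EtaleGroupoid

/-! ### Continuous sections of `G`-sheaves, and kernels. -/

section sections

variable {n : ℕ} {G₀ G₁ : Type u}
  [TopologicalSpace G₀] [ChartedSpace (EuclideanSpace ℝ (Fin n)) G₀]
  [TopologicalSpace G₁] [ChartedSpace (EuclideanSpace ℝ (Fin n)) G₁]
  {G : EtaleGroupoid n G₀ G₁}

namespace Shf

variable (F : Shf G) {Y : Type*} [TopologicalSpace Y] {p : Y → G₀}

/-- The lift `σ` of `p : Y → G₀` to the étalé space of `F` is continuous at `y`. -/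
def ContAt (σ : ∀ y, F.stalk (p y)) (y : Y) : Prop :=
  ContinuousAt (fun y => (⟨p y, σ y⟩ : Etale F.stalk)) y

variable {F}

theorem ContAt.base {σ : ∀ y, F.stalk (p y)} {y : Y} (h : F.ContAt σ y) : ContinuousAt p y :=
  ContinuousAt.comp (f := fun y => (⟨p y, σ y⟩ : Etale F.stalk)) F.continuous_pt.continuousAt h

/-- Two continuous lifts that agree at a point agree near it. -/
theorem ContAt.eventuallyEq {σ τ : ∀ y, F.stalk (p y)} {y : Y} (hσ : F.ContAt σ y)
    (hτ : F.ContAt τ y) (h : σ y = τ y) : ∀ᶠ z in 𝓝 y, σ z = τ z := by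
  obtain ⟨e, he, heq⟩ := F.isLocalHomeomorph_pt ⟨p y, σ y⟩
  have he' : (⟨p y, τ y⟩ : Etale F.stalk) ∈ e.source := h ▸ he
  filter_upwards [hσ.eventually (e.open_source.mem_nhds he),
    hτ.eventually (e.open_source.mem_nhds he')] with z h1 h2
  have := e.injOn h1 h2 (by rw [← heq])
  simpa using this

theorem ContAt.congr {σ τ : ∀ y, F.stalk (p y)} {y : Y} (hσ : F.ContAt σ y)
    (h : ∀ᶠ z in 𝓝 y, σ z = τ z) : F.ContAt τ y :=
  ContinuousAt.congr (f := fun y => (⟨p y, σ y⟩ : Etale F.stalk)) hσ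
    (h.mono fun z hz => by simp only [hz])

theorem ContAt.comp {Z : Type*} [TopologicalSpace Z] {σ : ∀ y, F.stalk (p y)} {f : Z → Y} {z : Z}
    (hσ : F.ContAt σ (f z)) (hf : ContinuousAt f z) :
    F.ContAt (p := p ∘ f) (fun z => σ (f z)) z :=
  ContinuousAt.comp (g := fun y => (⟨p y, σ y⟩ : Etale F.stalk)) hσ hf

theorem ContAt.zero {y : Y} (hp : ContinuousAt p y) : F.ContAt (fun y => (0 : F.stalk (p y))) y :=
  F.continuous_zero.continuousAt.comp hp

theorem ContAt.neg {σ : ∀ y, F.stalk (p y)} {y : Y} (hσ : F.ContAt σ y) :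
    F.ContAt (fun y => -σ y) y :=
  ContinuousAt.comp (f := fun y => (⟨p y, σ y⟩ : Etale F.stalk)) F.continuous_neg.continuousAt hσ

theorem ContAt.add {σ τ : ∀ y, F.stalk (p y)} {y : Y} (hσ : F.ContAt σ y) (hτ : F.ContAt τ y) :
    F.ContAt (fun y => σ y + τ y) y := by
  have h : ContinuousAt (fun x => (⟨((⟨p x, σ x⟩ : Etale F.stalk), (⟨p x, τ x⟩ : Etale F.stalk)),
      rfl⟩ : {p : Etale F.stalk × Etale F.stalk // p.1.pt = p.2.pt})) y :=
    IsInducing.subtypeVal.continuousAt_iff.2 (ContinuousAt.prodMk hσ hτ)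
  exact F.continuous_add.continuousAt.comp h

theorem ContAt.sub {σ τ : ∀ y, F.stalk (p y)} {y : Y} (hσ : F.ContAt σ y) (hτ : F.ContAt τ y) :
    F.ContAt (fun y => σ y - τ y) y := by
  simpa only [sub_eq_add_neg] using hσ.add hτ.neg

theorem ContAt.app {A B : Shf G} (f : A ⟶ B) {σ : ∀ y, A.stalk (p y)} {y : Y} (hσ : A.ContAt σ y) :
    B.ContAt (fun y => f.app (p y) (σ y)) y :=
  ContinuousAt.comp (f := fun y => (⟨p y, σ y⟩ : Etale A.stalk)) f.continuous_app.continuousAt hσ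

theorem ContAt.act {σ : ∀ y, F.stalk (p y)} {y : Y} (hσ : F.ContAt σ y) {γ : Y → G₁}
    (hγ : ContinuousAt γ y) {q : Y → G₀} (hs : ∀ y, G.s (γ y) = p y) (ht : ∀ y, G.t (γ y) = q y) :
    F.ContAt (fun y => F.act (γ y) (hs y) (ht y) (σ y)) y := by
  have h : ContinuousAt (fun x => (⟨((⟨p x, σ x⟩ : Etale F.stalk), γ x), hs x⟩ :
      {p : Etale F.stalk × G₁ // G.s p.2 = p.1.pt})) y :=
    IsInducing.subtypeVal.continuousAt_iff.2 (ContinuousAt.prodMk hσ hγ)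
  refine (F.continuous_act.continuousAt.comp h).congr (.of_forall fun z => ?_)
  exact F.mk_act _ _ (ht z) _

/-- The inverse of a chart of the étalé space at `a` is a local section. It is extended by `0` to
all of `G₀`, which is why continuity is claimed only near `x`. -/
theorem exists_section {x : G₀} (a : F.stalk x) : ∃ σ : ∀ z, F.stalk z, σ x = a ∧
    ∀ᶠ z in 𝓝 x, F.ContAt (p := id) σ z := by
  classical
  obtain ⟨e, he, heq⟩ := F.isLocalHomeomorph_pt ⟨x, a⟩
  have hx : x ∈ e.target := by simpa [← heq] using e.map_source he
  have hpt : ∀ z ∈ e.target, (e.symm z).pt = z := fun z hz => by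
    have := e.right_inv hz
    rwa [← heq] at this
  have hsx : e.symm x = ⟨x, a⟩ := by
    have := e.left_inv he
    rwa [← heq] at this
  have key : ∀ z (hz : z ∈ e.target), (⟨z, F.tr (hpt z hz) (e.symm z).val⟩ : Etale F.stalk) =
      e.symm z := fun z hz => F.mk_tr _ _
  refine ⟨fun z => if hz : z ∈ e.target then F.tr (hpt z hz) (e.symm z).val else 0, ?_, ?_⟩
  · have := (key x hx).trans hsx
    simpa [hx] using this
  · filter_upwards [e.open_target.mem_nhds hx] with z hz
    refine (e.continuousAt_symm hz).congr ?_
    filter_upwards [e.open_target.mem_nhds hz] with w hw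
    simp only [id, dif_pos hw]
    exact (key w hw).symm

/-- A local section of `F` through `a`. -/
noncomputable def sec {x : G₀} (a : F.stalk x) : ∀ z, F.stalk z := (exists_section a).choose

theorem sec_self {x : G₀} (a : F.stalk x) : sec a x = a := (exists_section a).choose_spec.1

theorem sec_contAt {x : G₀} (a : F.stalk x) : ∀ᶠ z in 𝓝 x, F.ContAt (p := id) (sec a) z :=
  (exists_section a).choose_spec.2

/-- A continuous section agrees near a point with the chosen local section through its value. -/
theorem ContAt.eventually_eq_sec {σ : ∀ y, F.stalk (p y)} {y : Y} (hσ : F.ContAt σ y) :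
    ∀ᶠ z in 𝓝 y, σ z = sec (σ y) (p z) :=
  hσ.eventuallyEq ((sec_contAt (σ y)).self_of_nhds.comp (f := p) hσ.base) (sec_self _).symm

theorem tr_act (F : Shf G) {g : G₁} {x y z : G₀} (e : y = z) (hs : G.s g = x) (ht : G.t g = y)
    (a : F.stalk x) : F.tr e (F.act g hs ht a) = F.act g hs (ht.trans e) a := by
  subst e; rfl

theorem app_tr {A B : Shf G} (f : A ⟶ B) {x y : G₀} (e : x = y) (a : A.stalk x) :
    f.app y (A.tr e a) = B.tr e (f.app x a) := by
  subst e; rfl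

theorem tr_section (F : Shf G) {Z : Type*} (p : Z → G₀) (σ : ∀ z, F.stalk (p z)) {z w : Z}
    (h : z = w) (e : p z = p w) : F.tr e (σ z) = σ w := by
  subst h; rfl

@[simp] theorem comp_app {A B C : Shf G} (f : A ⟶ B) (g : B ⟶ C) (x : G₀) (a : A.stalk x) :
    (f ≫ g).app x a = g.app x (f.app x a) := rfl

theorem hom_ext {A B : Shf G} {f g : A ⟶ B} (h : ∀ x a, f.app x a = g.app x a) : f = g :=
  Hom.ext (funext fun x => AddMonoidHom.ext (h x))

theorem mono_of_injective {A B : Shf G} (f : A ⟶ B) (h : ∀ x, Function.Injective (f.app x)) :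
    Mono f :=
  ⟨fun u v e => hom_ext fun x a => h x (by rw [← comp_app, e, comp_app])⟩

section kernel

variable {A B : Shf G} (f : A ⟶ B)

/-- The inclusion of the total space of the kernel of `f`. -/
def kerIncl (a : Etale fun x => (f.app x).ker) : Etale A.stalk := ⟨a.pt, a.val.1⟩

theorem kerIncl_injective : Function.Injective (kerIncl f) := by
  rintro ⟨x, a, ha⟩ ⟨y, b, hb⟩ h
  simp only [kerIncl, Etale.mk.injEq] at h
  obtain ⟨rfl, h⟩ := h
  obtain rfl := eq_of_heq h
  rfl

/-- The range is the locus where the continuous lifts `f` and `0` agree, and two continuous lifts to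
an étalé space agree on an open set. -/
theorem isOpen_range_kerIncl : IsOpen (Set.range (kerIncl f)) := by
  have hr : Set.range (kerIncl f) = {a | f.app a.pt a.val = 0} := by
    ext ⟨x, a⟩
    constructor
    · rintro ⟨⟨y, b, hb⟩, h⟩
      simp only [kerIncl, Etale.mk.injEq] at h
      obtain ⟨rfl, h⟩ := h
      obtain rfl := eq_of_heq h
      exact hb
    · exact fun h => ⟨⟨x, a, h⟩, rfl⟩
  rw [hr, isOpen_iff_mem_nhds]
  intro a ha
  have h1 : B.ContAt (p := (Etale.pt : Etale A.stalk → G₀)) (fun a => f.app a.pt a.val) a :=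
    f.continuous_app.continuousAt
  exact h1.eventuallyEq (.zero A.continuous_pt.continuousAt) ha

/-- The kernel of a morphism of abelian `G`-sheaves. -/
def kernel : Shf G where
  stalk x := (f.app x).ker
  top := .induced (kerIncl f) inferInstance
  isLocalHomeomorph_pt := by
    let _ : TopologicalSpace (Etale fun x => (f.app x).ker) := .induced (kerIncl f) inferInstance
    have : IsOpenEmbedding (kerIncl f) :=
      ⟨⟨⟨rfl⟩, kerIncl_injective f⟩, isOpen_range_kerIncl f⟩
    exact A.isLocalHomeomorph_pt.comp this.isLocalHomeomorph
  continuous_zero := continuous_induced_rng.2 A.continuous_zero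
  continuous_neg := by
    let _ : TopologicalSpace (Etale fun x => (f.app x).ker) := .induced (kerIncl f) inferInstance
    have hc : Continuous (kerIncl f) := continuous_induced_dom
    exact continuous_induced_rng.2 (A.continuous_neg.comp hc)
  continuous_add := by
    let _ : TopologicalSpace (Etale fun x => (f.app x).ker) := .induced (kerIncl f) inferInstance
    have hc : Continuous (kerIncl f) := continuous_induced_dom
    refine continuous_induced_rng.2 ?_
    have h : Continuous fun p : {p : (Etale fun x => (f.app x).ker) × (Etale fun x =>
        (f.app x).ker) // p.1.pt = p.2.pt} => (⟨(kerIncl f p.1.1, kerIncl f p.1.2), p.2⟩ :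
        {p : Etale A.stalk × Etale A.stalk // p.1.pt = p.2.pt}) :=
      Continuous.subtype_mk ((hc.comp (continuous_fst.comp continuous_subtype_val)).prodMk
        (hc.comp (continuous_snd.comp continuous_subtype_val))) _
    refine (A.continuous_add.comp h).congr ?_
    rintro ⟨⟨⟨x, a⟩, ⟨y, b⟩⟩, e⟩
    obtain rfl : x = y := e
    rfl
  act g x y hs ht := ((A.act g hs ht).comp (f.app x).ker.subtype).codRestrict _ fun a => by
    have : f.app x a.1 = 0 := a.2
    change f.app y (A.act g hs ht a.1) = 0
    rw [f.app_act, this, map_zero]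
  continuous_act := by
    let _ : TopologicalSpace (Etale fun x => (f.app x).ker) := .induced (kerIncl f) inferInstance
    have hc : Continuous (kerIncl f) := continuous_induced_dom
    refine continuous_induced_rng.2 ?_
    have h : Continuous fun p : {p : (Etale fun x => (f.app x).ker) × G₁ // G.s p.2 = p.1.pt} =>
        (⟨(kerIncl f p.1.1, p.1.2), p.2⟩ : {p : Etale A.stalk × G₁ // G.s p.2 = p.1.pt}) :=
      Continuous.subtype_mk ((hc.comp (continuous_fst.comp continuous_subtype_val)).prodMk
        (continuous_snd.comp continuous_subtype_val)) _
    exact A.continuous_act.comp h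
  act_e x a := Subtype.ext (A.act_e x a.1)
  act_m g h x y z hs ht hs' ht' a := Subtype.ext (A.act_m g h hs ht hs' ht' a.1)

/-- The inclusion of the kernel. -/
def kernelι : kernel f ⟶ A where
  app x := (f.app x).ker.subtype
  continuous_app := continuous_induced_dom
  app_act _ _ _ _ _ _ := rfl

/-- A monomorphism kills the inclusion of its kernel, so that inclusion is zero. This turns the
categorical notion into a statement on stalks, where injectivity of abelian groups applies. -/
theorem injective_of_mono [Mono f] (x : G₀) : Function.Injective (f.app x) := by
  have h : kernelι f = 0 := by
    rw [← cancel_mono f]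
    exact hom_ext fun x a =>
      (show f.app x a.1 = 0 from a.2).trans (map_zero (f.app x)).symm
  rw [injective_iff_map_eq_zero]
  intro a ha
  exact congrArg (fun u : kernel f ⟶ A => u.app x (⟨a, ha⟩ : (f.app x).ker)) h

end kernel

end Shf

end sections

end EtaleGroupoid

namespace EtaleGroupoid

/-! ### Cofree `G`-sheaves: universal property and injectivity. -/

section cofree

variable {n : ℕ} {G₀ G₁ : Type u}
  [TopologicalSpace G₀] [ChartedSpace (EuclideanSpace ℝ (Fin n)) G₀]
  [TopologicalSpace G₁] [ChartedSpace (EuclideanSpace ℝ (Fin n)) G₁]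
  (G : EtaleGroupoid n G₀ G₁)

theorem m_congr {g g' h h' : G₁} (e : g = g') (e' : h = h') (w : G.t g = G.s h) :
    G.m g h w = G.m g' h' (e ▸ e' ▸ w) := by
  subst e e'; rfl

theorem tInv_e (x : G₀) : ∀ᶠ z in 𝓝 x, G.tInv (G.e x) z = G.e z := by
  have := G.eq_tInv (g := G.e x) rfl G.e_loc.contMDiff.continuous.continuousAt
    (.of_forall G.t_e)
  exact this.mono fun z hz => hz.symm

theorem continuous_t : Continuous G.t := G.t_loc.contMDiff.continuous

theorem continuous_s : Continuous G.s := G.s_loc.contMDiff.continuous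

theorem tInv_continuousAt (g : G₁) : ∀ᶠ z in 𝓝 (G.t g), ContinuousAt (G.tInv g) z :=
  (G.tInv_smooth g).mono fun _ h => h.continuousAt

theorem flow_continuousAt (g : G₁) {y : G₀} (ht : G.t g = y) : ContinuousAt (G.flow g) y :=
  (G.flow_smooth g ht).self_of_nhds.continuousAt

/-- The product of the local sections of `t` through `g` and `h` is a continuous local section
through `gh`, and such a section is unique by `eq_tInv`. In contrast to `flow_m`, the arrow itself
is retained and not only its source. -/
theorem tInv_m (g h : G₁) (w : G.t g = G.s h) : ∀ᶠ z in 𝓝 (G.t h),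
    ∃ w' : G.t (G.tInv g (G.flow h z)) = G.s (G.tInv h z),
      G.tInv (G.m g h w) z = G.m _ _ w' := by
  classical
  have hfc := G.flow_continuousAt h rfl
  have hfh : G.flow h (G.t h) = G.t g := (G.flow_t h).trans w.symm
  let P : G₀ → G₁ × G₁ := fun z => (G.tInv g (G.flow h z), G.tInv h z)
  have key : ∀ᶠ z in 𝓝 (G.t h), G.t (P z).1 = G.s (P z).2 :=
    hfc.eventually (hfh ▸ G.t_tInv g)
  -- Away from `t h` the two arrows need not be composable; the constant pair `(g, h)` makes the map
  -- total.
  let Q : G₀ → {p : G₁ × G₁ // G.t p.1 = G.s p.2} := fun z =>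
    if hz : G.t (P z).1 = G.s (P z).2 then ⟨P z, hz⟩ else ⟨(g, h), w⟩
  have hPc : ContinuousAt P (G.t h) := by
    refine ContinuousAt.prodMk (ContinuousAt.comp ?_ hfc) (G.tInv_continuousAt h).self_of_nhds
    rw [hfh]; exact (G.tInv_continuousAt g).self_of_nhds
  have hQ : ContinuousAt Q (G.t h) := by
    refine IsInducing.subtypeVal.continuousAt_iff.2 (hPc.congr ?_)
    filter_upwards [key] with z hz
    simp only [Function.comp_apply, Q, dif_pos hz]
  have hQh : Q (G.t h) = ⟨(g, h), w⟩ := by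
    have e : P (G.t h) = (g, h) := by simp only [P, hfh, tInv_t]
    have hz : G.t (P (G.t h)).1 = G.s (P (G.t h)).2 := by rw [e]; exact w
    simp only [Q, dif_pos hz]
    exact Subtype.ext e
  have := G.eq_tInv (σ := fun z => G.m (Q z).1.1 (Q z).1.2 (Q z).2) (y := G.t h) (g := G.m g h w)
    (by simp only [hQh]) (G.continuous_m.continuousAt.comp hQ) (by
      filter_upwards [key, G.t_tInv h] with z hz h2
      simp only [G.t_m, Q, dif_pos hz]
      exact h2)
  filter_upwards [this, key] with z h1 hz
  refine ⟨hz, ?_⟩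
  rw [← h1]
  simp only [Q, dif_pos hz, P]

open Classical in
/-- Left translation by the local section of `t` through `h`. -/
noncomputable def ltrans (h k : G₁) : G₁ :=
  -- The condition holds once `s k` is close to `t h`, so the default value `k` is invisible to
  -- germs along `comap G.s (𝓝 (G.t h))`.
  if w : G.t (G.tInv h (G.s k)) = G.s k then G.m _ k w else k

variable {G}

theorem ltrans_of {h k : G₁} (w : G.t (G.tInv h (G.s k)) = G.s k) :
    G.ltrans h k = G.m _ k w := dif_pos w

theorem ltrans_eq {h k : G₁} (w : G.t h = G.s k) : G.ltrans h k = G.m h k w := by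
  have e : G.tInv h (G.s k) = h := by rw [← w, tInv_t]
  rw [ltrans_of (by rw [e, w]), G.m_congr e rfl]

theorem s_ltrans {h k : G₁} (w : G.t (G.tInv h (G.s k)) = G.s k) :
    G.s (G.ltrans h k) = G.flow h (G.s k) := by
  rw [ltrans_of w, G.s_m]; rfl

theorem eventually_source {p : G₀ → Prop} {x : G₀} (h : ∀ᶠ z in 𝓝 x, p z) :
    ∀ᶠ k in comap G.s (𝓝 x), p (G.s k) := h.comap G.s

theorem ltrans_e (x : G₀) : G.ltrans (G.e x) =ᶠ[comap G.s (𝓝 x)] id := by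
  filter_upwards [eventually_source (G.tInv_e x)] with k hk
  have w : G.t (G.tInv (G.e x) (G.s k)) = G.s k := by rw [hk, G.t_e]
  rw [ltrans_of w, G.m_congr hk rfl, G.e_m]; rfl

/-- Translation moves the source of an arrow by `flow h`, which sends `y` to `x`. Precomposition
therefore carries germs at `x` to germs at `y`: this is the action on the cofree sheaf. -/
theorem tendsto_ltrans {h : G₁} {x y : G₀} (hs : G.s h = x) (ht : G.t h = y) :
    Tendsto (G.ltrans h) (comap G.s (𝓝 y)) (comap G.s (𝓝 x)) := by
  subst hs ht
  refine tendsto_comap_iff.2 ?_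
  have h1 : Tendsto (G.flow h ∘ G.s) (comap G.s (𝓝 (G.t h))) (𝓝 (G.s h)) := by
    have := (G.flow_continuousAt h rfl).tendsto
    rw [G.flow_t] at this
    exact this.comp tendsto_comap
  refine h1.congr' ?_
  filter_upwards [eventually_source (G.t_tInv h)] with k hk
  exact (s_ltrans hk).symm

theorem ltrans_m (g h : G₁) (w : G.t g = G.s h) :
    G.ltrans (G.m g h w) =ᶠ[comap G.s (𝓝 (G.t h))] G.ltrans g ∘ G.ltrans h := by
  filter_upwards [eventually_source (G.t_tInv h), eventually_source (G.tInv_m g h w)]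
    with k h1 ⟨w', e⟩
  have e1 : G.s (G.ltrans h k) = G.flow h (G.s k) := s_ltrans h1
  have w2 : G.t (G.tInv g (G.s (G.ltrans h k))) = G.s (G.ltrans h k) := by
    rw [e1, w']; rfl
  have w3 : G.t (G.tInv (G.m g h w) (G.s k)) = G.s k := by rw [e, G.t_m, h1]
  rw [Function.comp_apply, ltrans_of w3, ltrans_of w2, G.m_congr e rfl,
    G.m_congr (congrArg (G.tInv g) e1) (ltrans_of h1)]
  exact G.assoc _ _ _ _ _

/-- One function on arrows computes the translates by all arrows near `h`; this gives continuity of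
the action on the cofree sheaf. -/
theorem ltrans_near (h : G₁) :
    ∀ᶠ h' in 𝓝 h, G.ltrans h =ᶠ[comap G.s (𝓝 (G.t h'))] G.ltrans h' := by
  filter_upwards [G.tInv_near h] with h' e
  filter_upwards [eventually_source e] with k hk
  unfold ltrans
  rw [hk]

theorem eventually_germ_eq {J : Type*} {φ ψ : G₁ → J} {x : G₀} (h : φ =ᶠ[comap G.s (𝓝 x)] ψ) :
    ∀ᶠ y in 𝓝 x, φ =ᶠ[comap G.s (𝓝 y)] ψ := by
  have := eventually_comap.1 h
  filter_upwards [eventually_eventually_nhds.2 this] with y hy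
  exact eventually_comap.2 hy

variable (G) (J : Type u)

/-- The stalk of the cofree `G`-sheaf. -/
abbrev CofreeStalk (x : G₀) : Type u := Germ (comap G.s (𝓝 x)) J

namespace Cofree

variable {G J}

/-- The germ of `φ` at `x`, as a point of the étalé space. -/
def pgerm (φ : G₁ → J) (x : G₀) : Etale (G.CofreeStalk J) := ⟨x, (φ : Germ (comap G.s (𝓝 x)) J)⟩

/-- The finest topology in which `x ↦ pgerm φ x` is continuous for every function `φ` on arrows.
Each `φ` gives a section over all of `G₀`. -/
instance : TopologicalSpace (Etale (G.CofreeStalk J)) where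
  IsOpen S := ∀ (φ : G₁ → J) (x : G₀), pgerm φ x ∈ S → ∀ᶠ y in 𝓝 x, pgerm φ y ∈ S
  isOpen_univ _ _ _ := .of_forall fun _ => trivial
  isOpen_inter S T hS hT φ x hx := (hS φ x hx.1).and (hT φ x hx.2)
  isOpen_sUnion 𝒮 h𝒮 φ x := by
    rintro ⟨S, hS, hx⟩
    exact (h𝒮 S hS φ x hx).mono fun _ hy => ⟨S, hS, hy⟩

theorem exists_pgerm (a : Etale (G.CofreeStalk J)) : ∃ φ, a = pgerm φ a.pt := by
  obtain ⟨x, a⟩ := a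
  induction a using Germ.inductionOn with | _ φ => exact ⟨φ, rfl⟩

theorem pgerm_congr {φ ψ : G₁ → J} {x : G₀} (h : φ =ᶠ[comap G.s (𝓝 x)] ψ) :
    pgerm φ x = pgerm (G := G) ψ x := by
  rw [pgerm, pgerm, Germ.coe_eq.2 h]

theorem pgerm_eq {φ ψ : G₁ → J} {x : G₀} (h : pgerm φ x = pgerm (G := G) ψ x) :
    φ =ᶠ[comap G.s (𝓝 x)] ψ := by
  simpa [pgerm] using h

theorem isOpen_section (φ : G₁ → J) :
    IsOpen {a : Etale (G.CofreeStalk J) | a = pgerm φ a.pt} := by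
  intro ψ x hx
  filter_upwards [eventually_germ_eq (pgerm_eq hx)] with y hy
  exact pgerm_congr hy

theorem eventually_pgerm (a : Etale (G.CofreeStalk J)) (φ : G₁ → J) (ha : a = pgerm φ a.pt) :
    ∀ᶠ b in 𝓝 a, b = pgerm φ b.pt := (isOpen_section φ).mem_nhds ha

theorem continuous_pt : Continuous (Etale.pt : Etale (G.CofreeStalk J) → G₀) :=
  continuous_def.2 fun _ hU _ _ hx => hU.mem_nhds hx

theorem continuousAt_of {X : Type*} [TopologicalSpace X] {F : X → Etale (G.CofreeStalk J)} {x : X}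
    (φ : G₁ → J) (p : X → G₀) (hp : ContinuousAt p x) (hF : ∀ᶠ y in 𝓝 x, F y = pgerm φ (p y)) :
    ContinuousAt F x := by
  intro S hS
  obtain ⟨T, hTS, hT, hxT⟩ := mem_nhds_iff.1 hS
  rw [hF.self_of_nhds] at hxT
  refine mem_map.2 ?_
  filter_upwards [hF, hp.eventually (hT φ _ hxT)] with y hy hy'
  exact hTS (hy ▸ hy')

theorem isLocalHomeomorph_pt : IsLocalHomeomorph (Etale.pt : Etale (G.CofreeStalk J) → G₀) := by
  refine IsLocalHomeomorph.mk _ fun a => ?_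
  obtain ⟨φ, ha⟩ := exists_pgerm a
  exact ⟨{  toFun := Etale.pt, invFun := pgerm φ
            source := {a | a = pgerm φ a.pt}, target := Set.univ
            map_source' := fun _ _ => trivial
            map_target' := fun _ _ => rfl
            left_inv' := fun _ hb => hb.symm
            right_inv' := fun _ _ => rfl
            open_source := isOpen_section φ
            open_target := isOpen_univ
            continuousOn_toFun := continuous_pt.continuousOn
            continuousOn_invFun := fun y _ => ContinuousAt.continuousWithinAt <|
              continuousAt_of φ id continuousAt_id (.of_forall fun _ => rfl) },
          ha, fun _ _ => rfl⟩

end Cofree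

variable [AddCommGroup J]

/-- The cofree abelian `G`-sheaf on `J`, representing `F ↦ ∏ₓ Hom(Fₓ, J)`: its sections over an
open set `U` are the functions to `J` on the arrows with source in `U`. -/
noncomputable def cofree : Shf G where
  stalk := G.CofreeStalk J
  isLocalHomeomorph_pt := Cofree.isLocalHomeomorph_pt
  continuous_zero := continuous_iff_continuousAt.2 fun _ =>
    Cofree.continuousAt_of (J := J) 0 id continuousAt_id (.of_forall fun _ => rfl)
  continuous_neg := continuous_iff_continuousAt.2 fun a => by
    obtain ⟨φ, ha⟩ := Cofree.exists_pgerm a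
    refine Cofree.continuousAt_of (-φ) Etale.pt Cofree.continuous_pt.continuousAt ?_
    filter_upwards [Cofree.eventually_pgerm a φ ha] with b e
    rw [e]
    rfl
  continuous_add := continuous_iff_continuousAt.2 fun p => by
    obtain ⟨φ, ha⟩ := Cofree.exists_pgerm p.1.1
    obtain ⟨ψ, hb⟩ := Cofree.exists_pgerm p.1.2
    have hc1 := (continuous_fst.comp continuous_subtype_val).continuousAt (x := p)
    have hc2 := (continuous_snd.comp continuous_subtype_val).continuousAt (x := p)
    refine Cofree.continuousAt_of (φ + ψ) (fun p => p.1.2.pt)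
      (Cofree.continuous_pt.continuousAt.comp hc2) ?_
    filter_upwards [hc1.eventually (Cofree.eventually_pgerm _ φ ha),
      hc2.eventually (Cofree.eventually_pgerm _ ψ hb)] with q e1 e2
    obtain ⟨⟨⟨x, a⟩, ⟨y, b⟩⟩, hxy⟩ := q
    obtain rfl : x = y := hxy
    simp only [Function.comp_apply, Cofree.pgerm, Etale.mk.injEq, heq_eq_eq, true_and] at e1 e2
    rw [e1, e2]; rfl
  act g x y hs ht :=
    { toFun := fun a => a.compTendsto (G.ltrans g) (tendsto_ltrans hs ht)
      map_zero' := rfl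
      map_add' := fun a b => by
        induction a, b using Germ.inductionOn₂ with | _ φ ψ => rfl }
  continuous_act := continuous_iff_continuousAt.2 fun p => by
    obtain ⟨φ, ha⟩ := Cofree.exists_pgerm p.1.1
    have hc1 := (continuous_fst.comp continuous_subtype_val).continuousAt (x := p)
    have hc2 := (continuous_snd.comp continuous_subtype_val).continuousAt (x := p)
    refine Cofree.continuousAt_of (φ ∘ G.ltrans p.1.2) (fun p => G.t p.1.2)
      (G.continuous_t.continuousAt.comp hc2) ?_
    filter_upwards [hc1.eventually (Cofree.eventually_pgerm _ φ ha),
      hc2.eventually (ltrans_near (G := G) p.1.2)] with q e1 e2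
    obtain ⟨⟨⟨x, a⟩, g⟩, hx⟩ := q
    obtain rfl : G.s g = x := hx
    simp only [Function.comp_apply, Cofree.pgerm, Etale.mk.injEq, heq_eq_eq, true_and] at e1 e2
    subst e1
    exact Cofree.pgerm_congr (φ := φ ∘ G.ltrans g) (e2.symm.fun_comp φ)
  act_e x a := by
    induction a using Germ.inductionOn with | _ φ =>
    exact Germ.coe_eq.2 ((ltrans_e x).fun_comp φ)
  act_m g h x y z hs ht hs' ht' a := by
    induction a using Germ.inductionOn with | _ φ =>
    subst ht'
    exact Germ.coe_eq.2 ((ltrans_m g h (ht.trans hs'.symm)).fun_comp φ)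

namespace Cofree

variable {G J}

/-- The germ of `φ` at `x`. -/
def germ (φ : G₁ → J) (x : G₀) : (G.cofree J).stalk x := (φ : Germ (comap G.s (𝓝 x)) J)

theorem germ_eq {φ ψ : G₁ → J} {x : G₀} :
    (germ φ x : (G.cofree J).stalk x) = germ ψ x ↔ φ =ᶠ[comap G.s (𝓝 x)] ψ := Germ.coe_eq

theorem exists_germ {x : G₀} (a : (G.cofree J).stalk x) : ∃ φ, a = germ φ x := by
  induction a using Germ.inductionOn with | _ φ => exact ⟨φ, rfl⟩

theorem act_germ (φ : G₁ → J) (g : G₁) {x y : G₀} (hs : G.s g = x) (ht : G.t g = y) :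
    (G.cofree J).act g hs ht (germ φ x) = germ (φ ∘ G.ltrans g) y := rfl

theorem germ_sub (φ ψ : G₁ → J) (x : G₀) :
    (germ (φ - ψ) x : (G.cofree J).stalk x) = germ φ x - germ ψ x := rfl

theorem contAt_germ (φ : G₁ → J) {Y : Type*} [TopologicalSpace Y] {p : Y → G₀} {y : Y}
    (hp : ContinuousAt p y) : (G.cofree J).ContAt (p := p) (fun y => germ φ (p y)) y :=
  continuousAt_of φ p hp (.of_forall fun _ => rfl)

theorem _root_.EtaleGroupoid.Shf.ContAt.eventually_germ {Y : Type*} [TopologicalSpace Y] {p : Y → G₀}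
    {σ : ∀ y, (G.cofree J).stalk (p y)} {y : Y} (hσ : (G.cofree J).ContAt σ y) {φ : G₁ → J}
    (h : σ y = germ φ (p y)) : ∀ᶠ z in 𝓝 y, σ z = germ φ (p z) :=
  hσ.eventuallyEq (contAt_germ φ hσ.base) h

/-- Evaluation of a germ at the unit arrow. -/
def ev (x : G₀) : (G.cofree J).stalk x →+ J where
  toFun a := Quotient.liftOn' a (fun φ => φ (G.e x)) fun φ ψ h => by
    have h' : ∀ᶠ k in comap G.s (𝓝 x), φ k = ψ k := h
    exact (eventually_comap.1 h').self_of_nhds (G.e x) (G.s_e x)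
  map_zero' := rfl
  map_add' a b := by
    induction a, b using Germ.inductionOn₂ with | _ φ ψ => rfl

theorem ev_germ (φ : G₁ → J) (x : G₀) : ev x (germ φ x : (G.cofree J).stalk x) = φ (G.e x) := rfl

/-- Translating the unit at `t g` by `g` gives `g` back. Hence `ev` together with the action
recovers all values of `φ`, which is the source of the universal property. -/
theorem ev_act_germ (φ : G₁ → J) (g : G₁) :
    ev (G.t g) ((G.cofree J).act g rfl rfl (germ φ (G.s g))) = φ g := by
  rw [act_germ, ev_germ, Function.comp_apply, ltrans_eq (G.s_e _).symm, G.m_e]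

/-- A germ is determined by the values of its translates at units. -/
theorem eq_germ {F : Shf G} {x : G₀} {u : F ⟶ G.cofree J} (a : F.stalk x) (σ : ∀ z, F.stalk z)
    (hσ : F.ContAt (p := id) σ x) (ha : σ x = a) :
    u.app x a = germ (fun k => ev (G.t k) (u.app _ (F.act k rfl rfl (σ (G.s k))))) x := by
  obtain ⟨φ, hφ⟩ := exists_germ (u.app x a)
  have h := (hσ.app u).eventually_germ (φ := φ) (by simp only [ha]; exact hφ)
  rw [hφ, germ_eq]
  filter_upwards [eventually_source h] with k hk
  simp only [id] at hk
  rw [u.app_act, hk, ev_act_germ]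

/-- Uniqueness in the universal property: by equivariance the value of `u.app x a` at an arrow is
`ev` of the image of a translate of a local section through `a`. -/
theorem hom_ext {F : Shf G} {u v : F ⟶ G.cofree J}
    (h : ∀ x a, ev x (u.app x a) = ev x (v.app x a)) : u = v := by
  refine Shf.hom_ext fun x a => ?_
  rw [eq_germ a (Shf.sec a) (Shf.sec_contAt a).self_of_nhds (Shf.sec_self a),
    eq_germ a (Shf.sec a) (Shf.sec_contAt a).self_of_nhds (Shf.sec_self a)]
  simp only [h]

section lift

variable {F : Shf G} (θ : ∀ x, F.stalk x →+ J)

theorem _root_.EtaleGroupoid.Shf.act_section (σ : ∀ z, F.stalk z) {g g' : G₁} (e : g = g')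
    {x x' y : G₀} (hs : G.s g = x) (hs' : G.s g' = x') (ht : G.t g = y) (ht' : G.t g' = y) :
    F.act g hs ht (σ x) = F.act g' hs' ht' (σ x') := by
  subst e hs hs'; rfl

/-- The function on arrows given by a local section of `F`. -/
def liftFun (σ : ∀ z, F.stalk z) (k : G₁) : J := θ (G.t k) (F.act k rfl rfl (σ (G.s k)))

theorem liftFun_congr {σ τ : ∀ z, F.stalk z} {x : G₀} (h : ∀ᶠ z in 𝓝 x, σ z = τ z) :
    liftFun θ σ =ᶠ[comap G.s (𝓝 x)] liftFun θ τ := by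
  filter_upwards [eventually_source h] with k hk
  simp only [liftFun, hk]

/-- Independence of the chosen section: any continuous section through `a` may be used to compute
`lift`, which reduces additivity and equivariance to a good choice of section. -/
theorem germ_liftFun {x : G₀} {a : F.stalk x} (σ : ∀ z, F.stalk z)
    (hσ : F.ContAt (p := id) σ x) (ha : σ x = a) :
    (germ (liftFun θ (Shf.sec a)) x : (G.cofree J).stalk x) = germ (liftFun θ σ) x :=
  germ_eq.2 (liftFun_congr θ ((Shf.sec_contAt a).self_of_nhds.eventuallyEq hσ
    ((Shf.sec_self a).trans ha.symm)))

/-- The morphism to a cofree sheaf given by maps on stalks. -/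
noncomputable def lift : F ⟶ G.cofree J where
  app x :=
    { toFun := fun a => germ (liftFun θ (Shf.sec a)) x
      map_zero' := by
        rw [germ_liftFun θ (fun _ => 0) (.zero continuousAt_id) rfl]
        exact germ_eq.2 (.of_forall fun k => by simp [liftFun])
      map_add' := fun a b => by
        have h := ((Shf.sec_contAt a).self_of_nhds.add (Shf.sec_contAt b).self_of_nhds)
        rw [germ_liftFun θ _ h (by simp only [Shf.sec_self])]
        exact germ_eq.2 (.of_forall fun k => by simp [liftFun]) }
  continuous_app := continuous_iff_continuousAt.2 fun a => by
    have h1 : F.ContAt (p := (Etale.pt : Etale F.stalk → G₀)) (fun a => a.val) a := continuousAt_id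
    have h2 := F.continuous_pt.continuousAt.eventually (Shf.sec_contAt a.val)
    refine continuousAt_of (liftFun θ (Shf.sec a.val)) Etale.pt F.continuous_pt.continuousAt ?_
    filter_upwards [h1.eventually_eq_sec, h2] with b hb hb'
    exact congrArg (Etale.mk (S := G.CofreeStalk J) b.pt) (germ_liftFun θ _ hb' hb.symm)
  app_act g x y hs ht a := by
    classical
    subst hs ht
    -- The section through `a` translated by the arrows near `g`; it passes through `a g` and is
    -- continuous at `t g`. The value `0` occurs only where the local inverse of `t` is not a
    -- section.
    let τ : ∀ z, F.stalk z := fun z => if w : G.t (G.tInv g z) = z then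
      F.act (G.tInv g z) rfl w (Shf.sec a (G.s (G.tInv g z))) else 0
    have hτ : F.ContAt (p := id) τ (G.t g) := by
      have h1 : F.ContAt (p := fun z => G.s (G.tInv g z))
          (fun z => Shf.sec a (G.s (G.tInv g z))) (G.t g) := by
        refine Shf.ContAt.comp (p := id) (f := fun z => G.s (G.tInv g z)) ?_
          (G.flow_continuousAt g rfl)
        rw [tInv_t]
        exact (Shf.sec_contAt a).self_of_nhds
      have h2 := h1.act (G.tInv_continuousAt g).self_of_nhds (fun _ => rfl) (fun _ => rfl)
      refine ContinuousAt.congr h2 ?_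
      filter_upwards [G.t_tInv g] with z hz
      simp only [id, τ, dif_pos hz]
      exact F.mk_act _ _ hz _
    have hτg : τ (G.t g) = F.act g rfl rfl a := by
      have w : G.t (G.tInv g (G.t g)) = G.t g := by rw [tInv_t]
      simp only [τ, dif_pos w]
      rw [Shf.act_section (Shf.sec a) (G.tInv_t g) rfl rfl w rfl, Shf.sec_self]
    change germ _ _ = (G.cofree J).act g _ _ (germ _ _)
    rw [germ_liftFun θ τ hτ hτg, act_germ, germ_eq]
    filter_upwards [eventually_source (G.t_tInv g)] with k hk
    simp only [liftFun, τ, dif_pos hk, Function.comp_apply]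
    rw [← F.act_m _ _ rfl hk rfl rfl]
    have e : G.m (G.tInv g (G.s k)) k hk = G.ltrans g k := (ltrans_of hk).symm
    -- The endpoints depend on the arrow, so arrow and endpoints are generalized together before
    -- substituting.
    have key : ∀ (k' : G₁) (_ : k' = G.ltrans g k) (x y : G₀) (hs : G.s k' = x) (ht : G.t k' = y),
        θ y (F.act k' hs ht (Shf.sec a x)) = θ (G.t (G.ltrans g k))
          (F.act (G.ltrans g k) rfl rfl (Shf.sec a (G.s (G.ltrans g k)))) := by
      rintro _ rfl _ _ rfl rfl; rfl
    exact key _ e _ _ _ _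

/-- Existence in the universal property: at the unit arrow the action is trivial and only `θ x`
remains. -/
theorem ev_lift (x : G₀) (a : F.stalk x) : ev x ((lift θ).app x a) = θ x a := by
  change liftFun θ (Shf.sec a) (G.e x) = θ x a
  have key : ∀ (y z : G₀) (hs : G.s (G.e x) = y) (ht : G.t (G.e x) = z) (h : x = y) (h' : x = z),
      θ z (F.act (G.e x) hs ht (Shf.sec a y)) = θ x a := by
    rintro _ _ hs ht rfl rfl
    rw [F.act_e, Shf.sec_self]
  exact key _ _ rfl rfl (G.s_e x).symm (G.t_e x).symm

theorem lift_injective (hθ : ∀ x, Function.Injective (θ x)) (x : G₀) :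
    Function.Injective ((lift θ).app x) := fun a b h => hθ x (by rw [← ev_lift θ, h, ev_lift])

end lift

/-- By the universal property, extending a morphism along `f` amounts to extending `ev x ∘ u` along
the injection `f.app x` for each `x` separately, with no compatibility between stalks. -/
theorem injective_cofree [Injective (AddCommGrpCat.of J)] : Injective (G.cofree J) where
  factors {A B} u f hf := by
    have h : ∀ x, ∃ θ : B.stalk x →+ J, ∀ a, θ (f.app x a) = ev x (u.app x a) := fun x => by
      have : Mono (AddCommGrpCat.ofHom (f.app x)) :=
        (AddCommGrpCat.mono_iff_injective _).2 (Shf.injective_of_mono f x)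
      let r := Injective.factorThru (AddCommGrpCat.ofHom ((ev x).comp (u.app x)))
        (AddCommGrpCat.ofHom (f.app x))
      have e := Injective.comp_factorThru (AddCommGrpCat.ofHom ((ev x).comp (u.app x)))
        (AddCommGrpCat.ofHom (f.app x))
      exact ⟨r.hom, fun a => congrArg (fun v => v.hom a) e⟩
    choose θ hθ using h
    exact ⟨lift θ, hom_ext fun x a => by rw [Shf.comp_app, ev_lift, hθ]⟩

end Cofree

end cofree

end EtaleGroupoid

namespace EtaleGroupoid

/-! ### Čech cochains in degrees at most two, and acyclicity of injective sheaves in degree one. -/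

section lowdegree

variable {n : ℕ} {G₀ G₁ : Type u}
  [TopologicalSpace G₀] [ChartedSpace (EuclideanSpace ℝ (Fin n)) G₀]
  [TopologicalSpace G₁] [ChartedSpace (EuclideanSpace ℝ (Fin n)) G₁]
  {G : EtaleGroupoid n G₀ G₁}

namespace Nerve

/-- An object as a string of length `0`. -/
def of0 (x : G₀) : Nerve G 0 := ⟨fun _ => x, Fin.elim0, fun j => j.elim0, fun j => j.elim0⟩

/-- An arrow as a string of length `1`. -/
def of1 (g : G₁) : Nerve G 1 :=
  ⟨![G.s g, G.t g], fun _ => g, by intro j; fin_cases j; rfl, by intro j; fin_cases j; rfl⟩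

/-- A composable pair as a string of length `2`. -/
def of2 (g h : G₁) (w : G.t g = G.s h) : Nerve G 2 :=
  ⟨![G.s g, G.t g, G.t h], ![g, h], by
    intro j
    fin_cases j
    · rfl
    · exact w.symm, by intro j; fin_cases j <;> rfl⟩

theorem of0_last (q : Nerve G 0) : of0 q.last = q :=
  Nerve.ext (funext fun j => by fin_cases j; rfl) (funext fun j => j.elim0)

theorem of1_arr (q : Nerve G 1) : of1 (q.arr 0) = q := by
  refine Nerve.ext (funext fun j => ?_) (funext fun j => by fin_cases j; rfl)
  fin_cases j
  · exact q.s_arr 0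
  · exact q.t_arr 0

theorem of2_arr (q : Nerve G 2) : of2 (q.arr 0) (q.arr 1) (q.composable 0) = q := by
  refine Nerve.ext (funext fun j => ?_) (funext fun j => ?_)
  · fin_cases j
    · exact q.s_arr 0
    · exact q.t_arr 0
    · exact q.t_arr 1
  · fin_cases j <;> rfl

theorem continuous_of0 : Continuous (of0 : G₀ → Nerve G 0) :=
  continuous_induced_rng.2 ((continuous_pi fun _ => continuous_id).prodMk
    (continuous_pi fun j => j.elim0))

theorem continuous_of1 : Continuous (of1 : G₁ → Nerve G 1) := by
  refine continuous_induced_rng.2 (Continuous.prodMk (continuous_pi fun j => ?_)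
    (continuous_pi fun _ => continuous_id))
  fin_cases j
  · exact G.continuous_s
  · exact G.continuous_t

theorem face_zero_of1 (g : G₁) : face 0 (of1 g : Nerve G 1) = of0 (G.t g) :=
  Nerve.ext (funext fun j => by fin_cases j; rfl) (funext fun j => j.elim0)

theorem face_one_of1 (g : G₁) : face 1 (of1 g : Nerve G 1) = of0 (G.s g) :=
  Nerve.ext (funext fun j => by fin_cases j; rfl) (funext fun j => j.elim0)

theorem face_zero_of2 (g h : G₁) (w : G.t g = G.s h) : face 0 (of2 g h w) = of1 h := by
  refine Nerve.ext (funext fun j => ?_) (funext fun j => by fin_cases j; rfl)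
  fin_cases j
  · exact w
  · rfl

theorem face_one_of2 (g h : G₁) (w : G.t g = G.s h) : face 1 (of2 g h w) = of1 (G.m g h w) := by
  refine Nerve.ext (funext fun j => ?_) (funext fun j => by fin_cases j; rfl)
  fin_cases j
  · exact (G.s_m g h w).symm
  · exact (G.t_m g h w).symm

theorem face_two_of2 (g h : G₁) (w : G.t g = G.s h) : face 2 (of2 g h w) = of1 g := by
  refine Nerve.ext (funext fun j => ?_) (funext fun j => by fin_cases j; rfl)
  fin_cases j <;> rfl

end Nerve

namespace Cochain

variable {F : Shf G}

theorem tr_apply {k : ℕ} (σ : Cochain F k) {q q' : Nerve G k} (h : q = q') (e : q.last = q'.last) :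
    F.tr e (σ.1 q) = σ.1 q' := F.tr_section Nerve.last σ.1 h e

theorem contAt {k : ℕ} (σ : Cochain F k) (q : Nerve G k) : F.ContAt (p := Nerve.last) σ.1 q :=
  σ.2.continuousAt

/-- The value of a cochain at an object. -/
def at0 (x : G₀) : Cochain F 0 →+ F.stalk x where
  toFun σ := σ.1 (Nerve.of0 x)
  map_zero' := rfl
  map_add' _ _ := rfl

/-- The value of a cochain at an arrow. -/
def at1 (g : G₁) : Cochain F 1 →+ F.stalk (G.t g) where
  toFun σ := σ.1 (Nerve.of1 g)
  map_zero' := rfl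
  map_add' _ _ := rfl

/-- The value of a cochain at a composable pair. -/
def at2 (g h : G₁) (w : G.t g = G.s h) : Cochain F 2 →+ F.stalk (G.t h) where
  toFun σ := σ.1 (Nerve.of2 g h w)
  map_zero' := rfl
  map_add' _ _ := rfl

theorem ext0 {σ τ : Cochain F 0} (h : ∀ x, at0 x σ = at0 x τ) : σ = τ := by
  refine Subtype.ext (funext fun q => ?_)
  rw [← tr_apply σ q.of0_last rfl, ← tr_apply τ q.of0_last rfl]
  exact congrArg _ (h q.last)

theorem ext1 {σ τ : Cochain F 1} (h : ∀ g, at1 g σ = at1 g τ) : σ = τ := by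
  refine Subtype.ext (funext fun q => ?_)
  rw [← tr_apply σ q.of1_arr (q.t_arr 0), ← tr_apply τ q.of1_arr (q.t_arr 0)]
  exact congrArg _ (h (q.arr 0))

theorem ext2 {σ τ : Cochain F 2} (h : ∀ g h w, at2 g h w σ = at2 g h w τ) : σ = τ := by
  refine Subtype.ext (funext fun q => ?_)
  rw [← tr_apply σ q.of2_arr (q.t_arr 1), ← tr_apply τ q.of2_arr (q.t_arr 1)]
  exact congrArg _ (h (q.arr 0) (q.arr 1) (q.composable 0))

theorem contAt0 (σ : Cochain F 0) (x : G₀) : F.ContAt (p := id) (fun x => at0 x σ) x :=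
  (contAt σ (Nerve.of0 x)).comp (f := Nerve.of0) Nerve.continuous_of0.continuousAt

theorem contAt1 (σ : Cochain F 1) (g : G₁) : F.ContAt (p := G.t) (fun g => at1 g σ) g :=
  (contAt σ (Nerve.of1 g)).comp (f := Nerve.of1) Nerve.continuous_of1.continuousAt

/-- The `0`-cochain given by a global section. -/
def mk0 (σ : ∀ x, F.stalk x) (h : ∀ x, F.ContAt (p := id) σ x) : Cochain F 0 :=
  ⟨fun q => σ q.last, continuous_iff_continuousAt.2 fun q =>
    Shf.ContAt.comp (p := id) (f := Nerve.last) (h q.last) Nerve.continuous_last.continuousAt⟩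

@[simp] theorem at0_mk0 (σ : ∀ x, F.stalk x) (h) (x : G₀) : at0 x (mk0 σ h) = σ x := rfl

@[simp] theorem at0_map {A B : Shf G} (f : A ⟶ B) (σ : Cochain A 0) (x : G₀) :
    at0 x (map f 0 σ) = f.app x (at0 x σ) := rfl

@[simp] theorem at1_map {A B : Shf G} (f : A ⟶ B) (σ : Cochain A 1) (g : G₁) :
    at1 g (map f 1 σ) = f.app _ (at1 g σ) := rfl

@[simp] theorem at2_map {A B : Shf G} (f : A ⟶ B) (σ : Cochain A 2) (g h : G₁) (w) :
    at2 g h w (map f 2 σ) = f.app _ (at2 g h w σ) := rfl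

theorem at1_delta (σ : Cochain F 0) (g : G₁) :
    at1 g (delta F 0 σ) = at0 (G.t g) σ - F.act g rfl rfl (at0 (G.s g) σ) := by
  have h0 : at1 g (inner F 0 σ) = at0 (G.t g) σ := tr_apply σ (Nerve.face_zero_of1 g) rfl
  have h1 : at1 g (outer F σ) = F.act g rfl rfl (at0 (G.s g) σ) :=
    congrArg (F.act g rfl rfl) (tr_apply σ (Nerve.face_one_of1 g) rfl)
  have e : delta F 0 σ = inner F 0 σ - outer F σ := by
    simp [delta, sub_eq_add_neg]
  rw [e, map_sub, h0, h1]

theorem at2_delta (a : Cochain F 1) (g h : G₁) (w : G.t g = G.s h) :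
    at2 g h w (delta F 1 a) = at1 h a - F.tr (G.t_m g h w) (at1 (G.m g h w) a) +
      F.act h w.symm rfl (at1 g a) := by
  have h0 : at2 g h w (inner F 0 a) = at1 h a := tr_apply a (Nerve.face_zero_of2 g h w) rfl
  have h1 : at2 g h w (inner F 1 a) = F.tr (G.t_m g h w) (at1 (G.m g h w) a) := by
    have := tr_apply a (Nerve.face_one_of2 g h w).symm (G.t_m g h w)
    exact this.symm
  have h2 : at2 g h w (outer F a) = F.act h w.symm rfl (at1 g a) :=
    congrArg (F.act h w.symm rfl) (tr_apply a (Nerve.face_two_of2 g h w) rfl)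
  have e : delta F 1 a = inner F 0 a - inner F 1 a + outer F a := by
    simp [delta, Fin.sum_univ_two, sub_eq_add_neg]
  rw [e, map_add, map_sub, h0, h1, h2]

theorem delta_delta (σ : Cochain F 0) : delta F 1 (delta F 0 σ) = 0 := by
  refine ext2 fun g h w => ?_
  have e : F.tr (G.t_m g h w) (F.act (G.m g h w) rfl rfl (at0 _ σ)) =
      F.act h w.symm rfl (F.act g rfl rfl (at0 (G.s g) σ)) := by
    rw [F.tr_act, ← F.act_m]
    exact Shf.act_section (fun z => at0 z σ) rfl _ _ _ _
  have e1 : F.tr (G.t_m g h w) (at0 _ σ) = at0 (G.t h) σ :=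
    F.tr_section id (fun x => at0 x σ) (G.t_m g h w) _
  have e2 : F.act h w.symm rfl (at0 (G.t g) σ) = F.act h rfl rfl (at0 _ σ) :=
    Shf.act_section (fun z => at0 z σ) rfl _ _ _ _
  rw [at2_delta, at1_delta, at1_delta, at1_delta, map_sub, map_sub, e, e1, e2, map_zero]
  abel

theorem map_delta0 {A B : Shf G} (f : A ⟶ B) (σ : Cochain A 0) :
    map f 1 (delta A 0 σ) = delta B 0 (map f 0 σ) :=
  ext1 fun g => by simp [at1_delta, f.app_act]

theorem map_delta1 {A B : Shf G} (f : A ⟶ B) (a : Cochain A 1) :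
    map f 2 (delta A 1 a) = delta B 1 (map f 1 a) :=
  ext2 fun g h w => by simp [at2_delta, f.app_act, Shf.app_tr]

theorem map_map {A B C : Shf G} (f : A ⟶ B) (g : B ⟶ C) {k : ℕ} (σ : Cochain A k) :
    map g k (map f k σ) = map (f ≫ g) k σ := rfl

theorem map_id {A : Shf G} {k : ℕ} (σ : Cochain A k) : map (𝟙 A) k σ = σ := rfl

/-- Evaluation at units contracts the Čech complex. If `a g` is the germ of `φ` and `g'` is an arrow
near `g` composable with `k`, the cocycle identity at `(g', k)` evaluated at a unit reads `ev (a k)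
- ev (a (g' k)) + φ k = 0`. -/
theorem exists_delta_eq_cofree {J : Type u} [AddCommGroup J] (a : Cochain (G.cofree J) 1)
    (ha : delta _ 1 a = 0) : ∃ σ, delta (G.cofree J) 0 σ = a := by
  -- At `g` the coboundary of the germs of `S` is the germ of `S - S ∘ ltrans g`; the sign is chosen
  -- so that this equals `φ`.
  let S : G₁ → J := fun k => -Cofree.ev (G.t k) (at1 k a)
  refine ⟨mk0 (fun x => Cofree.germ S x) fun x => Cofree.contAt_germ S continuousAt_id,
    ext1 fun g => ?_⟩
  obtain ⟨φ, hφ⟩ := Cofree.exists_germ (at1 g a)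
  rw [at1_delta, at0_mk0, at0_mk0, Cofree.act_germ, ← Cofree.germ_sub, hφ, Cofree.germ_eq]
  have h := (contAt1 a g).eventually_germ hφ
  have hc := (G.tInv_continuousAt g).self_of_nhds
  rw [ContinuousAt, tInv_t] at hc
  -- For `s k` near `t g`, the value of `a` at the nearby arrow `tInv g (s k)` is still a germ of
  -- the same `φ`.
  filter_upwards [eventually_source (G.t_tInv g), eventually_source (hc.eventually h)] with k w hk
  have key := congrArg (at2 (G.tInv g (G.s k)) k w) ha
  rw [at2_delta, map_zero] at key
  have key' := congrArg (Cofree.ev (G.t k)) key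
  have tr_ev : ∀ {x y : G₀} (e : x = y) (b : (G.cofree J).stalk x),
      Cofree.ev y ((G.cofree J).tr e b) = Cofree.ev x b := by
    rintro x _ rfl b; rfl
  have act_ev : ∀ {x : G₀} (e : G.s k = x), Cofree.ev (G.t k) ((G.cofree J).act k e rfl
      (Cofree.germ φ x)) = φ k := by
    rintro _ rfl; exact Cofree.ev_act_germ φ k
  rw [map_add, map_sub, tr_ev, hk, act_ev, map_zero] at key'
  have hS : S (G.ltrans g k) = -Cofree.ev _ (at1 (G.m _ k w) a) := by
    rw [ltrans_of w]
  simp only [Pi.sub_apply, Function.comp_apply, hS, S]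
  rw [eq_neg_of_add_eq_zero_right key']
  abel

/-- Acyclicity of injective sheaves in degree one. -/
theorem exists_delta_eq_of_injective (F : Shf G) [Injective F] (a : Cochain F 1)
    (ha : delta F 1 a = 0) : ∃ σ, delta F 0 σ = a := by
  classical
  -- Each stalk embeds in the product of all stalks, so `ι` is a monomorphism and the injective
  -- sheaf `F` is a retract of the cofree one.
  let ι : F ⟶ G.cofree (∀ x, F.stalk x) := Cofree.lift fun x => AddMonoidHom.single _ x
  have : Mono ι := Shf.mono_of_injective _
    (Cofree.lift_injective _ fun x => Pi.single_injective x)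
  obtain ⟨σ, hσ⟩ := exists_delta_eq_cofree (map ι 1 a) (by rw [← map_delta1, ha, map_zero])
  refine ⟨map (Injective.factorThru (𝟙 F) ι) 0 σ, ?_⟩
  rw [← map_delta0, hσ, map_map, Injective.comp_factorThru, map_id]

end Cochain

end lowdegree

end EtaleGroupoid

/-! ### Smooth partitions of unity and additive Čech cocycles on a paracompact manifold. -/

section partition

variable {n : ℕ} {M : Type u} [TopologicalSpace M] [ChartedSpace (EuclideanSpace ℝ (Fin n)) M]
  [IsManifold (𝓡 n) ∞ M]

/-- An open set whose closure lies in a chart is the support of a smooth nonnegative function. -/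
theorem exists_contMDiff_support_eq_of_closure_subset_chart {V : Set M} (hV : IsOpen V) (x : M)
    (h : closure V ⊆ (chartAt (EuclideanSpace ℝ (Fin n)) x).source) :
    ∃ f : M → ℝ, ContMDiff (𝓡 n) 𝓘(ℝ) ∞ f ∧ (∀ y, 0 ≤ f y) ∧ Function.support f = V := by
  let e := chartAt (EuclideanSpace ℝ (Fin n)) x
  obtain ⟨g, hg1, hg2, hg3⟩ := (e.isOpen_inter_preimage_symm hV).exists_contDiff_support_eq (n := ⊤)
  have g0 : ∀ y, 0 ≤ g y := fun y => hg3 (Set.mem_range_self y) |>.1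
  classical
  let f : M → ℝ := fun y => if y ∈ V then g (e y) else 0
  have hpos : ∀ y ∈ V, g (e y) ≠ 0 := fun y hy => by
    have hs := h (subset_closure hy)
    have : e y ∈ Function.support g := by
      rw [hg1]
      exact ⟨e.map_source hs, by simpa [e.left_inv hs] using hy⟩
    exact this
  have hzero : ∀ y ∈ e.source, y ∉ V → g (e y) = 0 := fun y hs hy => by
    by_contra hne
    have : e y ∈ Function.support g := hne
    rw [hg1] at this
    exact hy (by simpa [e.left_inv hs] using this.2)
  refine ⟨f, fun y => ?_, fun y => ?_, ?_⟩
  -- Points of `closure V` lie in the chart domain, where `f` is `g ∘ e`; near any other point `f`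
  -- vanishes.
  · by_cases hy : y ∈ closure V
    · have hs := h hy
      have h1 : ContMDiffAt (𝓡 n) 𝓘(ℝ) ∞ (fun y => g (e y)) y :=
        hg2.contMDiff.contMDiffAt.comp y
          (contMDiffAt_of_mem_maximalAtlas (IsManifold.chart_mem_maximalAtlas x) hs)
      refine h1.congr_of_eventuallyEq ?_
      filter_upwards [e.open_source.mem_nhds hs] with z hz
      by_cases hzV : z ∈ V
      · simp [f, hzV]
      · simp [f, hzV, hzero z hz hzV]
    · refine (contMDiffAt_const (c := (0 : ℝ))).congr_of_eventuallyEq ?_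
      filter_upwards [isClosed_closure.isOpen_compl.mem_nhds hy] with z hz
      exact if_neg fun hzV => hz (subset_closure hzV)
  · simp only [f]
    split_ifs
    exacts [g0 _, le_rfl]
  · ext y
    by_cases hy : y ∈ V
    · simp [f, hy, hpos y hy]
    · simp [f, hy]

variable [T2Space M] [ParacompactSpace M]

/-- Smooth Urysohn functions on paracompact manifolds. -/
theorem exists_contMDiff_zero_one_of_isClosed {s t : Set M} (hs : IsClosed s) (ht : IsClosed t)
    (hd : Disjoint s t) : ∃ f : C(M, ℝ), ContMDiff (𝓡 n) 𝓘(ℝ) ∞ f ∧ Set.EqOn f 0 s ∧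
      Set.EqOn f 1 t ∧ ∀ x, f x ∈ Set.Icc (0 : ℝ) 1 := by
  classical
  -- The neighbourhoods are so small that each misses `s` or `t`.
  have hN : ∀ x : M, ∃ N, IsOpen N ∧ x ∈ N ∧
      closure N ⊆ (chartAt (EuclideanSpace ℝ (Fin n)) x).source ∧ (Disjoint N s ∨ Disjoint N t) := by
    intro x
    have hc := (chartAt (EuclideanSpace ℝ (Fin n)) x).open_source.mem_nhds
      (mem_chart_source (EuclideanSpace ℝ (Fin n)) x)
    have key : ∀ r : Set M, IsClosed r → x ∉ r → ∃ N, IsOpen N ∧ x ∈ N ∧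
      closure N ⊆ (chartAt (EuclideanSpace ℝ (Fin n)) x).source ∧ Disjoint N r := by
      intro r hr hx
      obtain ⟨C, hC, hCc, hCs⟩ := exists_mem_nhds_isClosed_subset
        (inter_mem hc (hr.isOpen_compl.mem_nhds hx))
      refine ⟨interior C, isOpen_interior, mem_interior_iff_mem_nhds.2 hC,
        (closure_minimal interior_subset hCc).trans (hCs.trans Set.inter_subset_left), ?_⟩
      exact Set.disjoint_left.2 fun y hy hyr => (hCs (interior_subset hy)).2 hyr
    by_cases hx : x ∈ s
    · obtain ⟨N, h1, h2, h3, h4⟩ := key t ht (Set.disjoint_left.1 hd hx)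
      exact ⟨N, h1, h2, h3, .inr h4⟩
    · obtain ⟨N, h1, h2, h3, h4⟩ := key s hs hx
      exact ⟨N, h1, h2, h3, .inl h4⟩
  choose N hNo hxN hNc hNd using hN
  obtain ⟨V, hVo, hVc, hVf, hVN⟩ := precise_refinement N hNo
    (Set.eq_univ_of_forall fun x => Set.mem_iUnion.2 ⟨x, hxN x⟩)
  choose g hg g0 gs using fun x => exists_contMDiff_support_eq_of_closure_subset_chart (hVo x) x
    ((closure_mono (hVN x)).trans (hNc x))
  have hlf : LocallyFinite fun x => Function.support (g x) := by simpa only [gs] using hVf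
  have hfin : ∀ y, (Function.support fun x => g x y).Finite := fun y => hlf.point_finite y
  have hS : ContMDiff (𝓡 n) 𝓘(ℝ) ∞ fun y => ∑ᶠ x, g x y := contMDiff_finsum hg hlf
  -- The Urysohn function is `∑ k / ∑ g`, where `k` retains only the bumps whose neighbourhood
  -- misses `s`. It is `0` on `s`; at a point of `t` every nonzero bump comes from a neighbourhood
  -- that meets `t` and so misses `s`, giving `1`.
  let k : M → M → ℝ := fun x => if Disjoint (N x) s then g x else 0
  have hks : ∀ x, Function.support (k x) ⊆ Function.support (g x) := fun x => by
    by_cases h : Disjoint (N x) s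
    · simp only [k, if_pos h]; exact subset_rfl
    · simp [k, if_neg h]
  have hk : ContMDiff (𝓡 n) 𝓘(ℝ) ∞ fun y => ∑ᶠ x, k x y := by
    refine contMDiff_finsum (fun x => ?_) (hlf.subset hks)
    by_cases h : Disjoint (N x) s
    · simp only [k, if_pos h]; exact hg x
    · simp only [k, if_neg h]; exact contMDiff_const
  have hkg : ∀ x y, 0 ≤ k x y ∧ k x y ≤ g x y := fun x y => by
    by_cases h : Disjoint (N x) s
    · simp only [k, if_pos h]; exact ⟨g0 x y, le_rfl⟩
    · simp only [k, if_neg h]; exact ⟨le_rfl, g0 x y⟩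
  have hfk : ∀ y, (Function.support fun x => k x y).Finite := fun y =>
    (hfin y).subset fun x hx => hks x hx
  have hSpos : ∀ y, 0 < ∑ᶠ x, g x y := fun y => by
    obtain ⟨x, hx⟩ := Set.mem_iUnion.1 (hVc.symm ▸ Set.mem_univ y : y ∈ ⋃ x, V x)
    have : g x y ≠ 0 := by rw [← gs x] at hx; exact hx
    exact finsum_pos (fun x => g0 x y) ⟨x, lt_of_le_of_ne (g0 x y) this.symm⟩ (hfin y)
  have hF : ContMDiff (𝓡 n) 𝓘(ℝ) ∞ fun y => (∑ᶠ x, k x y) / ∑ᶠ x, g x y :=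
    fun y => (hk y).div₀ (hS y) (hSpos y).ne'
  refine ⟨⟨_, hF.continuous⟩, hF, fun y hy => ?_, fun y hy => ?_, fun y => ⟨?_, ?_⟩⟩
  · have : ∀ x, k x y = 0 := fun x => by
      by_cases h : Disjoint (N x) s
      · by_contra hne
        have hyV : y ∈ Function.support (g x) := hks x hne
        rw [gs] at hyV
        exact Set.disjoint_left.1 h (hVN x hyV) hy
      · simp [k, if_neg h]
    simp [this]
  · have : ∀ x, k x y = g x y := fun x => by
      by_cases h : Disjoint (N x) s
      · simp [k, if_pos h]
      · have h' := (hNd x).resolve_left h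
        have : g x y = 0 := by
          by_contra hne
          have hyV : y ∈ Function.support (g x) := hne
          rw [gs] at hyV
          exact Set.disjoint_left.1 h' (hVN x hyV) hy
        simp [k, if_neg h, this]
    simp only [this, ContinuousMap.coe_mk, Pi.one_apply]
    exact div_self (hSpos y).ne'
  · exact div_nonneg (finsum_nonneg fun x => (hkg x y).1) (hSpos y).le
  · exact (div_le_one (hSpos y)).2 (finsum_le_finsum' (hfk y) (hfin y) fun x => (hkg x y).2)

/-- Smooth partitions of unity on paracompact manifolds. -/
theorem SmoothPartitionOfUnity.exists_isSubordinate_of_paracompact {ι : Type*} (U : ι → Set M)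
    (ho : ∀ i, IsOpen (U i)) (hU : ⋃ i, U i = Set.univ) :
    ∃ f : SmoothPartitionOfUnity ι (𝓡 n) M Set.univ, f.IsSubordinate U := by
  obtain ⟨f, hf, hfU⟩ := BumpCovering.exists_isSubordinate_of_prop
    (fun f : M → ℝ => ContMDiff (𝓡 n) 𝓘(ℝ) ∞ f)
    (fun s t hs ht hd => exists_contMDiff_zero_one_of_isClosed hs ht hd)
    isClosed_univ U ho hU.ge
  exact ⟨f.toSmoothPartitionOfUnity hf, hfU.toSmoothPartitionOfUnity hf⟩

/-- Smooth additive Čech `1`-cocycles on a paracompact manifold are coboundaries. -/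
theorem exists_smooth_additive_split {ι : Type*} {W : ι → Set M} (hW : ∀ i, IsOpen (W i))
    (hWc : ⋃ i, W i = Set.univ) {g : ι → ι → M → ℂ}
    (hg : ∀ i j, ∀ z ∈ W i ∩ W j, ContMDiffAt (𝓡 n) 𝓘(ℝ, ℂ) ∞ (g i j) z)
    (hc : ∀ i j k, ∀ z ∈ W i ∩ W j ∩ W k, g i j z + g j k z = g i k z) :
    ∃ ψ : ι → M → ℂ, (∀ i, ∀ z ∈ W i, ContMDiffAt (𝓡 n) 𝓘(ℝ, ℂ) ∞ (ψ i) z) ∧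
      ∀ i j, ∀ z ∈ W i ∩ W j, g i j z = ψ i z - ψ j z := by
  obtain ⟨χ, hχ⟩ := SmoothPartitionOfUnity.exists_isSubordinate_of_paracompact (n := n) W hW hWc
  -- In the difference of two such averages the cocycle identity turns `g i k - g j k` into `g i j`,
  -- and the weights sum to `1`.
  refine ⟨fun i z => ∑ᶠ k, χ k z • g i k z, fun i z hz => ?_, fun i j z hz => ?_⟩
  · exact χ.contMDiffAt_finsum fun k hk => hg i k z ⟨hz, hχ k hk⟩
  · have hf : (Function.support fun k => χ k z).Finite := χ.locallyFinite.point_finite z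
    rw [← finsum_sub_distrib (hf.subset fun k hk => left_ne_zero_of_smul hk)
      (hf.subset fun k hk => left_ne_zero_of_smul hk)]
    have : ∀ k, χ k z • g i k z - χ k z • g j k z = χ k z • g i j z := fun k => by
      by_cases h : χ k z = 0
      · simp [h]
      · have hk : z ∈ W k := hχ k (subset_tsupport _ h)
        rw [← hc i j k z ⟨hz, hk⟩, ← smul_sub, add_sub_cancel_right]
    simp only [this]
    rw [← finsum_smul, χ.sum_eq_one (Set.mem_univ z), one_smul]

end partition

/-! ### Logarithms of multiplicative cocycles by parallel frames along a contraction. -/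

section logcocycle

open unitInterval

variable {X : Type*} [TopologicalSpace X] (H : ℝ × X → X) (V : X → Set X) (f : X → X → X → ℂˣ)

/-- A frame, over `(-∞, T] × U`, of the pull-back along `H` of the line bundle with transition
functions `f`. -/
structure IsFrame (U : Set X) (T : ℝ) (s : X → ℝ × X → ℂˣ) : Prop where
  cont : ∀ i, ContinuousOn (s i) {q | q.1 ≤ T ∧ q.2 ∈ U ∧ H q ∈ V i}
  trans : ∀ i j q, q.1 ≤ T → q.2 ∈ U → H q ∈ V i → H q ∈ V j → s i q = f i j (H q) * s j q

variable {H V f} {U U' : Set X} {T T' : ℝ} {s s' : X → ℝ × X → ℂˣ}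

theorem IsFrame.mono (h : IsFrame H V f U T s) (hU : U' ⊆ U) : IsFrame H V f U' T s :=
  ⟨fun i => (h.cont i).mono fun _ hq => ⟨hq.1, hU hq.2.1, hq.2.2⟩,
    fun i j q h1 h2 => h.trans i j q h1 (hU h2)⟩

/-- Over a strip that `H` maps into the single set `V k` the bundle is trivial, so the frame is
continued with its coordinate in that trivialization held constant. -/
theorem IsFrame.extend (hH : Continuous H) (hf : ∀ i j, ContinuousOn (f i j) (V i ∩ V j))
    (hc : ∀ i j k, ∀ z ∈ V i ∩ V j ∩ V k, f i j z * f j k z = f i k z)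
    (h : IsFrame H V f U T s) (hT : T ≤ T') (k : X)
    (hk : ∀ q : ℝ × X, T ≤ q.1 → q.1 ≤ T' → q.2 ∈ U → H q ∈ V k) :
    ∃ s', IsFrame H V f U T' s' ∧ ∀ i q, q.1 ≤ T → s' i q = s i q := by
  -- At time `T` the two branches agree by the transition rule from `k` to `i`.
  refine ⟨fun i q => if q.1 ≤ T then s i q else f i k (H q) * s k (T, q.2), ⟨fun i => ?_, ?_⟩,
    fun i q hq => if_pos hq⟩
  · refine ContinuousOn.if (p := fun q : ℝ × X => q.1 ≤ T) ?_ ?_ ?_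
    · rintro ⟨τ, y⟩ ⟨⟨h1, h2, h3⟩, hfr⟩
      obtain rfl : τ = T := frontier_le_subset_eq continuous_fst continuous_const hfr
      exact h.trans i k _ le_rfl h2 h3 (hk _ le_rfl hT h2)
    · rw [(isClosed_le continuous_fst continuous_const).closure_eq]
      exact (h.cont i).mono fun q hq => ⟨hq.2, hq.1.2⟩
    · have hcl : closure {q : ℝ × X | ¬ q.1 ≤ T} ⊆ {q | T ≤ q.1} := by
        simp only [not_le]
        exact closure_lt_subset_le continuous_const continuous_fst
      refine ContinuousOn.mul ((hf i k).comp hH.continuousOn fun q hq =>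
        ⟨hq.1.2.2, hk q (hcl hq.2) hq.1.1 hq.1.2.1⟩) ?_
      exact (h.cont k).comp (f := fun q : ℝ × X => (T, q.2)) (by fun_prop)
        fun q hq => ⟨le_rfl, hq.1.2.1, hk (T, q.2) le_rfl hT hq.1.2.1⟩
  · intro i j q h1 h2 h3 h4
    by_cases hq : q.1 ≤ T
    · simp only [if_pos hq]
      exact h.trans i j q hq h2 h3 h4
    · have h5 := hk q (not_le.1 hq).le h1 h2
      simp only [if_neg hq]
      rw [← hc i j k _ ⟨⟨h3, h4⟩, h5⟩, mul_assoc]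

/-- By compactness the path `τ ↦ H (τ, x)` is cut into finitely many pieces, each inside one `V k`.
The tube lemma gives the same for all starting points near `x`, and `IsFrame.extend` is applied once
per piece. -/
theorem exists_isFrame (hH : Continuous H) (hV : ∀ i, IsOpen (V i)) (hxV : ∀ i, i ∈ V i)
    (hf : ∀ i j, ContinuousOn (f i j) (V i ∩ V j))
    (hc : ∀ i j k, ∀ z ∈ V i ∩ V j ∩ V k, f i j z * f j k z = f i k z)
    {x p : X} {U₀ : Set X} (hU₀ : IsOpen U₀) (hx : x ∈ U₀)
    (hp : ∀ q : ℝ × X, q.1 ≤ 0 → q.2 ∈ U₀ → H q = p) :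
    ∃ U s, IsOpen U ∧ x ∈ U ∧ U ⊆ U₀ ∧ IsFrame H V f U 1 s ∧ ∀ y ∈ U, s p (0, y) = 1 := by
  have hpp : f p p p = 1 := by
    have := hc p p p p ⟨⟨hxV p, hxV p⟩, hxV p⟩
    simpa using this
  obtain ⟨t, ht0, htm, ⟨N, hN⟩, ht⟩ := exists_monotone_Icc_subset_open_cover_Icc
    (a := (0 : ℝ)) (b := 1) zero_le_one (c := fun i => {τ | H (τ, x) ∈ V i})
    (fun i => ((hV i).preimage (hH.comp (Continuous.prodMk_left x))).preimage continuous_subtype_val)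
    (fun τ _ => Set.mem_iUnion.2 ⟨H (τ, x), hxV _⟩)
  have key : ∀ m, ∃ U s, IsOpen U ∧ x ∈ U ∧ U ⊆ U₀ ∧ IsFrame H V f U (t m) s ∧
      ∀ y ∈ U, s p (0, y) = 1 := by
    intro m
    induction m with
    | zero =>
      -- Up to time `0` the homotopy stays at `p`, so a constant frame exists there; it is
      -- normalized to be `1` in the coordinate `p`.
      refine ⟨U₀, fun i q => f i p p, hU₀, hx, subset_rfl, ⟨fun i => continuousOn_const, ?_⟩,
        fun y _ => hpp⟩
      intro i j q h1 h2 h3 h4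
      rw [ht0] at h1
      rw [hp q h1 h2] at h3 h4 ⊢
      exact (hc i j p p ⟨⟨h3, h4⟩, hxV p⟩).symm
    | succ m ih =>
      obtain ⟨U, s, hU, hxU, hUU, hs, hs1⟩ := ih
      obtain ⟨k, hk⟩ := ht m
      obtain ⟨A, B, hA, hB, hIA, hxB, hAB⟩ := generalized_tube_lemma
        (isCompact_Icc (a := (t m : ℝ)) (b := t (m + 1))) (isCompact_singleton (x := x))
        ((hV k).preimage hH) (by
          rintro ⟨τ, y⟩ ⟨hτ, rfl⟩
          exact @hk ⟨τ, (t m).2.1.trans hτ.1, hτ.2.trans (t (m + 1)).2.2⟩ hτ)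
      obtain ⟨s', hs', hss⟩ := (hs.mono (U' := U ∩ B) Set.inter_subset_left).extend hH hf hc
        (htm (Nat.le_succ m)) k (fun q h1 h2 h3 => hAB ⟨hIA ⟨h1, h2⟩, h3.2⟩)
      refine ⟨U ∩ B, s', hU.inter hB, ⟨hxU, hxB rfl⟩, Set.inter_subset_left.trans hUU, hs',
        fun y hy => ?_⟩
      rw [hss p _ (t m).2.1]
      exact hs1 y hy.1
  obtain ⟨U, s, h1, h2, h3, h4, h5⟩ := key N
  rw [hN N le_rfl] at h4
  exact ⟨U, s, h1, h2, h3, h4, h5⟩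

/-- The quotient of two frames. -/
noncomputable def frameRatio (H : ℝ × X → X) (s s' : X → ℝ × X → ℂˣ) (q : ℝ × X) : ℂˣ :=
  s (H q) q / s' (H q) q

/-- The transition functions cancel, so the ratio may be computed in any coordinate `i`. -/
theorem frameRatio_eq (hxV : ∀ i, i ∈ V i) (h : IsFrame H V f U T s) (h' : IsFrame H V f U' T s')
    {q : ℝ × X} (hq : q.1 ≤ T) (hqU : q.2 ∈ U ∩ U') {i : X} (hi : H q ∈ V i) :
    frameRatio H s s' q = s i q / s' i q := by
  rw [h.trans i (H q) q hq hqU.1 hi (hxV _), h'.trans i (H q) q hq hqU.2 hi (hxV _),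
    mul_div_mul_left_eq_div, frameRatio]

theorem frameRatio_mul {Y : Type*} {H : ℝ × Y → Y} {s s' s'' : Y → ℝ × Y → ℂˣ} (q : ℝ × Y) :
    frameRatio H s s' q * frameRatio H s' s'' q = frameRatio H s s'' q := div_mul_div_cancel _ _ _

/-- The coordinate `H q` in the definition jumps with `q`; near a given `q` it is frozen by
`frameRatio_eq`. -/
theorem continuousOn_frameRatio (hH : Continuous H) (hV : ∀ i, IsOpen (V i)) (hxV : ∀ i, i ∈ V i)
    (h : IsFrame H V f U T s) (h' : IsFrame H V f U' T s') :
    ContinuousOn (frameRatio H s s') {q | q.1 ≤ T ∧ q.2 ∈ U ∩ U'} := by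
  rintro q ⟨h1, h2⟩
  have hn : ∀ᶠ r in 𝓝[{q | q.1 ≤ T ∧ q.2 ∈ U ∩ U'}] q, H r ∈ V (H q) :=
    mem_nhdsWithin_of_mem_nhds (hH.continuousAt.eventually ((hV (H q)).mem_nhds (hxV _)))
  have c1 : ContinuousWithinAt (s (H q)) {q | q.1 ≤ T ∧ q.2 ∈ U ∩ U'} q := by
    refine (h.cont (H q) q ⟨h1, h2.1, hxV _⟩).mono_of_mem_nhdsWithin ?_
    filter_upwards [hn, self_mem_nhdsWithin] with r hr hr' using ⟨hr'.1, hr'.2.1, hr⟩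
  have c2 : ContinuousWithinAt (s' (H q)) {q | q.1 ≤ T ∧ q.2 ∈ U ∩ U'} q := by
    refine (h'.cont (H q) q ⟨h1, h2.2, hxV _⟩).mono_of_mem_nhdsWithin ?_
    filter_upwards [hn, self_mem_nhdsWithin] with r hr hr' using ⟨hr'.1, hr'.2.2, hr⟩
  refine (c1.div' c2).congr_of_eventuallyEq ?_ rfl
  filter_upwards [hn, self_mem_nhdsWithin] with r hr hr'
  exact frameRatio_eq hxV h h' hr'.1 hr'.2 hr

/-- A logarithm of a function of `t ∈ [0, 1]` with value `1` at `t = 0`, depending continuously on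
parameters. -/
theorem exists_log_lift {A : Set X} {r : ℝ × X → ℂˣ} (hr : ContinuousOn r {q | q.1 ≤ 1 ∧ q.2 ∈ A})
    (h0 : ∀ z ∈ A, r (0, z) = 1) : ∃ R : I × X → ℂ, (∀ z ∈ A, R (0, z) = 0) ∧
      (∀ z ∈ A, ∀ t : I, Complex.exp (R (t, z)) = r (t, z)) ∧
      ContinuousOn R {q | q.2 ∈ A} := by
  classical
  -- Seen as a homotopy in the punctured plane starting at the constant `1`, `r` lifts through the
  -- covering `exp` with initial value `0`.
  let K : C(I × A, {z : ℂ // z ≠ 0}) :=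
    ⟨fun q => ⟨r (q.1, q.2), (r (q.1, q.2)).ne_zero⟩, by
      have h1 : Continuous fun q : I × A => r (q.1, q.2) := by
        refine hr.comp_continuous (f := fun q : I × A => ((q.1 : ℝ), (q.2 : X))) (by fun_prop)
          fun q => ⟨q.1.2.2, q.2.2⟩
      exact (Units.continuous_val.comp h1).subtype_mk _⟩
  have hK : ∀ a, K (0, a) = ⟨_, Complex.exp_ne_zero ((0 : C(A, ℂ)) a)⟩ := fun a =>
    Subtype.ext (by simp [K, h0 a a.2])
  let L := Complex.isCoveringMap_exp.liftHomotopy K 0 hK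
  have hL := Complex.isCoveringMap_exp.liftHomotopy_lifts K 0 hK
  have hL0 := Complex.isCoveringMap_exp.liftHomotopy_zero K 0 hK
  refine ⟨fun q => if h : q.2 ∈ A then L (q.1, ⟨q.2, h⟩) else 0, fun z hz => ?_, fun z hz t => ?_, ?_⟩
  · simp only [dif_pos hz]
    exact hL0 ⟨z, hz⟩
  · simp only [dif_pos hz]
    exact congrArg Subtype.val (congrFun hL (t, ⟨z, hz⟩))
  · rw [continuousOn_iff_continuous_domRestrict]
    have : Continuous fun q : {q : I × X | q.2 ∈ A} => L (q.1.1, ⟨q.1.2, q.2⟩) :=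
      L.continuous.comp ((continuous_fst.comp continuous_subtype_val).prodMk
        ((continuous_snd.comp continuous_subtype_val).subtype_mk _))
    refine this.congr fun q => ?_
    have hq : q.1.2 ∈ A := q.2
    simp only [Set.domRestrict_apply, dif_pos hq]

/-- A continuous nonvanishing function has a logarithm near every point. -/
theorem exists_local_log {a : X → ℂˣ} {U : Set X} (hU : IsOpen U) {x : X} (hx : x ∈ U)
    (ha : ContinuousOn a U) : ∃ W α, IsOpen W ∧ x ∈ W ∧ W ⊆ U ∧ ContinuousOn α W ∧
      ∀ z ∈ W, Complex.exp (α z) = a z := by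
  -- Normalizing to the value `1` at `x` brings nearby values into the slit plane, where the
  -- principal logarithm is continuous.
  let b : X → ℂ := fun z => (a z : ℂ) / a x
  have hb : ContinuousOn b U := (Units.continuous_val.comp_continuousOn ha).div_const _
  have hbx : b x ∈ Complex.slitPlane := by
    simp only [b, div_self (a x).ne_zero]; exact Complex.one_mem_slitPlane
  have hsub : ∀ z ∈ U ∩ b ⁻¹' Complex.slitPlane, b z ∈ Complex.slitPlane := fun z hz => hz.2
  refine ⟨U ∩ b ⁻¹' Complex.slitPlane, fun z => Complex.log (a x) + Complex.log (b z),
    hb.isOpen_inter_preimage hU Complex.isOpen_slitPlane, ⟨hx, hbx⟩, Set.inter_subset_left, ?_,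
    fun z hz => ?_⟩
  · exact continuousOn_const.add ((hb.mono Set.inter_subset_left).clog hsub)
  · rw [Complex.exp_add, Complex.exp_log (a x).ne_zero,
      Complex.exp_log (Complex.slitPlane_ne_zero (hsub z hz))]
    exact mul_div_cancel₀ _ (a x).ne_zero

/-- If `X` deforms to a set of points by a homotopy that is locally constant at time `0`, then a
multiplicative Čech cocycle has, on a refinement, a logarithm which is an additive cocycle. -/
theorem exists_log_cocycle (hH : Continuous H) (hH1 : ∀ z, H (1, z) = z)
    (hH0 : ∀ x, ∃ U₀, IsOpen U₀ ∧ x ∈ U₀ ∧ ∃ p, ∀ q : ℝ × X, q.1 ≤ 0 → q.2 ∈ U₀ → H q = p)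
    (hV : ∀ i, IsOpen (V i)) (hxV : ∀ i, i ∈ V i)
    (hf : ∀ i j, ContinuousOn (f i j) (V i ∩ V j))
    (hc : ∀ i j k, ∀ z ∈ V i ∩ V j ∩ V k, f i j z * f j k z = f i k z) :
    ∃ (W : X → Set X) (g : X → X → X → ℂ), (∀ i, IsOpen (W i)) ∧ (∀ i, i ∈ W i) ∧
      (∀ i, W i ⊆ V i) ∧ (∀ i j, ContinuousOn (g i j) (W i ∩ W j)) ∧
      (∀ i j, ∀ z ∈ W i ∩ W j, Complex.exp (g i j z) = f i j z) ∧
      ∀ i j k, ∀ z ∈ W i ∩ W j ∩ W k, g i j z + g j k z = g i k z := by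
  have local_data : ∀ x, ∃ (W : Set X) (s : X → ℝ × X → ℂˣ) (p : X) (α : X → ℂ), IsOpen W ∧ x ∈ W ∧
      W ⊆ V x ∧ IsFrame H V f W 1 s ∧ (∀ y ∈ W, s p (0, y) = 1) ∧ (∀ y ∈ W, H (0, y) = p) ∧
      ContinuousOn α W ∧ ∀ y ∈ W, Complex.exp (α y) = s x (1, y) := by
    intro x
    obtain ⟨U₀, hU₀, hx, p, hp⟩ := hH0 x
    obtain ⟨U, s, hU, hxU, hUU, hs, hs1⟩ := exists_isFrame hH hV hxV hf hc hU₀ hx hp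
    obtain ⟨W, α, hW, hxW, hWU, hα, hα'⟩ := exists_local_log (a := fun y => s x (1, y))
      (hU.inter (hV x)) ⟨hxU, hxV x⟩ ((hs.cont x).comp (f := fun y => ((1 : ℝ), y)) (by fun_prop)
        fun y hy => ⟨le_rfl, hy.1, (hH1 y).symm ▸ hy.2⟩)
    exact ⟨W, s, p, α, hW, hxW, fun y hy => (hWU hy).2, hs.mono fun y hy => (hWU hy).1,
      fun y hy => hs1 y (hWU hy).1, fun y hy => hp _ le_rfl (hUU (hWU hy).1), hα, hα'⟩
  choose W s p α hW hxW hWV hs hs1 hp hα hα' using local_data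
  have hr := fun x y => continuousOn_frameRatio hH hV hxV (hs x) (hs y)
  -- If `W x` and `W y` meet, their common points are deformed to the same `p`, and both frames are
  -- `1` there.
  have hr0 : ∀ x y, ∀ z ∈ W x ∩ W y, frameRatio H (s x) (s y) (0, z) = 1 := fun x y z hz => by
    have e : p x = p y := (hp x z hz.1).symm.trans (hp y z hz.2)
    rw [frameRatio_eq hxV (hs x) (hs y) zero_le_one hz (i := p x) (by
      rw [hp x z hz.1]; exact hxV _), hs1 x z hz.1, e, hs1 y z hz.2, div_one]
  choose R hR0 hR hRc using fun x y => exists_log_lift (hr x y) (hr0 x y)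
  -- At time `1` the transition rule gives `f x y = s x x / (s y y * ratio)`; `α x`, `α y` and `R x
  -- y` are logarithms of the three factors.
  refine ⟨W, fun x y z => α x z - α y z - R x y (1, z), hW, hxW, hWV, fun x y => ?_,
    fun x y z hz => ?_, fun x y w z hz => ?_⟩
  · refine (((hα x).mono Set.inter_subset_left).sub ((hα y).mono Set.inter_subset_right)).sub ?_
    exact (hRc x y).comp (f := fun z => ((1 : I), z)) (by fun_prop) fun z hz => hz
  · have h1 := frameRatio_eq hxV (hs x) (hs y) (q := (1, z)) le_rfl hz (i := x)
      ((hH1 z).symm ▸ hWV x hz.1)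
    have h2 := (hs y).trans x y (1, z) le_rfl hz.2 ((hH1 z).symm ▸ hWV x hz.1)
      ((hH1 z).symm ▸ hWV y hz.2)
    have h3 := hR x y z hz 1
    rw [hH1] at h2
    rw [Complex.exp_sub, Complex.exp_sub, hα' x z hz.1, hα' y z hz.2, h3, Set.Icc.coe_one, h1, h2]
    have e1 := (s x x (1, z)).ne_zero
    have e2 := (s y y (1, z)).ne_zero
    have e3 := (f x y z).ne_zero
    push_cast
    field_simp
  · have hz1 : z ∈ W x ∩ W y := hz.1
    have hz2 : z ∈ W y ∩ W w := ⟨hz.1.2, hz.2⟩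
    have hz3 : z ∈ W x ∩ W w := ⟨hz.1.1, hz.2⟩
    have hcont : ∀ a b, z ∈ W a ∩ W b → Continuous fun t : I => R a b (t, z) := fun a b h =>
      (hRc a b).comp_continuous (f := fun t : I => (t, z)) (by fun_prop) fun _ => h
    -- Ratios multiply exactly, so `R x y + R y w` and `R x w` are lifts of the same path with the
    -- same value at `0`. Uniqueness of lifts excludes a discrepancy in `2πiℤ`, the usual
    -- obstruction to an additive logarithm.
    have key := Complex.isCoveringMap_exp.eq_of_comp_eq
      ((hcont x y hz1).add (hcont y w hz2)) (hcont x w hz3) (by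
        funext t
        refine Subtype.ext ?_
        simp only [Function.comp_apply, Pi.add_apply]
        rw [Complex.exp_add, hR x y z hz1, hR y w z hz2, hR x w z hz3, ← Units.val_mul,
          frameRatio_mul]) 0 (by simp [hR0 x y z hz1, hR0 y w z hz2, hR0 x w z hz3])
    have := congrFun key 1
    simp only [Pi.add_apply] at this ⊢
    rw [← this]
    ring

end logcocycle

/-! ### Splitting smooth `ℂˣ`-valued cocycles. -/

section split

variable {n : ℕ} {M : Type u} [TopologicalSpace M] [ChartedSpace (EuclideanSpace ℝ (Fin n)) M]

/-- A continuous logarithm of a smooth function is smooth. -/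
theorem ContMDiffAt.of_exp {g f : M → ℂ} {z : M} (hg : ContinuousAt g z)
    (hf : ContMDiffAt (𝓡 n) 𝓘(ℝ, ℂ) ∞ f z) (h : ∀ᶠ y in 𝓝 z, Complex.exp (g y) = f y) :
    ContMDiffAt (𝓡 n) 𝓘(ℝ, ℂ) ∞ g z := by
  have h1 : ContMDiffAt (𝓡 n) 𝓘(ℝ, ℂ) ∞ (fun y => f y / f z) z := by
    have : ContDiff ℝ ∞ fun w : ℂ => w / f z := contDiff_id.div_const _
    exact this.contMDiff.contMDiffAt.comp z hf
  have hz : f z ≠ 0 := h.self_of_nhds ▸ Complex.exp_ne_zero _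
  have hlog : ContMDiffAt (𝓡 n) 𝓘(ℝ, ℂ) ∞ (fun y => Complex.log (f y / f z) + g z) z := by
    have hl : ContDiffAt ℝ ∞ (fun w => Complex.log w + g z) (f z / f z) := by
      rw [div_self hz]
      exact ((Complex.contDiffAt_log Complex.one_mem_slitPlane).restrict_scalars ℝ).add
        contDiffAt_const
    exact hl.contMDiffAt.comp z h1
  refine hlog.congr_of_eventuallyEq ?_
  -- Within this distance the principal logarithm of `exp (g y - g z)` is `g y - g z` itself.
  have hnear : ∀ᶠ y in 𝓝 z, ‖g y - g z‖ < Real.pi := by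
    have : ContinuousAt (fun y => ‖g y - g z‖) z := (hg.sub continuousAt_const).norm
    exact this.eventually (gt_mem_nhds (by simpa using Real.pi_pos))
  filter_upwards [h, hnear] with y hy hn
  have him := (Complex.abs_im_le_norm (g y - g z)).trans_lt hn
  rw [← hy, ← h.self_of_nhds, ← Complex.exp_sub, Complex.log_exp (abs_lt.1 him).1
    (abs_lt.1 him).2.le, sub_add_cancel]

variable [IsManifold (𝓡 n) ∞ M] [T2Space M] [ParacompactSpace M]

/-- Smooth `ℂˣ`-valued Čech `1`-cocycles on a paracompact manifold with contractible components
are coboundaries. -/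
theorem exists_smooth_units_split {H : ℝ × M → M} (hH : Continuous H) (hH1 : ∀ z, H (1, z) = z)
    (hH0 : ∀ x, ∃ U₀, IsOpen U₀ ∧ x ∈ U₀ ∧ ∃ p, ∀ q : ℝ × M, q.1 ≤ 0 → q.2 ∈ U₀ → H q = p)
    {V : M → Set M} (hV : ∀ i, IsOpen (V i)) (hxV : ∀ i, i ∈ V i) {f : M → M → M → ℂˣ}
    (hf : ∀ i j, ∀ z ∈ V i ∩ V j, ContMDiffAt (𝓡 n) 𝓘(ℝ, ℂ) ∞ (fun z => (f i j z : ℂ)) z)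
    (hc : ∀ i j k, ∀ z ∈ V i ∩ V j ∩ V k, f i j z * f j k z = f i k z) :
    ∃ (W : M → Set M) (h : M → M → ℂˣ), (∀ i, IsOpen (W i)) ∧ (∀ i, i ∈ W i) ∧ (∀ i, W i ⊆ V i) ∧
      (∀ i, ∀ z ∈ W i, ContMDiffAt (𝓡 n) 𝓘(ℝ, ℂ) ∞ (fun z => (h i z : ℂ)) z) ∧
      ∀ i j, ∀ z ∈ W i ∩ W j, f i j z = h i z / h j z := by
  obtain ⟨W, g, hW, hxW, hWV, hg, hexp, hcg⟩ := exists_log_cocycle hH hH1 hH0 hV hxV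
    (fun i j z hz => ContinuousAt.continuousWithinAt
      (Units.isEmbedding_val₀.continuousAt_iff.2 (hf i j z hz).continuousAt)) hc
  obtain ⟨ψ, hψ, hψg⟩ := exists_smooth_additive_split (n := n) hW
    (Set.eq_univ_of_forall fun x => Set.mem_iUnion.2 ⟨x, hxW x⟩) (g := g)
    (fun i j z hz => by
      have hn := ((hW i).inter (hW j)).mem_nhds hz
      refine ContMDiffAt.of_exp ((hg i j).continuousAt hn)
        (hf i j z ⟨hWV i hz.1, hWV j hz.2⟩) ?_
      filter_upwards [hn] with y hy using hexp i j y hy) hcg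
  refine ⟨W, fun i z => Units.mk0 _ (Complex.exp_ne_zero (ψ i z)), hW, hxW, hWV,
    fun i z hz => ?_, fun i j z hz => Units.ext ?_⟩
  · have : ContDiff ℝ ∞ Complex.exp := Complex.contDiff_exp
    exact this.contMDiff.contMDiffAt.comp z (hψ i z hz)
  · rw [Units.val_div_eq_div_val, Units.val_mk0, Units.val_mk0, ← Complex.exp_sub, ← hψg i j z hz,
      hexp i j z hz]

end split

/-! ### Quasi-isomorphisms of abelian groups in terms of elements. -/

section ab

namespace CategoryTheory.ShortComplex

theorem ab_exists_cycle (S : ShortComplex Ab.{u}) (x : S.X₂) (hx : S.g x = 0) :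
    ∃ z : S.cycles, S.iCycles z = x :=
  ⟨S.abCyclesIso.inv (⟨x, hx⟩ : S.g.hom.ker), S.abCyclesIso_inv_apply_iCycles ⟨x, hx⟩⟩

theorem ab_iCycles_injective (S : ShortComplex Ab.{u}) : Function.Injective S.iCycles :=
  (AddCommGrpCat.mono_iff_injective _).1 inferInstance

theorem ab_g_iCycles (S : ShortComplex Ab.{u}) (z : S.cycles) : S.g (S.iCycles z) = 0 := by
  rw [← ConcreteCategory.comp_apply, S.iCycles_g]; rfl

theorem ab_homologyπ_eq_zero_iff (S : ShortComplex Ab.{u}) (z : S.cycles) :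
    S.homologyπ z = 0 ↔ ∃ y, S.f y = S.iCycles z := by
  have hex : (ShortComplex.mk S.toCycles S.homologyπ (by simp)).Exact :=
    ShortComplex.exact_of_g_is_cokernel _ S.homologyIsCokernel
  constructor
  · intro h
    obtain ⟨y, hy⟩ := (ab_exact_iff _).1 hex z h
    refine ⟨y, ?_⟩
    rw [← hy, ← ConcreteCategory.comp_apply]
    exact congrArg (fun u : S.X₁ ⟶ S.X₂ => u y) S.toCycles_i.symm
  · rintro ⟨y, hy⟩
    have : S.toCycles y = z := S.ab_iCycles_injective (by
      rw [← hy, ← ConcreteCategory.comp_apply, S.toCycles_i])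
    rw [← this, ← ConcreteCategory.comp_apply, S.toCycles_comp_homologyπ]; rfl

theorem ab_homologyπ_surjective (S : ShortComplex Ab.{u}) : Function.Surjective S.homologyπ :=
  (AddCommGrpCat.epi_iff_surjective _).1 inferInstance

/-- Quasi-isomorphisms of short complexes of abelian groups in terms of elements. -/
theorem ab_quasiIso_iff {S T : ShortComplex Ab.{u}} (φ : S ⟶ T) : QuasiIso φ ↔
    (∀ x, S.g x = 0 → (∃ y, T.f y = φ.τ₂ x) → ∃ y, S.f y = x) ∧
      ∀ b, T.g b = 0 → ∃ a, S.g a = 0 ∧ ∃ c, T.f c = b - φ.τ₂ a := by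
  have hi : ∀ z, T.iCycles (cyclesMap φ z) = φ.τ₂ (S.iCycles z) := fun z => by
    rw [← ConcreteCategory.comp_apply, cyclesMap_i, ConcreteCategory.comp_apply]
  have hπ : ∀ z, homologyMap φ (S.homologyπ z) = T.homologyπ (cyclesMap φ z) := fun z => by
    rw [← ConcreteCategory.comp_apply, homologyπ_naturality, ConcreteCategory.comp_apply]
  rw [quasiIso_iff, ConcreteCategory.isIso_iff_bijective]
  refine and_congr ?_ ?_
  · rw [injective_iff_map_eq_zero]
    constructor
    · rintro h x hx ⟨y, hy⟩
      obtain ⟨z, rfl⟩ := S.ab_exists_cycle x hx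
      refine (S.ab_homologyπ_eq_zero_iff z).1 (h _ ?_)
      rw [hπ, ab_homologyπ_eq_zero_iff]
      exact ⟨y, by rw [hi]; exact hy⟩
    · intro h w hw
      obtain ⟨z, rfl⟩ := S.ab_homologyπ_surjective w
      rw [hπ, ab_homologyπ_eq_zero_iff, hi] at hw
      exact (S.ab_homologyπ_eq_zero_iff z).2 (h _ (S.ab_g_iCycles z) hw)
  · constructor
    · intro h b hb
      obtain ⟨z, rfl⟩ := T.ab_exists_cycle b hb
      obtain ⟨w, hw⟩ := h (T.homologyπ z)
      obtain ⟨a, rfl⟩ := S.ab_homologyπ_surjective w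
      rw [hπ, eq_comm, ← sub_eq_zero, ← map_sub, ab_homologyπ_eq_zero_iff, map_sub, hi] at hw
      exact ⟨_, S.ab_g_iCycles a, hw⟩
    · intro h w
      obtain ⟨z, rfl⟩ := T.ab_homologyπ_surjective w
      obtain ⟨a, ha, hc⟩ := h _ (T.ab_g_iCycles z)
      obtain ⟨a, rfl⟩ := S.ab_exists_cycle a ha
      refine ⟨S.homologyπ a, ?_⟩
      rw [hπ, eq_comm, ← sub_eq_zero, ← map_sub, ab_homologyπ_eq_zero_iff, map_sub, hi]
      exact hc

end CategoryTheory.ShortComplex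

end ab

namespace EtaleGroupoid

/-! ### Existence of injective resolutions. -/

section resolution

variable {n : ℕ} {G₀ G₁ : Type u}
  [TopologicalSpace G₀] [ChartedSpace (EuclideanSpace ℝ (Fin n)) G₀]
  [TopologicalSpace G₁] [ChartedSpace (EuclideanSpace ℝ (Fin n)) G₁]
  {G : EtaleGroupoid n G₀ G₁}

/-- `j` induces isomorphisms on the cohomology of the stalks at `x`, in terms of elements. -/
structure StalkQuasiIso {K T : CochainComplex (Shf G) ℕ} (j : K ⟶ T) (x : G₀) : Prop where
  inj0 : ∀ a, (K.d 0 1).app x a = 0 → (j.f 0).app x a = 0 → a = 0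
  surj0 : ∀ b, (T.d 0 1).app x b = 0 → ∃ a, (K.d 0 1).app x a = 0 ∧ (j.f 0).app x a = b
  inj : ∀ m a, (K.d (m + 1) (m + 2)).app x a = 0 →
    (∃ b, (T.d m (m + 1)).app x b = (j.f (m + 1)).app x a) → ∃ c, (K.d m (m + 1)).app x c = a
  surj : ∀ m b, (T.d (m + 1) (m + 2)).app x b = 0 → ∃ a, (K.d (m + 1) (m + 2)).app x a = 0 ∧
    ∃ c, (T.d m (m + 1)).app x c = b - (j.f (m + 1)).app x a

theorem quasiIso_stalk_iff {K T : CochainComplex (Shf G) ℕ} (j : K ⟶ T) (x : G₀) :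
    QuasiIso (((Shf.stalkFunctor (G := G) x).mapHomologicalComplex (ComplexShape.up ℕ)).map j) ↔
      StalkQuasiIso j x := by
  -- The predecessor of `0` in the shape is `0` itself, so the incoming differential in degree `0`
  -- is `d 0 0`, which vanishes.
  have h0 : (K.d 0 0 = 0) ∧ (T.d 0 0 = 0) := ⟨K.shape 0 0 (by simp), T.shape 0 0 (by simp)⟩
  have key0 := (quasiIsoAt_iff' (((Shf.stalkFunctor (G := G) x).mapHomologicalComplex
    (ComplexShape.up ℕ)).map j) 0 0 1 (by simp) (by simp)).trans (ShortComplex.ab_quasiIso_iff _)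
  have key := fun m => (quasiIsoAt_iff' (((Shf.stalkFunctor (G := G) x).mapHomologicalComplex
    (ComplexShape.up ℕ)).map j) m (m + 1) (m + 2) (by simp) (by simp)).trans
      (ShortComplex.ab_quasiIso_iff _)
  rw [quasiIso_iff]
  constructor
  · intro h
    have k0 := key0.1 (h 0)
    refine ⟨fun a h1 h2 => ?_, fun b hb => ?_, fun m => ((key m).1 (h _)).1,
      fun m => ((key m).1 (h _)).2⟩
    · obtain ⟨y, hy⟩ := k0.1 a h1 ⟨0, (map_zero _).trans h2.symm⟩
      have : (K.d 0 0).app x y = a := hy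
      rw [← this, h0.1]; rfl
    · obtain ⟨a, ha, c, hc⟩ := k0.2 b hb
      have : (T.d 0 0).app x c = b - (j.f 0).app x a := hc
      rw [h0.2] at this
      exact ⟨a, ha, (sub_eq_zero.1 (this.symm.trans rfl)).symm⟩
  · rintro ⟨i0, s0, i, s⟩ m
    cases m with
    | zero =>
      refine key0.2 ⟨?_, fun b hb => ?_⟩
      · rintro a h1 ⟨y, hy⟩
        have : (T.d 0 0).app x y = (j.f 0).app x a := hy
        rw [h0.2] at this
        refine ⟨0, ?_⟩
        rw [i0 a h1 this.symm]
        exact map_zero _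
      · obtain ⟨a, ha, e⟩ := s0 b hb
        refine ⟨a, ha, 0, (map_zero _).trans ?_⟩
        exact (sub_eq_zero.2 e.symm).symm
    | succ m => exact (key m).2 ⟨i m, s m⟩

/-- An injective abelian group containing all groups of a family. -/
noncomputable def hull {X : Type u} (Q : X → Type u) [∀ x, AddCommGroup (Q x)] : AddCommGrpCat.{u} :=
  Injective.under (AddCommGrpCat.of (∀ x, Q x))

noncomputable instance {X : Type u} (Q : X → Type u) [∀ x, AddCommGroup (Q x)] :
    Injective (AddCommGrpCat.of (hull Q)) :=
  inferInstanceAs (Injective (Injective.under (AddCommGrpCat.of (∀ x, Q x))))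

open Classical in
/-- The embeddings of a family of groups into its hull. -/
noncomputable def toHull {X : Type u} (Q : X → Type u) [∀ x, AddCommGroup (Q x)] (x : X) :
    Q x →+ hull Q :=
  (Injective.ι (AddCommGrpCat.of (∀ x, Q x))).hom.comp (AddMonoidHom.single Q x)

theorem toHull_injective {X : Type u} (Q : X → Type u) [∀ x, AddCommGroup (Q x)] (x : X) :
    Function.Injective (toHull Q x) := by
  classical
  exact ((AddCommGrpCat.mono_iff_injective (Injective.ι (AddCommGrpCat.of (∀ x, Q x)))).1
    inferInstance).comp (Pi.single_injective x)

/-- The morphism to an injective sheaf given by subgroups `S x` of the stalks of `B`. -/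
noncomputable def quotHom (B : Shf G) (S : ∀ x, AddSubgroup (B.stalk x)) :
    B ⟶ G.cofree (hull fun x => B.stalk x ⧸ S x) :=
  Cofree.lift fun x => (toHull (fun x => B.stalk x ⧸ S x) x).comp (QuotientAddGroup.mk' (S x))

theorem ev_quotHom {B : Shf G} {S : ∀ x, AddSubgroup (B.stalk x)} {x : G₀} (b : B.stalk x) :
    Cofree.ev x ((quotHom B S).app x b) = 0 ↔ b ∈ S x := by
  rw [quotHom, Cofree.ev_lift, AddMonoidHom.comp_apply,
    map_eq_zero_iff _ (toHull_injective _ x), QuotientAddGroup.mk'_apply,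
    QuotientAddGroup.eq_zero_iff]

/-- Only this implication is pointwise. The subgroups `S x` need not be stable under arrows, so `b ∈
S x` only makes the value of the image at the unit vanish; `comp_quotHom` obtains vanishing for
whole morphisms. -/
theorem mem_of_quotHom {B : Shf G} {S : ∀ x, AddSubgroup (B.stalk x)} {x : G₀} {b : B.stalk x}
    (h : (quotHom B S).app x b = 0) : b ∈ S x :=
  ev_quotHom b |>.1 (by rw [h, map_zero])

theorem comp_quotHom {A B : Shf G} {S : ∀ x, AddSubgroup (B.stalk x)} (f : A ⟶ B)
    (h : ∀ x a, f.app x a ∈ S x) : f ≫ quotHom B S = 0 :=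
  Cofree.hom_ext fun x a => by
    rw [Shf.comp_app, (ev_quotHom _).2 (h x a)]; rfl

instance {X : Type u} (Q : X → Type u) [∀ x, AddCommGroup (Q x)] : Injective (G.cofree (hull Q)) :=
  Cofree.injective_cofree

/-- A complex of abelian `G`-sheaves concentrated in degrees `0` and `1` has an injective
resolution. -/
theorem exists_isInjRes (K : CochainComplex (Shf G) ℕ)
    (hK : ∀ m x, Subsingleton ((K.X (m + 2)).stalk x)) :
    ∃ (T : CochainComplex (Shf G) ℕ) (j : K ⟶ T), IsInjRes j := by
  let T₀ := G.cofree (hull (K.X 0).stalk)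
  let j₀ : K.X 0 ⟶ T₀ := Cofree.lift (toHull (K.X 0).stalk)
  have hj₀ : ∀ x, Function.Injective (j₀.app x) := Cofree.lift_injective _ (toHull_injective _)
  -- The quotient by `N x` is the stalk of the pushout of `j₀` and `d`. Embedding it into an
  -- injective makes the mapping cone of `j` exact at `T₀ ⊕ K¹`, which is the content of `hker`.
  let N : ∀ x, AddSubgroup (T₀.stalk x × (K.X 1).stalk x) := fun x =>
    ((j₀.app x).prod (-(K.d 0 1).app x)).range
  let Q : G₀ → Type u := fun x => (T₀.stalk x × (K.X 1).stalk x) ⧸ N x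
  let θ : ∀ x, T₀.stalk x × (K.X 1).stalk x →+ hull Q := fun x =>
    (toHull Q x).comp (QuotientAddGroup.mk' (N x))
  have hθ : ∀ x b c, θ x (b, c) = 0 → ∃ a, j₀.app x a = b ∧ -(K.d 0 1).app x a = c := by
    intro x b c h
    rw [AddMonoidHom.comp_apply, map_eq_zero_iff _ (toHull_injective _ x),
      QuotientAddGroup.mk'_apply, QuotientAddGroup.eq_zero_iff] at h
    obtain ⟨a, ha⟩ := h
    exact ⟨a, congrArg Prod.fst ha, congrArg Prod.snd ha⟩
  let T₁ := G.cofree (hull Q)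
  let d₀ : T₀ ⟶ T₁ := Cofree.lift fun x => (θ x).comp (AddMonoidHom.inl _ _)
  let j₁ : K.X 1 ⟶ T₁ := Cofree.lift fun x => (θ x).comp (AddMonoidHom.inr _ _)
  have hev : ∀ x b c, Cofree.ev x (d₀.app x b + j₁.app x c) = θ x (b, c) := fun x b c => by
    rw [map_add, Cofree.ev_lift, Cofree.ev_lift]
    refine ((θ x).map_add _ _).symm.trans (congrArg (θ x) ?_)
    ext <;> simp
  have hker : ∀ x b c, d₀.app x b + j₁.app x c = 0 →
      ∃ a, j₀.app x a = b ∧ -(K.d 0 1).app x a = c := fun x b c h =>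
    hθ x b c (by rw [← hev, h, map_zero])
  have hcomm : j₀ ≫ d₀ = K.d 0 1 ≫ j₁ := by
    refine Cofree.hom_ext fun x a => ?_
    have h0 : θ x (j₀.app x a, -(K.d 0 1).app x a) = 0 := by
      rw [AddMonoidHom.comp_apply, map_eq_zero_iff _ (toHull_injective _ x),
        QuotientAddGroup.mk'_apply, QuotientAddGroup.eq_zero_iff]
      exact ⟨a, rfl⟩
    rw [← hev, map_neg, ← sub_eq_add_neg, map_sub, sub_eq_zero] at h0
    exact h0
  -- The kernel of `d₁` has to be the image of `d₀` together with that of `j₁`, so that `K¹`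
  -- accounts for all of the first cohomology.
  let S₁ : ∀ x, AddSubgroup (T₁.stalk x) := fun x => (d₀.app x).range ⊔ (j₁.app x).range
  let d₁ := quotHom T₁ S₁
  have h01 : d₀ ≫ d₁ = 0 := comp_quotHom _ fun x a => AddSubgroup.mem_sup_left ⟨a, rfl⟩
  have hj1 : j₁ ≫ d₁ = 0 := comp_quotHom _ fun x a => AddSubgroup.mem_sup_right ⟨a, rfl⟩
  -- From degree two on `K` vanishes and the complex is continued as an exact one.
  let succ : ∀ S : ShortComplex (Shf G), Σ' (X₄ : Shf G) (d₂ : S.X₃ ⟶ X₄), S.g ≫ d₂ = 0 :=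
    fun S => ⟨_, quotHom S.X₃ fun x => (S.g.app x).range, comp_quotHom _ fun x a => ⟨a, rfl⟩⟩
  let T := CochainComplex.mk T₀ T₁ _ d₀ d₁ h01 succ
  have hd : ∀ m, T.d m (m + 1) = (CochainComplex.mkAux T₀ T₁ _ d₀ d₁ h01 succ m).f := fun m =>
    CochainComplex.of_d (fun n => (CochainComplex.mkAux T₀ T₁ _ d₀ d₁ h01 succ n).X₁)
      (fun n => (CochainComplex.mkAux T₀ T₁ _ d₀ d₁ h01 succ n).f) m
  have hinj : ∀ m, Injective (T.X m)
    | 0 => inferInstanceAs (Injective (G.cofree _))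
    | 1 => inferInstanceAs (Injective (G.cofree _))
    | 2 => inferInstanceAs (Injective (G.cofree _))
    | m + 3 => inferInstanceAs (Injective (G.cofree _))
  have hex : ∀ m x b, (T.d (m + 2) (m + 3)).app x b = 0 →
      ∃ c, (T.d (m + 1) (m + 2)).app x c = b := by
    intro m x b h
    rw [hd] at h ⊢
    exact mem_of_quotHom h
  let f : ∀ m, K.X m ⟶ T.X m := fun m => match m with
    | 0 => j₀
    | 1 => j₁
    | m + 2 => 0
  let j : K ⟶ T := CochainComplex.ofHom f fun m => by
    match m with
    | 0 => rw [hd]; exact hcomm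
    | 1 =>
      rw [hd]
      exact hj1.trans Limits.comp_zero.symm
    | m + 2 => exact Limits.zero_comp.trans Limits.comp_zero.symm
  refine ⟨T, j, hinj, fun x => (quasiIso_stalk_iff j x).2 ⟨fun a _ h => ?_, fun b h => ?_, ?_, ?_⟩⟩
  · exact hj₀ x (h.trans (map_zero _).symm)
  · rw [hd] at h
    obtain ⟨a, ha, ha'⟩ := hker x b 0 (by rw [map_zero, add_zero]; exact h)
    exact ⟨a, neg_eq_zero.1 ha', ha⟩
  · rintro (_ | m) a h ⟨b, hb⟩
    · rw [hd] at hb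
      have hneg : ∀ b : T₀.stalk x, d₀.app x b = j₁.app x a → d₀.app x (-b) + j₁.app x a = 0 :=
        fun b h => by rw [map_neg, h, neg_add_cancel]
      obtain ⟨c, hc, hc'⟩ := hker x _ a (hneg b hb)
      exact ⟨-c, by rw [map_neg]; exact hc'⟩
    · exact ⟨0, (hK m x).elim _ _⟩
  · rintro (_ | m) b h
    · rw [hd] at h ⊢
      obtain ⟨_, ⟨c, rfl⟩, _, ⟨a, rfl⟩, e⟩ := AddSubgroup.mem_sup.1 (mem_of_quotHom (S := S₁) h)
      exact ⟨a, (hK 0 x).elim _ _, c, by rw [← e]; exact (add_sub_cancel_right _ _).symm⟩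
    · obtain ⟨c, hc⟩ := hex m x b h
      exact ⟨0, map_zero _, c, by rw [hc, map_zero, sub_zero]⟩

end resolution

end EtaleGroupoid

/-! ### Germs and the functions that represent them. -/

namespace Coeff

variable {n : ℕ} {M : Type u} [TopologicalSpace M] [ChartedSpace (EuclideanSpace ℝ (Fin n)) M]
  {C : Coeff n M}

/-- The value of a germ. -/
def val {x : M} : C.stalk x →+ C.V where
  toFun a := Germ.value a.1
  map_zero' := rfl
  map_add' a b := by
    obtain ⟨f, hf, rfl⟩ := exists_germ a
    obtain ⟨g, hg, rfl⟩ := exists_germ b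
    rfl

theorem GoodNear.congr {f g : M → C.V} {x : M} (hf : C.GoodNear f x) (h : f =ᶠ[𝓝 x] g) :
    C.GoodNear g x :=
  (hf.and (eventually_eventually_nhds.2 h)).mono fun _ hz => C.good_congr hz.2 hz.1

/-- The germ `a` is the germ of the function `f`. -/
def IsGerm {x : M} (a : C.stalk x) (f : M → C.V) : Prop := ∃ h, a = C.germ f x h

namespace IsGerm

variable {x : M} {a b : C.stalk x} {f g : M → C.V}

theorem congr (ha : IsGerm a f) (h : f =ᶠ[𝓝 x] g) : IsGerm a g := by
  obtain ⟨hf, rfl⟩ := ha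
  exact ⟨hf.congr h, germ_eq.2 h⟩

theorem eq_iff (ha : IsGerm a f) (hb : IsGerm b g) : a = b ↔ f =ᶠ[𝓝 x] g := by
  obtain ⟨hf, rfl⟩ := ha
  obtain ⟨hg, rfl⟩ := hb
  exact germ_eq

theorem val_eq (ha : IsGerm a f) : val a = f x := by
  obtain ⟨hf, rfl⟩ := ha
  rfl

theorem zero : IsGerm (0 : C.stalk x) 0 := ⟨.of_forall C.good_zero, rfl⟩

theorem add (ha : IsGerm a f) (hb : IsGerm b g) : IsGerm (a + b) (f + g) := by
  obtain ⟨hf, rfl⟩ := ha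
  obtain ⟨hg, rfl⟩ := hb
  exact ⟨hf.add hg, rfl⟩

theorem neg (ha : IsGerm a f) : IsGerm (-a) (-f) := by
  obtain ⟨hf, rfl⟩ := ha
  exact ⟨hf.neg, rfl⟩

theorem sub (ha : IsGerm a f) (hb : IsGerm b g) : IsGerm (a - b) (f - g) := by
  rw [sub_eq_add_neg, sub_eq_add_neg]
  exact ha.add hb.neg

end IsGerm

end Coeff

namespace EtaleGroupoid

section coeff

variable {n : ℕ} {G₀ G₁ : Type u}
  [TopologicalSpace G₀] [ChartedSpace (EuclideanSpace ℝ (Fin n)) G₀]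
  [TopologicalSpace G₁] [ChartedSpace (EuclideanSpace ℝ (Fin n)) G₁]
  {G : EtaleGroupoid n G₀ G₁} {C : Coeff n G₀}

open Coeff (IsGerm)

theorem isGerm_tr {x y : G₀} (e : x = y) {a : (G.coeffShf C).stalk x} {f : G₀ → C.V}
    (h : IsGerm (C := C) a f) : IsGerm (C := C) ((G.coeffShf C).tr e a) f := by
  subst e; exact h

theorem isGerm_act {g : G₁} {x y : G₀} (hs : G.s g = x) (ht : G.t g = y)
    {a : (G.coeffShf C).stalk x} {f : G₀ → C.V} (h : IsGerm (C := C) a f) :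
    IsGerm (C := C) ((G.coeffShf C).act g hs ht a) (C.pull (G.flow g) f) := by
  obtain ⟨hf, rfl⟩ := h
  exact ⟨Coeff.GoodNear.pull (G.flow_smooth g ht) ((G.flow_of_eq hs ht).symm ▸ hf), rfl⟩

/-- A continuous section is near each point the section of germs of a fixed function. -/
theorem Shf.ContAt.eventually_isGerm {Y : Type*} [TopologicalSpace Y] {p : Y → G₀}
    {σ : ∀ y, (G.coeffShf C).stalk (p y)} {y : Y} (hσ : (G.coeffShf C).ContAt σ y) {f : G₀ → C.V}
    (e : IsGerm (C := C) (σ y) f) : ∀ᶠ z in 𝓝 y, IsGerm (C := C) (σ z) f := by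
  obtain ⟨h, e⟩ := e
  have h1 := Coeff.eventually_pgerm (C := C) ⟨p y, σ y⟩ f h (by rw [e]; rfl)
  have h2 : ContinuousAt (fun y => (⟨p y, σ y⟩ : C.Space)) y := hσ
  filter_upwards [h2.eventually h1] with z ⟨h', hz⟩
  refine ⟨h', ?_⟩
  injection hz

theorem contAt_of_isGerm {f : G₀ → C.V} {Y : Type*} [TopologicalSpace Y] {p : Y → G₀} {y : Y}
    {σ : ∀ y, (G.coeffShf C).stalk (p y)} (hp : ContinuousAt p y)
    (h : ∀ᶠ z in 𝓝 y, IsGerm (C := C) (σ z) f) : (G.coeffShf C).ContAt σ y :=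
  Coeff.continuousAt_of (C := C) f p hp (h.mono fun z ⟨h', hz⟩ => ⟨h', by rw [hz]; rfl⟩)

/-- A section over `G₀` continuous near a point is the germ of its function of values. -/
theorem Shf.ContAt.isGerm_val {σ : ∀ x, (G.coeffShf C).stalk x} {x : G₀}
    (hσ : (G.coeffShf C).ContAt (p := id) σ x) :
    IsGerm (C := C) (σ x) (fun z => Coeff.val (C := C) (σ z)) := by
  obtain ⟨f, hf⟩ := Coeff.exists_germ (σ x)
  exact IsGerm.congr hf ((hσ.eventually_isGerm hf).mono fun z hz => hz.val_eq.symm)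

/-- A section over `G₁` is the germ of its function of values, transported along `t`. -/
theorem Shf.ContAt.isGerm_val_t {σ : ∀ g, (G.coeffShf C).stalk (G.t g)} {g : G₁}
    (hσ : (G.coeffShf C).ContAt (p := G.t) σ g) :
    IsGerm (C := C) (σ g) (fun z => Coeff.val (C := C) (σ (G.tInv g z))) := by
  obtain ⟨f, hf⟩ := Coeff.exists_germ (σ g)
  have hc := (G.tInv_continuousAt g).self_of_nhds
  rw [ContinuousAt, tInv_t] at hc
  refine IsGerm.congr hf ?_
  filter_upwards [hc.eventually (hσ.eventually_isGerm hf), G.t_tInv g] with z hz ht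
  rw [hz.val_eq, ht]

end coeff

section units

variable {n : ℕ} {G₀ G₁ : Type u}
  [TopologicalSpace G₀] [ChartedSpace (EuclideanSpace ℝ (Fin n)) G₀] [IsManifold (𝓡 n) ∞ G₀]
  [TopologicalSpace G₁] [ChartedSpace (EuclideanSpace ℝ (Fin n)) G₁]
  {G : EtaleGroupoid n G₀ G₁}

/-- `a` is the germ of `f : G₀ → ℂˣ`. -/
def IsUnitGerm {x : G₀} (a : G.unitsShf.stalk x) (f : G₀ → ℂˣ) : Prop :=
  Coeff.IsGerm (C := unitsCoeff G₀) a fun z => Additive.ofMul (f z)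

/-- The value of a germ of functions to `ℂˣ`. -/
def uval {x : G₀} : G.unitsShf.stalk x →+ Additive ℂˣ := Coeff.val (C := unitsCoeff G₀)

theorem isUnitGerm_of_smooth {f : G₀ → ℂˣ} {x : G₀}
    (h : ∀ᶠ z in 𝓝 x, ContMDiffAt (𝓡 n) 𝓘(ℝ, ℂ) ∞ (fun z => (f z : ℂ)) z) :
    ∃ a : G.unitsShf.stalk x, IsUnitGerm a f :=
  ⟨(unitsCoeff G₀).germ (fun z => Additive.ofMul (f z)) x h, h, rfl⟩

theorem contAt_of_isUnitGerm {f : G₀ → ℂˣ} {Y : Type*} [TopologicalSpace Y] {p : Y → G₀} {y : Y}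
    {σ : ∀ y, G.unitsShf.stalk (p y)} (hp : ContinuousAt p y)
    (h : ∀ᶠ z in 𝓝 y, IsUnitGerm (σ z) f) : G.unitsShf.ContAt σ y :=
  contAt_of_isGerm (C := unitsCoeff G₀) hp h

theorem exists_isUnitGerm {x : G₀} (a : G.unitsShf.stalk x) : ∃ f, IsUnitGerm a f :=
  Coeff.exists_germ (C := unitsCoeff G₀) a

/-- `a` is the germ of the 1-form `A`. -/
def IsFormGerm {x : G₀} (a : G.formShf.stalk x) (A : CForm n G₀) : Prop :=
  Coeff.IsGerm (C := formCoeff G₀) a A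

/-- The value of a germ of 1-forms. -/
noncomputable def fval {x : G₀} : G.formShf.stalk x →+ (EuclideanSpace ℝ (Fin n) →L[ℝ] ℂ) :=
  Coeff.val (C := formCoeff G₀)

namespace IsUnitGerm

variable {x y : G₀} {a b : G.unitsShf.stalk x} {f g : G₀ → ℂˣ}

theorem smooth (h : IsUnitGerm a f) :
    ∀ᶠ z in 𝓝 x, ContMDiffAt (𝓡 n) 𝓘(ℝ, ℂ) ∞ (fun z => (f z : ℂ)) z := h.choose

theorem eq_iff (ha : IsUnitGerm a f) (hb : IsUnitGerm b g) : a = b ↔ f =ᶠ[𝓝 x] g :=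
  Coeff.IsGerm.eq_iff ha hb

theorem eq_zero_iff (ha : IsUnitGerm a f) : a = 0 ↔ f =ᶠ[𝓝 x] 1 :=
  Coeff.IsGerm.eq_iff ha Coeff.IsGerm.zero

theorem uval_eq (ha : IsUnitGerm a f) : uval a = Additive.ofMul (f x) := Coeff.IsGerm.val_eq ha

theorem add (ha : IsUnitGerm a f) (hb : IsUnitGerm b g) : IsUnitGerm (a + b) (f * g) :=
  Coeff.IsGerm.add ha hb

theorem sub (ha : IsUnitGerm a f) (hb : IsUnitGerm b g) : IsUnitGerm (a - b) (f / g) :=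
  Coeff.IsGerm.sub ha hb

theorem tr (e : x = y) (ha : IsUnitGerm a f) : IsUnitGerm (G.unitsShf.tr e a) f :=
  isGerm_tr (C := unitsCoeff G₀) e ha

theorem act {k : G₁} (hs : G.s k = x) (ht : G.t k = y) (ha : IsUnitGerm a f) :
    IsUnitGerm (G.unitsShf.act k hs ht a) (f ∘ G.flow k) :=
  isGerm_act (C := unitsCoeff G₀) hs ht ha

theorem dlog (ha : IsUnitGerm a f) : IsFormGerm (G.dlogHom.app x a) (CForm.dlog f) := by
  obtain ⟨h, rfl⟩ := ha
  exact ⟨dlogOp_good h, rfl⟩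

end IsUnitGerm

namespace IsFormGerm

variable {x y : G₀} {a b : G.formShf.stalk x} {A B : CForm n G₀}

theorem smooth (h : IsFormGerm a A) : ∀ᶠ z in 𝓝 x, A.SmoothAt z := h.choose

theorem eq_iff (ha : IsFormGerm a A) (hb : IsFormGerm b B) : a = b ↔ ∀ᶠ z in 𝓝 x, A z = B z :=
  Coeff.IsGerm.eq_iff ha hb

theorem eq_zero_iff (ha : IsFormGerm a A) : a = 0 ↔ ∀ᶠ z in 𝓝 x, A z = 0 :=
  Coeff.IsGerm.eq_iff ha Coeff.IsGerm.zero

theorem fval_eq (ha : IsFormGerm a A) : fval a = A x := Coeff.IsGerm.val_eq ha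

theorem add (ha : IsFormGerm a A) (hb : IsFormGerm b B) : IsFormGerm (a + b) (A + B) :=
  Coeff.IsGerm.add ha hb

theorem sub (ha : IsFormGerm a A) (hb : IsFormGerm b B) : IsFormGerm (a - b) (A - B) :=
  Coeff.IsGerm.sub ha hb

theorem act {k : G₁} (hs : G.s k = x) (ht : G.t k = y) (ha : IsFormGerm a A) :
    IsFormGerm (G.formShf.act k hs ht a) (CForm.pull (G.flow k) A) :=
  isGerm_act (C := formCoeff G₀) hs ht ha

end IsFormGerm

theorem uval_tr {x y : G₀} (e : x = y) (a : G.unitsShf.stalk x) :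
    uval (G.unitsShf.tr e a) = uval a := by
  subst e; rfl

/-- The action on `ℂˣ_G` does not change values. -/
theorem uval_act {k : G₁} {x y : G₀} (hs : G.s k = x) (ht : G.t k = y) (a : G.unitsShf.stalk x) :
    uval (G.unitsShf.act k hs ht a) = uval a := by
  obtain ⟨f, h⟩ := exists_isUnitGerm a
  rw [(h.act hs ht).uval_eq, h.uval_eq, Function.comp_apply, G.flow_of_eq hs ht]

end units

/-! ### The total complex in low degrees. -/

namespace Tot

variable {n : ℕ} {G₀ G₁ : Type u}
  [TopologicalSpace G₀] [ChartedSpace (EuclideanSpace ℝ (Fin n)) G₀]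
  [TopologicalSpace G₁] [ChartedSpace (EuclideanSpace ℝ (Fin n)) G₁]
  {G : EtaleGroupoid n G₀ G₁} {K T : CochainComplex (Shf G) ℕ}

/-- The element of total degree `0` with component `f`. -/
def single (f : Cochain (K.X 0) 0) : Tot K 0
  | ⟨(0, 0), _⟩ => f
  | ⟨(0, l + 1), h⟩ => absurd h (by simp)
  | ⟨(k + 1, l), h⟩ => absurd h (by simp)

theorem exists_single (b : Tot K 0) : ∃ f, b = single f := by
  refine ⟨b ⟨(0, 0), rfl⟩, funext ?_⟩
  rintro ⟨⟨_ | k, _ | l⟩, h⟩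
  · rfl
  all_goals exact absurd h (by simp)

theorem ext_pair {c c' : Tot K 1} (h : c ⟨(1, 0), rfl⟩ = c' ⟨(1, 0), rfl⟩)
    (h' : c ⟨(0, 1), rfl⟩ = c' ⟨(0, 1), rfl⟩) : c = c' := by
  funext p
  obtain ⟨⟨k, l⟩, hp⟩ := p
  have hp' : k + l = 1 := hp
  obtain ⟨rfl, rfl⟩ | ⟨rfl, rfl⟩ : (k = 1 ∧ l = 0) ∨ (k = 0 ∧ l = 1) := by omega
  · exact h
  · exact h'

theorem exists_pair (c : Tot K 1) : ∃ a b, c = pair a b :=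
  ⟨c ⟨(1, 0), rfl⟩, c ⟨(0, 1), rfl⟩, ext_pair rfl rfl⟩

theorem pair_inj {a a' : Cochain (K.X 0) 1} {b b' : Cochain (K.X 1) 0} :
    pair a b = pair a' b' ↔ a = a' ∧ b = b' := by
  refine ⟨fun h => ⟨congrFun h ⟨(1, 0), rfl⟩, congrFun h ⟨(0, 1), rfl⟩⟩, ?_⟩
  rintro ⟨rfl, rfl⟩; rfl

theorem pair_sub (a a' : Cochain (K.X 0) 1) (b b' : Cochain (K.X 1) 0) :
    pair a b - pair a' b' = pair (a - a') (b - b') := ext_pair rfl rfl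

theorem map_pair (j : K ⟶ T) (a : Cochain (K.X 0) 1) (b : Cochain (K.X 1) 0) :
    map j (pair a b) = pair (Cochain.map (j.f 0) 1 a) (Cochain.map (j.f 1) 0 b) := ext_pair rfl rfl

theorem D_single (f : Cochain (K.X 0) 0) : D K 0 (single f) =
    pair (-Cochain.delta (K.X 0) 0 f) (Cochain.map (K.d 0 1) 0 f) := by
  refine ext_pair ?_ ?_
  · change 0 + (-1 : ℤ) ^ (0 + 1) • Cochain.delta (K.X 0) 0 f = -Cochain.delta (K.X 0) 0 f
    simp
  · change Cochain.map (K.d 0 1) 0 f + 0 = Cochain.map (K.d 0 1) 0 f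
    simp

theorem D_pair_eq_zero_iff (a : Cochain (K.X 0) 1) (b : Cochain (K.X 1) 0) : D K 1 (pair a b) = 0 ↔
    Cochain.delta (K.X 0) 1 a = 0 ∧ Cochain.map (K.d 0 1) 1 a + Cochain.delta (K.X 1) 0 b = 0 ∧
      Cochain.map (K.d 1 2) 0 b = 0 := by
  have e20 : D K 1 (pair a b) ⟨(2, 0), rfl⟩ = -Cochain.delta (K.X 0) 1 a := by
    change 0 + (-1 : ℤ) ^ (0 + 1) • Cochain.delta (K.X 0) 1 a = _
    simp
  have e11 : D K 1 (pair a b) ⟨(1, 1), rfl⟩ =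
      Cochain.map (K.d 0 1) 1 a + Cochain.delta (K.X 1) 0 b := by
    change Cochain.map (K.d 0 1) 1 a + (-1 : ℤ) ^ (1 + 1) • Cochain.delta (K.X 1) 0 b = _
    simp
  have e02 : D K 1 (pair a b) ⟨(0, 2), rfl⟩ = Cochain.map (K.d 1 2) 0 b := by
    change Cochain.map (K.d 1 2) 0 b + 0 = _
    simp
  constructor
  · intro h
    rw [h] at e20 e11 e02
    exact ⟨neg_eq_zero.1 e20.symm, e11.symm, e02.symm⟩
  · rintro ⟨h1, h2, h3⟩
    funext p
    obtain ⟨⟨k, l⟩, hp⟩ := p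
    have hp' : k + l = 2 := hp
    obtain ⟨rfl, rfl⟩ | ⟨rfl, rfl⟩ | ⟨rfl, rfl⟩ :
      (k = 2 ∧ l = 0) ∨ (k = 1 ∧ l = 1) ∨ (k = 0 ∧ l = 2) := by omega
    · exact e20.trans (by rw [h1]; exact neg_zero)
    · exact e11.trans h2
    · exact e02.trans h3

end Tot

end EtaleGroupoid

/-! ### Functoriality of the pull-back of 1-forms. -/

namespace CForm

variable {n : ℕ} {M N P : Type u}
  [TopologicalSpace M] [ChartedSpace (EuclideanSpace ℝ (Fin n)) M]
  [TopologicalSpace N] [ChartedSpace (EuclideanSpace ℝ (Fin n)) N]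
  [TopologicalSpace P] [ChartedSpace (EuclideanSpace ℝ (Fin n)) P]

theorem pull_comp_apply {φ : N → M} {ψ : P → N} {z : P} (α : CForm n M)
    (hφ : MDifferentiableAt (𝓡 n) (𝓡 n) φ (ψ z)) (hψ : MDifferentiableAt (𝓡 n) (𝓡 n) ψ z) :
    pull (φ ∘ ψ) α z = pull ψ (pull φ α) z := by
  simp only [pull, mfderiv_comp z hφ hψ]
  rfl

theorem pull_of_eventuallyEq_id {φ : M → M} {z : M} (α : CForm n M) (h : φ =ᶠ[𝓝 z] id) :
    pull φ α z = α z := by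
  have e : (mfderiv (𝓡 n) (𝓡 n) φ z : EuclideanSpace ℝ (Fin n) →L[ℝ] _) =
    ContinuousLinearMap.id ℝ (EuclideanSpace ℝ (Fin n)) := h.mfderiv_eq.trans mfderiv_id
  change (α (φ z) : EuclideanSpace ℝ (Fin n) →L[ℝ] ℂ).comp
    (mfderiv (𝓡 n) (𝓡 n) φ z : EuclideanSpace ℝ (Fin n) →L[ℝ] _) = α z
  rw [e, h.self_of_nhds]
  rfl

theorem dlog_comp {φ : N → M} {f : M → ℂˣ} {z : N} (hφ : MDifferentiableAt (𝓡 n) (𝓡 n) φ z)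
    (hf : MDifferentiableAt (𝓡 n) 𝓘(ℝ, ℂ) (fun z => (f z : ℂ)) (φ z)) :
    dlog (n := n) (f ∘ φ) z = pull φ (dlog f) z := by
  have e : d (n := n) (fun w => ((f ∘ φ) w : ℂ)) z =
    (d (fun w => (f w : ℂ)) (φ z)).comp (mfderiv (𝓡 n) (𝓡 n) φ z) := mfderiv_comp z hf hφ
  simp only [dlog, pull]
  rw [e]
  rfl

end CForm

/-! ### Line bundles with connection as Čech 1-cocycles. -/

namespace EtaleGroupoid

variable {n : ℕ} {G₀ G₁ : Type u}
  [TopologicalSpace G₀] [ChartedSpace (EuclideanSpace ℝ (Fin n)) G₀] [IsManifold (𝓡 n) ∞ G₀]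
  [TopologicalSpace G₁] [ChartedSpace (EuclideanSpace ℝ (Fin n)) G₁]
  {G : EtaleGroupoid n G₀ G₁}

theorem units2_d : G.units2.d 0 1 = G.dlogHom := CochainComplex.of_d G.units2X G.units2d 0

theorem subsingleton_units2_stalk (m : ℕ) (x : G₀) :
    Subsingleton ((G.units2.X (m + 2)).stalk x) := inferInstanceAs (Subsingleton PUnit)

/-- The function `ρ` on arrows represents the cochain `a`. -/
def Represents (a : Cochain G.unitsShf 1) (ρ : G₁ → ℂˣ) : Prop :=
  ∀ g, IsUnitGerm (Cochain.at1 g a) (ρ ∘ G.tInv g)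

namespace Represents

variable {a a' : Cochain G.unitsShf 1} {ρ ρ' : G₁ → ℂˣ}

theorem of_cochain (a : Cochain G.unitsShf 1) :
    Represents a fun g => (uval (Cochain.at1 g a)).toMul :=
  fun g => Shf.ContAt.isGerm_val_t (C := unitsCoeff G₀) (Cochain.contAt1 a g)

theorem uval_eq (h : Represents a ρ) (g : G₁) :
    uval (Cochain.at1 g a) = Additive.ofMul (ρ g) := by
  rw [(h g).uval_eq, Function.comp_apply, G.tInv_t]

theorem ext (h : Represents a ρ) (h' : Represents a' ρ) : a = a' :=
  Cochain.ext1 fun g => ((h g).eq_iff (h' g)).2 .rfl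

theorem smooth (h : Represents a ρ) : ContMDiff (𝓡 n) 𝓘(ℝ, ℂ) ∞ fun g => (ρ g : ℂ) := by
  intro g
  refine ((h g).smooth.self_of_nhds.comp g (G.t_loc.contMDiff g)).congr_of_eventuallyEq ?_
  filter_upwards [(G.t_loc g).localInverse_eventuallyEq_left] with k hk
  have hk' : G.tInv g (G.t k) = k := hk
  simp only [Function.comp_apply, hk']

/-- Neither the action nor transport changes values, so taking values in the cocycle condition gives
multiplicativity. Conversely an equality of germs is needed: near `t k` the local inverse through
`gk` is a product of arrows near `g` and `k` (`tInv_m`), to which multiplicativity applies. -/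
theorem delta_eq_zero_iff (h : Represents a ρ) : Cochain.delta G.unitsShf 1 a = 0 ↔
    ∀ g k w, ρ (G.m g k w) = ρ g * ρ k := by
  constructor
  · intro e g k w
    have key := congrArg uval (congrArg (Cochain.at2 g k w) e)
    rw [Cochain.at2_delta, map_zero, map_zero, map_add, map_sub, uval_tr, uval_act, h.uval_eq,
      h.uval_eq, h.uval_eq] at key
    have e2 : ρ k / ρ (G.m g k w) * ρ g = 1 := congrArg Additive.toMul key
    rw [div_mul_eq_mul_div, div_eq_one] at e2
    rw [← e2, mul_comm]
  · intro e
    refine Cochain.ext2 fun g k w => ?_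
    rw [Cochain.at2_delta, map_zero, ((((h k).sub ((h _).tr _)).add ((h g).act _ _)).eq_zero_iff)]
    filter_upwards [G.tInv_m g k w] with z ⟨w', hz⟩
    simp only [Pi.mul_apply, Pi.div_apply, Function.comp_apply, hz, e, Pi.one_apply]
    rw [div_mul_eq_mul_div, mul_comm, div_self']

end Represents

/-- The 1-form `A` represents the cochain `b`. -/
def RepresentsForm (b : Cochain G.formShf 0) (A : CForm n G₀) : Prop :=
  ∀ x, IsFormGerm (Cochain.at0 x b) A

namespace RepresentsForm

theorem of_cochain (b : Cochain G.formShf 0) :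
    RepresentsForm b fun x => fval (Cochain.at0 x b) :=
  fun x => Shf.ContAt.isGerm_val (C := formCoeff G₀) (Cochain.contAt0 b x)

variable {b b' : Cochain G.formShf 0} {A : CForm n G₀}

theorem ext (h : RepresentsForm b A) (h' : RepresentsForm b' A) : b = b' :=
  Cochain.ext0 fun g => ((h g).eq_iff (h' g)).2 (.of_forall fun _ => rfl)

theorem fval_eq (h : RepresentsForm b A) (x : G₀) : fval (Cochain.at0 x b) = A x := (h x).fval_eq

theorem smooth (h : RepresentsForm b A) (x : G₀) : A.SmoothAt x := (h x).smooth.self_of_nhds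

end RepresentsForm

variable [IsManifold (𝓡 n) ∞ G₁]

/-- At `g` the cochain on the left is the germ of the pull-back along `tInv g` of `θ = dlog ρ + t^*
A - s^* A`, because `t ∘ tInv g` is the identity near `t g` and `s ∘ tInv g = flow g`. As `tInv g`
is a local diffeomorphism, it vanishes exactly when `θ` does. -/
theorem Represents.dlog_add_delta_eq_zero_iff {a : Cochain G.unitsShf 1} {ρ : G₁ → ℂˣ}
    (ha : Represents a ρ) {b : Cochain G.formShf 0} {A : CForm n G₀} (hb : RepresentsForm b A) :
    Cochain.map G.dlogHom 1 a + Cochain.delta G.formShf 0 b = 0 ↔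
      CForm.pull G.s A - CForm.pull G.t A = CForm.dlog ρ := by
  have hρ := ha.smooth
  let θ : CForm n G₁ := CForm.dlog ρ + (CForm.pull G.t A - CForm.pull G.s A)
  have hθ : CForm.pull G.s A - CForm.pull G.t A = CForm.dlog ρ ↔ θ = 0 := by
    rw [← neg_sub, eq_comm, ← eq_neg_iff_add_eq_zero]
  have key (g : G₁) : ∀ᶠ z in 𝓝 (G.t g),
      ((CForm.dlog (ρ ∘ G.tInv g) : CForm n G₀) + (A - CForm.pull (G.flow g) A)) z = CForm.pull (G.tInv g) θ z := by
    filter_upwards [G.tInv_smooth g, eventually_eventually_nhds.2 (G.t_tInv g)] with z h1 h2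
    have d1 := h1.mdifferentiableAt (by simp)
    have e1 := CForm.dlog_comp d1 ((hρ (G.tInv g z)).mdifferentiableAt (by simp))
    have e2 := CForm.pull_comp_apply A
      ((G.s_loc.contMDiff (G.tInv g z)).mdifferentiableAt (by simp)) d1
    have e3 := CForm.pull_comp_apply A
      ((G.t_loc.contMDiff (G.tInv g z)).mdifferentiableAt (by simp)) d1
    have e4 := CForm.pull_of_eventuallyEq_id A (φ := G.t ∘ G.tInv g) h2
    refine (congrArg₂ (· + ·) e1 (congrArg₂ (· - ·) (e4.symm.trans e3) e2)).trans ?_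
    ext v
    rfl
  have key' (g : G₁) : Cochain.at1 g (Cochain.map G.dlogHom 1 a + Cochain.delta G.formShf 0 b) = 0 ↔
      ∀ᶠ z in 𝓝 (G.t g), CForm.pull (G.tInv g) θ z = 0 := by
    rw [map_add, Cochain.at1_map, Cochain.at1_delta,
      ((ha g).dlog.add ((hb _).sub ((hb _).act rfl rfl))).eq_zero_iff]
    exact eventually_congr ((key g).mono fun z hz => by rw [hz])
  rw [hθ]
  constructor
  · intro e
    funext g
    have h0 := ((key' g).1 (by rw [e, map_zero])).self_of_nhds
    have e1 := CForm.pull_of_eventuallyEq_id θ (φ := G.tInv g ∘ G.t)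
      (G.t_loc g).localInverse_eventuallyEq_left
    have e2 := CForm.pull_comp_apply θ ((G.tInv_smooth g).self_of_nhds.mdifferentiableAt (by simp))
      ((G.t_loc.contMDiff g).mdifferentiableAt (by simp))
    refine (e1.symm.trans e2).trans ?_
    rw [CForm.pull, h0]
    exact ContinuousLinearMap.zero_comp _
  · intro e
    refine Cochain.ext1 fun g => ?_
    rw [map_zero, key', e]
    exact .of_forall fun z => ContinuousLinearMap.zero_comp _

namespace LineBundle

theorem represents (L : LineBundle G) : Represents L.ρCochain L.ρ.arr := fun g =>
  ⟨(G.tInv_smooth g).mono fun z hz => (L.smooth_ρ _).comp z hz, rfl⟩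

theorem representsForm (L : LineBundle G) : RepresentsForm L.ACochain L.A := fun _ =>
  ⟨.of_forall L.smooth_A, rfl⟩

theorem cochain_injective : Function.Injective (cochain (G := G)) := by
  intro L L' h
  obtain ⟨h1, h2⟩ := Tot.pair_inj.1 h
  have e1 : L.ρ.arr = L'.ρ.arr := funext fun g => Additive.ofMul.injective <| by
    rw [← L.represents.uval_eq, ← L'.represents.uval_eq]
    exact congrArg (fun a => uval (Cochain.at1 g a)) h1
  have e2 : L.A = L'.A := funext fun x => by
    rw [← L.representsForm.fval_eq, ← L'.representsForm.fval_eq]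
    exact congrArg (fun a => fval (Cochain.at0 x a)) h2
  refine LineBundle.ext ?_ e2
  generalize L.ρ = ρ at e1 ⊢
  generalize L'.ρ = ρ' at e1 ⊢
  obtain ⟨o, _, _, _, _, _, _⟩ := ρ
  obtain ⟨o', _, _, _, _, _, _⟩ := ρ'
  -- There is only one map to the single object, so a morphism to `unitsGroupoid` is determined by
  -- its map on arrows.
  obtain rfl : o = o' := funext fun _ => rfl
  cases e1
  rfl

theorem D_pair_units2 (a : Cochain G.unitsShf 1) (b : Cochain G.formShf 0) :
    Tot.D G.units2 1 (Tot.pair (K := G.units2) a b) = 0 ↔ Cochain.delta G.unitsShf 1 a = 0 ∧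
      Cochain.map G.dlogHom 1 a + Cochain.delta G.formShf 0 b = 0 := by
  refine (Tot.D_pair_eq_zero_iff (K := G.units2) a b).trans ?_
  rw [units2_d]
  refine and_congr Iff.rfl (and_iff_left ?_)
  exact Cochain.ext0 fun x => (subsingleton_units2_stalk 0 x).elim _ _

theorem D_cochain (L : LineBundle G) : Tot.D G.units2 1 L.cochain = 0 :=
  (D_pair_units2 _ _).2 ⟨L.represents.delta_eq_zero_iff.2 L.ρ.arr_m,
    (L.represents.dlog_add_delta_eq_zero_iff L.representsForm).2 L.compat⟩

theorem exists_cochain_eq_pair {a : Cochain G.unitsShf 1} {b : Cochain G.formShf 0}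
    (h1 : Cochain.delta G.unitsShf 1 a = 0)
    (h2 : Cochain.map G.dlogHom 1 a + Cochain.delta G.formShf 0 b = 0) :
    ∃ L : LineBundle G, L.ρCochain = a ∧ L.ACochain = b := by
  have ha := Represents.of_cochain a
  have hb := RepresentsForm.of_cochain b
  generalize (fun g => (uval (Cochain.at1 g a)).toMul) = ρ at ha
  generalize (fun x => fval (Cochain.at0 x b)) = A at hb
  have hm := ha.delta_eq_zero_iff.1 h1
  -- A multiplicative `ρ` has idempotent values at units; preservation of inverses then follows as
  -- well.
  have he (x : G₀) : ρ (G.e x) = 1 := by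
    have h := hm (G.e x) (G.e x) ((G.t_e x).trans (G.s_e x).symm)
    have h' : G.m (G.e x) (G.e x) ((G.t_e x).trans (G.s_e x).symm) = G.e x :=
      (G.m_congr rfl (by rw [G.t_e]) _).trans (G.m_e (G.e x))
    rwa [h', left_eq_mul] at h
  let L : LineBundle G :=
    { ρ :=
        { obj := fun _ => PUnit.unit
          arr := ρ
          s_arr := fun _ => rfl
          t_arr := fun _ => rfl
          arr_e := he
          arr_i := fun g => by
            have h := hm g (G.i g) (G.s_i g).symm
            rw [G.m_i, he] at h
            exact (inv_eq_of_mul_eq_one_right h.symm).symm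
          arr_m := hm }
      smooth_ρ := ha.smooth
      A := A
      smooth_A := hb.smooth
      compat := (ha.dlog_add_delta_eq_zero_iff hb).1 h2 }
  exact ⟨L, L.represents.ext ha, L.representsForm.ext hb⟩

theorem exists_cochain_eq (c : Tot G.units2 1) (hc : Tot.D G.units2 1 c = 0) :
    ∃ L : LineBundle G, L.cochain = c := by
  obtain ⟨a, b, rfl⟩ := Tot.exists_pair c
  obtain ⟨h1, h2⟩ := (D_pair_units2 a b).1 hc
  obtain ⟨L, ha, hb⟩ := exists_cochain_eq_pair h1 h2
  exact ⟨L, Tot.pair_inj.2 ⟨ha, hb⟩⟩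

/-- Naturality says `f(t g) / f(s g) = ρ'(g) / ρ(g)`, which is `δ γ = ρ' - ρ` for the section `γ` of
germs of `f`. -/
theorem iso_iff {L L' : LineBundle G} : L.Iso L' ↔ ∃ γ : Cochain G.unitsShf 0,
    Cochain.delta G.unitsShf 0 γ = L'.ρCochain - L.ρCochain ∧
      Cochain.map G.dlogHom 0 γ = L.ACochain - L'.ACochain := by
  constructor
  · rintro ⟨f, hf, h, h'⟩
    choose γ hγ using fun x => isUnitGerm_of_smooth (G := G) (x := x) (.of_forall hf)
    refine ⟨Cochain.mk0 γ fun x => contAt_of_isUnitGerm continuousAt_id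
      (.of_forall hγ), Cochain.ext1 fun g => ?_, Cochain.ext0 fun x => ?_⟩
    · rw [Cochain.at1_delta, map_sub, Cochain.at0_mk0, Cochain.at0_mk0,
        ((hγ _).sub ((hγ _).act rfl rfl)).eq_iff ((L'.represents g).sub (L.represents g))]
      filter_upwards [G.t_tInv g] with z hz
      have e := h (G.tInv g z)
      rw [hz] at e
      simp only [Pi.div_apply, Function.comp_apply, flow]
      rw [div_eq_div_iff_mul_eq_mul, mul_comm, ← e, mul_comm]
    · rw [Cochain.at0_map, map_sub, Cochain.at0_mk0,
        (hγ _).dlog.eq_iff ((L.representsForm x).sub (L'.representsForm x))]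
      exact .of_forall fun z => congrFun (eq_sub_of_add_eq h') z
  · rintro ⟨γ, h, h'⟩
    have hγ (x : G₀) : IsUnitGerm (Cochain.at0 x γ) fun x => (uval (Cochain.at0 x γ)).toMul :=
      Shf.ContAt.isGerm_val (C := unitsCoeff G₀) (Cochain.contAt0 γ x)
    refine ⟨_, fun x => (hγ x).smooth.self_of_nhds, fun g => ?_, funext fun x => ?_⟩
    · have e := congrArg uval (congrArg (Cochain.at1 g) h)
      rw [Cochain.at1_delta, map_sub, map_sub, map_sub, uval_act, L.represents.uval_eq,
        L'.represents.uval_eq] at e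
      have e' : (uval (Cochain.at0 (G.t g) γ)).toMul / (uval (Cochain.at0 (G.s g) γ)).toMul =
        L'.ρ.arr g / L.ρ.arr g := congrArg Additive.toMul e
      rw [div_eq_div_iff_mul_eq_mul] at e'
      rw [mul_comm, ← e', mul_comm]
    · have e := congrArg fval (congrArg (Cochain.at0 x) h')
      rw [map_sub, map_sub, L.representsForm.fval_eq, L'.representsForm.fval_eq, Cochain.at0_map,
        (hγ x).dlog.fval_eq] at e
      exact add_eq_of_eq_sub e

/-- The total differential is `-δ` on `C^{0,0}`, so the cobounding cochain is the inverse of the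
isomorphism. -/
theorem iso_iff_cohomologous (L L' : LineBundle G) : L.Iso L' ↔
    ∃ b : Tot G.units2 0, Tot.D G.units2 0 b = L'.cochain - L.cochain := by
  have key (β : Cochain G.unitsShf 0) : Tot.D G.units2 0 (Tot.single (K := G.units2) β) =
      L'.cochain - L.cochain ↔ Cochain.delta G.unitsShf 0 (-β) = L'.ρCochain - L.ρCochain ∧
        Cochain.map G.dlogHom 0 (-β) = L.ACochain - L'.ACochain := by
    have e := Tot.D_single (K := G.units2) β
    rw [units2_d] at e
    rw [map_neg, map_neg, neg_eq_iff_eq_neg (b := L.ACochain - L'.ACochain), neg_sub, e]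
    exact (Eq.congr_right (Tot.pair_sub (K := G.units2) _ _ _ _)).trans Tot.pair_inj
  rw [iso_iff]
  constructor
  · rintro ⟨γ, h⟩
    exact ⟨_, (key (-γ)).2 (by rwa [neg_neg])⟩
  · rintro ⟨b, h⟩
    obtain ⟨β, rfl⟩ := Tot.exists_single b
    exact ⟨_, (key β).1 h⟩

theorem ρCochain_tensor (L L' : LineBundle G) :
    (L.tensor L').ρCochain = L.ρCochain + L'.ρCochain :=
  (L.tensor L').represents.ext fun g => by
    rw [map_add]; exact (L.represents g).add (L'.represents g)

theorem ACochain_tensor (L L' : LineBundle G) :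
    (L.tensor L').ACochain = L.ACochain + L'.ACochain :=
  (L.tensor L').representsForm.ext fun x => by
    rw [map_add]; exact (L.representsForm x).add (L'.representsForm x)

end LineBundle

end EtaleGroupoid

/-! ### Contraction of the pieces of `G₀`. -/

/-- A disjoint union of contractible open sets has a homotopy from a locally constant map to the
identity, parametrized by the real line. -/
theorem exists_homotopy_of_contractible {X ι : Type*} [TopologicalSpace X] (U : ι → Opens X)
    (hd : Pairwise (Function.onFun Disjoint U)) (hU : (⨆ i, U i) = ⊤)
    (hc : ∀ i, ContractibleSpace (U i)) :
    ∃ H : ℝ × X → X, Continuous H ∧ (∀ z, H (1, z) = z) ∧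
      ∀ x, ∃ U₀, IsOpen U₀ ∧ x ∈ U₀ ∧ ∃ p, ∀ q : ℝ × X, q.1 ≤ 0 → q.2 ∈ U₀ → H q = p := by
  have hmem (x : X) : ∃ i, x ∈ U i := by
    have : x ∈ (⨆ i, U i) := hU ▸ trivial
    simpa using this
  choose i hi using hmem
  have huniq {x : X} {j : ι} (hx : x ∈ U j) : i x = j := by
    by_contra hne
    exact Set.disjoint_left.1 (Opens.coe_disjoint.2 (hd hne)) (hi x) hx
  choose p hp using fun i => (contractible_iff_id_nullhomotopic (U i)).1 (hc i)
  let F (i : ι) := (hp i).some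
  -- The contraction `F i` runs from the identity to `p i`; it is reversed and clamped, so that it
  -- rests at `p i` for all times up to `0`.
  let K (i : ι) (q : ℝ × U i) : X := F i (Set.projIcc 0 1 zero_le_one (1 - q.1), q.2)
  have hK (i : ι) : Continuous (K i) :=
    continuous_subtype_val.comp ((F i).continuous.comp ((continuous_projIcc.comp
      (continuous_const.sub continuous_fst)).prodMk continuous_snd))
  let H (q : ℝ × X) : X := K (i q.2) (q.1, ⟨q.2, hi q.2⟩)
  have hH {q : ℝ × X} {j : ι} (hq : q.2 ∈ U j) : H q = K j (q.1, ⟨q.2, hq⟩) := by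
    obtain rfl := huniq hq
    rfl
  refine ⟨H, continuous_iff_continuousAt.2 fun q => ?_, fun z => ?_, fun x => ?_⟩
  · have ho : IsOpen {r : ℝ × X | r.2 ∈ U (i q.2)} := (U (i q.2)).isOpen.preimage continuous_snd
    refine ContinuousOn.continuousAt (s := {r : ℝ × X | r.2 ∈ U (i q.2)}) ?_
      (ho.mem_nhds (hi q.2))
    rw [continuousOn_iff_continuous_domRestrict]
    have : Continuous fun r : {r : ℝ × X | r.2 ∈ U (i q.2)} =>
        K (i q.2) (r.1.1, ⟨r.1.2, r.2⟩) := (hK _).comp (by fun_prop)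
    exact this.congr fun r => (hH r.2).symm
  · simp [H, K]
  · refine ⟨U (i x), (U (i x)).isOpen, hi x, p (i x), fun q hq hx => ?_⟩
    rw [hH hx]
    have : Set.projIcc (0 : ℝ) 1 zero_le_one (1 - q.1) = 1 :=
      Set.projIcc_of_right_le _ (by linarith)
    simp [K, this]

namespace EtaleGroupoid

section twoTerm

variable {n : ℕ} {G₀ G₁ : Type u}
  [TopologicalSpace G₀] [ChartedSpace (EuclideanSpace ℝ (Fin n)) G₀]
  [TopologicalSpace G₁] [ChartedSpace (EuclideanSpace ℝ (Fin n)) G₁]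
  {G : EtaleGroupoid n G₀ G₁}

theorem IsLeray.exists_homotopy (hG : G.IsLeray) :
    ∃ H : ℝ × G₀ → G₀, Continuous H ∧ (∀ z, H (1, z) = z) ∧
      ∀ x, ∃ U₀, IsOpen U₀ ∧ x ∈ U₀ ∧ ∃ p, ∀ q : ℝ × G₀, q.1 ≤ 0 → q.2 ∈ U₀ → H q = p := by
  obtain ⟨ι, U, hd, hU, hc⟩ := hG 0
  obtain ⟨H, h1, h2, h3⟩ := exists_homotopy_of_contractible U hd hU hc
  refine ⟨fun q => (H (q.1, Nerve.of0 q.2)).last, Nerve.continuous_last.comp (h1.comp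
    (continuous_fst.prodMk (Nerve.continuous_of0.comp continuous_snd))), fun z => ?_, fun x => ?_⟩
  · simp only [h2]
    rfl
  · obtain ⟨V, hV, hx, p, hp⟩ := h3 (Nerve.of0 x)
    exact ⟨_, hV.preimage Nerve.continuous_of0, hx, p.last, fun q h h' => by
      simp only [hp (q.1, Nerve.of0 q.2) h h']⟩

/-! ### Comparison of Čech cocycles with invariant sections of a resolution. -/

/-- Sheaves `A → B` and `I → J → J'` and a map of complexes `j` from the first to the second that
induces isomorphisms on stalk cohomology in degrees `0` and `1` and is injective in degree `2`. -/
structure TwoTermRes {A B I J J' : Shf G} (d : A ⟶ B) (j₀ : A ⟶ I) (j₁ : B ⟶ J) (e : I ⟶ J)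
    (e' : J ⟶ J') : Prop where
  comm : j₀ ≫ e = d ≫ j₁
  comp : e ≫ e' = 0
  comp_j : j₁ ≫ e' = 0
  inj : ∀ x a, d.app x a = 0 → j₀.app x a = 0 → a = 0
  lift : ∀ x a b, e.app x a = j₁.app x b → ∃ f, j₀.app x f = a ∧ d.app x f = b
  surj : ∀ x c, e'.app x c = 0 → ∃ a b, e.app x a = c - j₁.app x b

open invSections (toCochain)

/-- A `0`-cochain with vanishing coboundary is an invariant section. -/
theorem exists_toCochain_eq {F : Shf G} {σ : Cochain F 0} (h : Cochain.delta F 0 σ = 0) :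
    ∃ τ : invSections F, toCochain τ = σ := by
  refine ⟨⟨fun x => Cochain.at0 x σ, continuous_iff_continuousAt.2 fun x => Cochain.contAt0 σ x,
    fun g => ?_⟩, Cochain.ext0 fun x => rfl⟩
  have e := congrArg (Cochain.at1 g) h
  rw [Cochain.at1_delta, map_zero] at e
  exact (sub_eq_zero.1 e).symm

theorem delta_toCochain {F : Shf G} (τ : invSections F) : Cochain.delta F 0 (toCochain τ) = 0 :=
  Cochain.ext1 fun g => by
    rw [Cochain.at1_delta, map_zero, sub_eq_zero]
    exact (τ.2.2 g).symm

theorem toCochain_injective {F : Shf G} :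
    Function.Injective (toCochain : invSections F → Cochain F 0) := fun _ _ h =>
  Subtype.ext (funext fun x => congrArg (Cochain.at0 x) h)

theorem toCochain_map {A B : Shf G} (f : A ⟶ B) (σ : invSections A) :
    toCochain (invSections.map f σ) = Cochain.map f 0 (toCochain σ) := rfl

theorem toCochain_add {F : Shf G} (σ τ : invSections F) :
    toCochain (σ + τ) = toCochain σ + toCochain τ := rfl

theorem toCochain_sub {F : Shf G} (σ τ : invSections F) :
    toCochain (σ - τ) = toCochain σ - toCochain τ := rfl

theorem Cochain.ext_at {F : Shf G} {k : ℕ} {σ τ : Cochain F k} (h : ∀ q, σ.1 q = τ.1 q) : σ = τ :=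
  Subtype.ext (funext h)

namespace TwoTermRes

variable {A B I J J' : Shf G} {d : A ⟶ B} {j₀ : A ⟶ I} {j₁ : B ⟶ J} {e : I ⟶ J} {e' : J ⟶ J'}

theorem eq_of (R : TwoTermRes d j₀ j₁ e e') {x : G₀} {a b : A.stalk x}
    (h : j₀.app x a = j₀.app x b) (h' : d.app x a = d.app x b) : a = b := by
  refine sub_eq_zero.1 (R.inj x _ ?_ ?_)
  · rw [map_sub, h', sub_self]
  · rw [map_sub, h, sub_self]

theorem e_j (R : TwoTermRes d j₀ j₁ e e') {x : G₀} (a : A.stalk x) :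
    e.app x (j₀.app x a) = j₁.app x (d.app x a) := by
  rw [← Shf.comp_app, R.comm, Shf.comp_app]

/-- Pointwise lifts are automatically continuous because they are unique: a local section through `f
y` has the same images under `j₀` and `d` as `f` near `y`, hence equals `f` there by `eq_of`. -/
theorem contAt (R : TwoTermRes d j₀ j₁ e e') {Y : Type*} [TopologicalSpace Y] {p : Y → G₀} {y : Y}
    {f : ∀ y, A.stalk (p y)} {a : ∀ y, I.stalk (p y)} {b : ∀ y, B.stalk (p y)}
    (ha : I.ContAt a y) (hb : B.ContAt b y) (hfa : ∀ᶠ z in 𝓝 y, j₀.app _ (f z) = a z)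
    (hfb : ∀ᶠ z in 𝓝 y, d.app _ (f z) = b z) : A.ContAt f y := by
  have hs : A.ContAt (fun z => Shf.sec (f y) (p z)) y :=
    (Shf.sec_contAt (f y)).self_of_nhds.comp (f := p) ha.base
  refine hs.congr ?_
  filter_upwards [hfa, hfb, (hs.app j₀).eventuallyEq ha (by rw [Shf.sec_self, hfa.self_of_nhds]),
    (hs.app d).eventuallyEq hb (by rw [Shf.sec_self, hfb.self_of_nhds])] with z h1 h2 h3 h4
  exact R.eq_of (h3.trans h1.symm) (h4.trans h2.symm)

theorem lift_cochain (R : TwoTermRes d j₀ j₁ e e') {k : ℕ} (a : Cochain I k) (b : Cochain B k)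
    (h : Cochain.map e k a = Cochain.map j₁ k b) :
    ∃ f, Cochain.map j₀ k f = a ∧ Cochain.map d k f = b := by
  choose f hf hf' using fun q => R.lift q.last (a.1 q) (b.1 q) (congrFun (Subtype.ext_iff.1 h) q)
  exact ⟨⟨f, continuous_iff_continuousAt.2 fun q => R.contAt (p := Nerve.last) (Cochain.contAt a q)
    (Cochain.contAt b q) (.of_forall hf) (.of_forall hf')⟩, Cochain.ext_at hf, Cochain.ext_at hf'⟩

theorem cochain_eq_of (R : TwoTermRes d j₀ j₁ e e') {k : ℕ} {f g : Cochain A k}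
    (h : Cochain.map j₀ k f = Cochain.map j₀ k g) (h' : Cochain.map d k f = Cochain.map d k g) :
    f = g :=
  Cochain.ext_at fun q => R.eq_of (congrFun (Subtype.ext_iff.1 h) q)
    (congrFun (Subtype.ext_iff.1 h') q)

theorem map_e_j (R : TwoTermRes d j₀ j₁ e e') {k : ℕ} (f : Cochain A k) :
    Cochain.map e k (Cochain.map j₀ k f) = Cochain.map j₁ k (Cochain.map d k f) := by
  rw [Cochain.map_map, Cochain.map_map, R.comm]

end TwoTermRes

/-- The section `τ` and the image under `j` of the pair `(ρ, a)` are cohomologous. -/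
def Cohomologous {A B I J : Shf G} (j₀ : A ⟶ I) (j₁ : B ⟶ J) (e : I ⟶ J) (ρ : Cochain A 1)
    (a : Cochain B 0) (τ : invSections J) : Prop :=
  ∃ β : Cochain I 0, Cochain.delta I 0 β = Cochain.map j₀ 1 ρ ∧
    Cochain.map e 0 β = toCochain τ - Cochain.map j₁ 0 a

namespace Cohomologous

variable {A B I J J' : Shf G} {d : A ⟶ B} {j₀ : A ⟶ I} {j₁ : B ⟶ J} {e : I ⟶ J} {e' : J ⟶ J'}
  {ρ ρ' : Cochain A 1} {a a' : Cochain B 0} {τ τ' : invSections J}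

theorem add (h : Cohomologous j₀ j₁ e ρ a τ) (h' : Cohomologous j₀ j₁ e ρ' a' τ') :
    Cohomologous j₀ j₁ e (ρ + ρ') (a + a') (τ + τ') := by
  obtain ⟨β, h1, h2⟩ := h
  obtain ⟨β', h1', h2'⟩ := h'
  refine ⟨β + β', by rw [map_add, map_add, h1, h1'], ?_⟩
  rw [map_add, map_add, h2, h2', toCochain_add]
  abel

theorem sub_map (h : Cohomologous j₀ j₁ e ρ a τ) (σ : invSections I) :
    Cohomologous j₀ j₁ e ρ a (τ - invSections.map e σ) := by
  obtain ⟨β, h1, h2⟩ := h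
  refine ⟨β - toCochain σ, by rw [map_sub, delta_toCochain, sub_zero, h1], ?_⟩
  rw [map_sub, h2, toCochain_sub, toCochain_map]
  abel

/-- Acyclicity of `I` gives `β` with `δ β = j₀ ρ`. Then `δ (e β + j₁ a) = j₁ (d ρ + δ a) = 0`, so `e
β + j₁ a` is invariant; it is the required `τ`. -/
theorem exists_invSection (R : TwoTermRes d j₀ j₁ e e') [Injective I]
    (h : Cochain.delta A 1 ρ = 0) (h' : Cochain.map d 1 ρ + Cochain.delta B 0 a = 0) :
    ∃ τ : invSections J, invSections.map e' τ = 0 ∧ Cohomologous j₀ j₁ e ρ a τ := by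
  obtain ⟨β, hβ⟩ := Cochain.exists_delta_eq_of_injective I (Cochain.map j₀ 1 ρ)
    (by rw [← Cochain.map_delta1, h, map_zero])
  obtain ⟨τ, hτ⟩ := exists_toCochain_eq (σ := Cochain.map e 0 β + Cochain.map j₁ 0 a) (by
    rw [map_add, ← Cochain.map_delta0, ← Cochain.map_delta0, hβ, R.map_e_j, ← map_add, h',
      map_zero])
  refine ⟨τ, toCochain_injective ?_, β, hβ, by rw [hτ, add_sub_cancel_right]⟩
  rw [toCochain_map, hτ, map_add, Cochain.map_map, Cochain.map_map, R.comp, R.comp_j]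
  exact add_zero _

/-- Invariance of `τ` gives `e (δ β) = j₁ (-δ a)`, so `δ β` and `-δ a` have a common lift `ρ` to
`A`. It is a cocycle because both of its images are. -/
theorem exists_cocycle (R : TwoTermRes d j₀ j₁ e e') {β : Cochain I 0}
    (h : Cochain.map e 0 β = toCochain τ - Cochain.map j₁ 0 a) :
    ∃ ρ, Cochain.delta A 1 ρ = 0 ∧ Cochain.map d 1 ρ + Cochain.delta B 0 a = 0 ∧
      Cohomologous j₀ j₁ e ρ a τ := by
  obtain ⟨ρ, hρ, hρ'⟩ := R.lift_cochain (Cochain.delta I 0 β) (-Cochain.delta B 0 a) (by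
    rw [Cochain.map_delta0, h, map_sub, delta_toCochain, map_neg, Cochain.map_delta0, zero_sub])
  refine ⟨ρ, R.cochain_eq_of ?_ ?_, by rw [hρ', neg_add_cancel], β, hρ.symm, h⟩
  · rw [Cochain.map_delta1, hρ, Cochain.delta_delta, map_zero]
  · rw [Cochain.map_delta1, hρ', map_neg, Cochain.delta_delta, map_zero, neg_zero]

/-- The two kinds of witness determine each other through `j₀ γ = β' - β + σ`: given `γ`, the `σ` so
defined is invariant, and given `σ`, the right-hand side lifts to `γ`. -/
theorem iff_exists (R : TwoTermRes d j₀ j₁ e e') (h : Cohomologous j₀ j₁ e ρ a τ)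
    (h' : Cohomologous j₀ j₁ e ρ' a' τ') (hρ : Cochain.map d 1 ρ + Cochain.delta B 0 a = 0)
    (hρ' : Cochain.map d 1 ρ' + Cochain.delta B 0 a' = 0) :
    (∃ γ, Cochain.delta A 0 γ = ρ' - ρ ∧ Cochain.map d 0 γ = a - a') ↔
      ∃ σ, invSections.map e σ = τ - τ' := by
  obtain ⟨β, h1, h2⟩ := h
  obtain ⟨β', h1', h2'⟩ := h'
  constructor
  · rintro ⟨γ, h3, h4⟩
    obtain ⟨σ, hσ⟩ := exists_toCochain_eq (σ := Cochain.map j₀ 0 γ - (β' - β)) (by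
      rw [map_sub, map_sub, ← Cochain.map_delta0, h3, h1, h1', map_sub, sub_self])
    refine ⟨σ, toCochain_injective ?_⟩
    rw [toCochain_map, hσ, map_sub, map_sub, R.map_e_j, h4, h2, h2', map_sub, toCochain_sub]
    abel
  · rintro ⟨σ, hσ⟩
    have hσ' := congrArg toCochain hσ
    rw [toCochain_map, toCochain_sub] at hσ'
    obtain ⟨γ, h3, h4⟩ := R.lift_cochain (β' - β + toCochain σ) (a - a') (by
      rw [map_add, map_sub, h2, h2', hσ', map_sub]
      abel)
    refine ⟨γ, R.cochain_eq_of ?_ ?_, h4⟩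
    · rw [Cochain.map_delta0, h3, map_add, map_sub, delta_toCochain, h1, h1', map_sub, add_zero]
    · rw [Cochain.map_delta0, h4, map_sub, map_sub, eq_neg_of_add_eq_zero_left hρ,
        eq_neg_of_add_eq_zero_left hρ']
      abel

end Cohomologous

end twoTerm

/-! ### Closed sections over `G₀`: from local to global. -/

section units

variable {n : ℕ} {G₀ G₁ : Type u}
  [TopologicalSpace G₀] [ChartedSpace (EuclideanSpace ℝ (Fin n)) G₀] [IsManifold (𝓡 n) ∞ G₀]
  [TopologicalSpace G₁] [ChartedSpace (EuclideanSpace ℝ (Fin n)) G₁]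
  {G : EtaleGroupoid n G₀ G₁}

/-- A closed section of `J` over `G₀` is the sum of a coboundary and the image of a 1-form. -/
theorem TwoTermRes.exists_map_eq [T2Space G₀] [ParacompactSpace G₀] (hG : G.IsLeray)
    {I J J' : Shf G} {j₀ : G.unitsShf ⟶ I} {j₁ : G.formShf ⟶ J} {e : I ⟶ J} {e' : J ⟶ J'}
    (R : TwoTermRes G.dlogHom j₀ j₁ e e') (τ : Cochain J 0) (hτ : Cochain.map e' 0 τ = 0) :
    ∃ (β : Cochain I 0) (a : Cochain G.formShf 0),
      Cochain.map e 0 β = τ - Cochain.map j₁ 0 a := by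
  obtain ⟨H, hH, hH1, hH0⟩ := hG.exists_homotopy
  choose c α hcα using fun x => R.surj x (Cochain.at0 x τ) (by
    rw [← Cochain.at0_map, hτ, map_zero])
  have hnear (x : G₀) : ∀ᶠ z in 𝓝 x, I.ContAt (p := id) (Shf.sec (c x)) z ∧
      G.formShf.ContAt (p := id) (Shf.sec (α x)) z ∧
      e.app z (Shf.sec (c x) z) = Cochain.at0 z τ - j₁.app z (Shf.sec (α x) z) := by
    have h1 := Shf.sec_contAt (c x)
    have h2 := Shf.sec_contAt (α x)
    filter_upwards [h1, h2, (h1.self_of_nhds.app e).eventuallyEq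
      ((Cochain.contAt0 τ x).sub (h2.self_of_nhds.app j₁))
      (by simp only [id, Shf.sec_self, hcα])] with z h3 h4 h5 using ⟨h3, h4, h5⟩
  choose V hVs hV hxV using fun x => eventually_nhds_iff.1 (hnear x)
  -- On overlaps two local solutions `(c, α)` differ by the image of a unique germ `F x y` in
  -- `ℂˣ_G`; uniqueness makes `F` continuous and a cocycle. The value `0` off the overlap is a
  -- default.
  have hF (x y z : G₀) : ∃ F : G.unitsShf.stalk z, z ∈ V x ∩ V y →
      j₀.app z F = Shf.sec (c x) z - Shf.sec (c y) z ∧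
        G.dlogHom.app z F = Shf.sec (α y) z - Shf.sec (α x) z := by
    by_cases hz : z ∈ V x ∩ V y
    · obtain ⟨F, h1, h2⟩ := R.lift z (Shf.sec (c x) z - Shf.sec (c y) z)
        (Shf.sec (α y) z - Shf.sec (α x) z) (by
          rw [map_sub, map_sub, (hVs x z hz.1).2.2, (hVs y z hz.2).2.2]
          abel)
      exact ⟨F, fun _ => ⟨h1, h2⟩⟩
    · exact ⟨0, fun h => absurd h hz⟩
  choose F hF using hF
  have hFc {x y z : G₀} (hz : z ∈ V x ∩ V y) : G.unitsShf.ContAt (p := id) (F x y) z := by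
    have hn := ((hV x).inter (hV y)).mem_nhds hz
    refine R.contAt ((hVs x z hz.1).1.sub (hVs y z hz.2).1)
      ((hVs y z hz.2).2.1.sub (hVs x z hz.1).2.1) ?_ ?_
    · filter_upwards [hn] with w hw using (hF x y w hw).1
    · filter_upwards [hn] with w hw using (hF x y w hw).2
  have hFg {x y z : G₀} (hz : z ∈ V x ∩ V y) :
      IsUnitGerm (F x y z) fun w => (uval (F x y w)).toMul :=
    Shf.ContAt.isGerm_val (C := unitsCoeff G₀) (hFc hz)
  obtain ⟨W, h, hW, hxW, hWV, hh, hsplit⟩ := exists_smooth_units_split hH hH1 hH0 hV hxV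
    (f := fun x y z => (uval (F x y z)).toMul) (fun x y z hz => (hFg hz).smooth.self_of_nhds)
    (fun x y w z hz => by
      have : F x y z + F y w z = F x w z := by
        have h1 := hF x y z hz.1
        have h2 := hF y w z ⟨hz.1.2, hz.2⟩
        have h3 := hF x w z ⟨hz.1.1, hz.2⟩
        refine R.eq_of ?_ ?_
        · rw [map_add, h1.1, h2.1, h3.1]; abel
        · rw [map_add, h1.2, h2.2, h3.2]; abel
      rw [← this, map_add, toMul_add])
  have hb (x z : G₀) : ∃ b : G.unitsShf.stalk z, z ∈ W x → IsUnitGerm b (h x) := by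
    by_cases hz : z ∈ W x
    · obtain ⟨b, hb⟩ := isUnitGerm_of_smooth (G := G) (x := z) (f := h x) (by
        filter_upwards [(hW x).mem_nhds hz] with w hw using hh x w hw)
      exact ⟨b, fun _ => hb⟩
    · exact ⟨0, fun h => absurd h hz⟩
  choose b hb using hb
  have hbc (x : G₀) : G.unitsShf.ContAt (p := id) (b x) x :=
    contAt_of_isUnitGerm continuousAt_id (by
      filter_upwards [(hW x).mem_nhds (hxW x)] with z hz using hb x z hz)
  have hFb {x y z : G₀} (hx : z ∈ W x) (hy : z ∈ W y) : F x y z = b x z - b y z := by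
    refine ((hFg ⟨hWV x hx, hWV y hy⟩).eq_iff ((hb x z hx).sub (hb y z hy))).2 ?_
    filter_upwards [((hW x).inter (hW y)).mem_nhds ⟨hx, hy⟩] with w hw using hsplit x y w hw
  -- Since `F x y = b x - b y`, the corrected local solutions agree on overlaps. The global sections
  -- may thus use the index `z` at the point `z`, and near `x` they coincide with the continuous
  -- ones of index `x`.
  refine ⟨Cochain.mk0 (fun z => Shf.sec (c z) z - j₀.app z (b z z)) fun x => ?_,
    Cochain.mk0 (fun z => Shf.sec (α z) z + G.dlogHom.app z (b z z)) fun x => ?_,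
    Cochain.ext0 fun z => ?_⟩
  · refine ((hVs x x (hxV x)).1.sub ((hbc x).app j₀)).congr ?_
    filter_upwards [(hW x).mem_nhds (hxW x)] with z hz
    have h1 := (hF x z z ⟨hWV x hz, hxV z⟩).1
    rw [hFb hz (hxW z), map_sub] at h1
    exact (sub_eq_sub_iff_sub_eq_sub.1 h1.symm).symm ▸ rfl
  · refine ((hVs x x (hxV x)).2.1.add ((hbc x).app G.dlogHom)).congr ?_
    filter_upwards [(hW x).mem_nhds (hxW x)] with z hz
    have h1 := (hF x z z ⟨hWV x hz, hxV z⟩).2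
    rw [hFb hz (hxW z), map_sub] at h1
    have h2 := eq_add_of_sub_eq h1
    simp only [id] at *
    rw [h2]
    abel
  · rw [Cochain.at0_map, map_sub, Cochain.at0_map, Cochain.at0_mk0, Cochain.at0_mk0, map_sub,
      (hVs z z (hxV z)).2.2, R.e_j, map_add]
    abel

end units

end EtaleGroupoid

/-! ### Classification by hypercohomology. -/

namespace EtaleGroupoid

variable {n : ℕ} {G₀ G₁ : Type u}
  [TopologicalSpace G₀] [ChartedSpace (EuclideanSpace ℝ (Fin n)) G₀] [IsManifold (𝓡 n) ∞ G₀]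
  [TopologicalSpace G₁] [ChartedSpace (EuclideanSpace ℝ (Fin n)) G₁]
  {G : EtaleGroupoid n G₀ G₁} {T : CochainComplex (Shf G) ℕ} {j : G.units2 ⟶ T}

/-- The component of degree `0` of a map from `ℂˣ(2)_G`. -/
noncomputable def comp0 (j : G.units2 ⟶ T) : G.unitsShf ⟶ T.X 0 := j.f 0

/-- The component of degree `1` of a map from `ℂˣ(2)_G`. -/
noncomputable def comp1 (j : G.units2 ⟶ T) : G.formShf ⟶ T.X 1 := j.f 1

theorem IsInjRes.twoTermRes (h : IsInjRes j) :
    TwoTermRes G.dlogHom (comp0 j) (comp1 j) (T.d 0 1) (T.d 1 2) := by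
  have hq (x : G₀) := (quasiIso_stalk_iff j x).1 (h.quasiIso x)
  have hK (x : G₀) (b : (G.units2.X 1).stalk x) : (G.units2.d 1 2).app x b = 0 :=
    (subsingleton_units2_stalk 0 x).elim _ _
  have comm : comp0 j ≫ T.d 0 1 = G.dlogHom ≫ comp1 j := by
    rw [← units2_d]
    exact j.comm 0 1
  have hcomm {x : G₀} (a) : (T.d 0 1).app x ((comp0 j).app x a) =
      (comp1 j).app x (G.dlogHom.app x a) := by
    rw [← Shf.comp_app, comm, Shf.comp_app]
  refine ⟨comm, T.d_comp_d 0 1 2, ?_, fun x a ha ha' => ?_, fun x a b hab => ?_, fun x c hc => ?_⟩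
  · have e : j.f 1 ≫ T.d 1 2 = G.units2.d 1 2 ≫ j.f 2 := j.comm 1 2
    refine e.trans (Shf.hom_ext fun x b => ?_)
    rw [Shf.comp_app, hK, map_zero]
    rfl
  · refine (hq x).inj0 a ?_ ha'
    rw [units2_d]
    exact ha
  -- Injectivity on first cohomology makes `b` exact, say `b = d c`. Then `a - j₀ c` is a cycle, and
  -- surjectivity in degree zero supplies the correction `f` with `d f = 0`.
  · obtain ⟨c, hc⟩ : ∃ c : G.unitsShf.stalk x, G.dlogHom.app x c = b := by
      have := (hq x).inj 0 b (hK x b) ⟨a, hab⟩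
      rwa [units2_d] at this
    obtain ⟨f, hf, hf'⟩ : ∃ f : G.unitsShf.stalk x, G.dlogHom.app x f = 0 ∧
        (comp0 j).app x f = a - (comp0 j).app x c := by
      have := (hq x).surj0 (a - (comp0 j).app x c) (by rw [map_sub, hab, hcomm, hc, sub_self])
      rwa [units2_d] at this
    exact ⟨c + f, by rw [map_add, hf', add_sub_cancel], by rw [map_add, hc, hf, add_zero]⟩
  · obtain ⟨b, -, a, e⟩ := (hq x).surj 0 c hc
    exact ⟨a, b, e⟩

variable [IsManifold (𝓡 n) ∞ G₁]

/-- The line bundle with connection `L` represents the invariant section `τ`. -/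
def LineBundle.RepresentedBy (j : G.units2 ⟶ T) (L : LineBundle G) (τ : invSections (T.X 1)) :
    Prop := Cohomologous (comp0 j) (comp1 j) (T.d 0 1) L.ρCochain L.ACochain τ

namespace LineBundle

theorem map_dlog_add_delta (L : LineBundle G) :
    Cochain.map G.dlogHom 1 L.ρCochain + Cochain.delta G.formShf 0 L.ACochain = 0 :=
  ((D_pair_units2 _ _).1 L.D_cochain).2

theorem representedBy_iff {L : LineBundle G} {τ : invSections (T.X 1)} :
    L.RepresentedBy j τ ↔ ∃ b : Tot T 0,
      Tot.D T 0 b = Tot.pair 0 (invSections.toCochain τ) - Tot.map j L.cochain := by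
  have key (β : Cochain (T.X 0) 0) : Tot.D T 0 (Tot.single β) =
      Tot.pair 0 (invSections.toCochain τ) - Tot.map j L.cochain ↔
      Cochain.delta (T.X 0) 0 β = Cochain.map (comp0 j) 1 L.ρCochain ∧
        Cochain.map (T.d 0 1) 0 β =
          invSections.toCochain τ - Cochain.map (comp1 j) 0 L.ACochain := by
    have e : Tot.map j L.cochain = Tot.pair (Cochain.map (comp0 j) 1 L.ρCochain)
        (Cochain.map (comp1 j) 0 L.ACochain) := Tot.map_pair j L.ρCochain L.ACochain
    rw [e, Tot.pair_sub, Tot.D_single, Tot.pair_inj, zero_sub, neg_inj]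
  constructor
  · rintro ⟨β, h⟩
    exact ⟨_, (key β).2 h⟩
  · rintro ⟨b, h⟩
    obtain ⟨β, rfl⟩ := Tot.exists_single b
    exact ⟨β, (key β).1 h⟩

theorem RepresentedBy.tensor {L L' : LineBundle G} {τ τ' : invSections (T.X 1)}
    (h : L.RepresentedBy j τ) (h' : L'.RepresentedBy j τ') :
    (L.tensor L').RepresentedBy j (τ + τ') := by
  rw [RepresentedBy, ρCochain_tensor, ACochain_tensor]
  exact Cohomologous.add h h'

theorem exists_representedBy (hj : IsInjRes j) (L : LineBundle G) :
    ∃ τ : invZ T 1, L.RepresentedBy j τ.1 := by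
  have := hj.injective 0
  obtain ⟨τ, h, h'⟩ := Cohomologous.exists_invSection hj.twoTermRes
    (L.represents.delta_eq_zero_iff.2 L.ρ.arr_m) L.map_dlog_add_delta
  exact ⟨⟨τ, h⟩, h'⟩

theorem exists_of_invZ [T2Space G₀] [ParacompactSpace G₀] (hG : G.IsLeray) (hj : IsInjRes j)
    (τ : invZ T 1) : ∃ L : LineBundle G, L.RepresentedBy j τ.1 := by
  obtain ⟨β, a, h⟩ := hj.twoTermRes.exists_map_eq hG (invSections.toCochain τ.1)
    (congrArg invSections.toCochain τ.2)
  obtain ⟨ρ, h1, h2, h3⟩ := Cohomologous.exists_cocycle hj.twoTermRes h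
  obtain ⟨L, rfl, rfl⟩ := exists_cochain_eq_pair h1 h2
  exact ⟨L, h3⟩

theorem RepresentedBy.iso_iff (hj : IsInjRes j) {L L' : LineBundle G} {τ τ' : invZ T 1}
    (h : L.RepresentedBy j τ.1) (h' : L'.RepresentedBy j τ'.1) :
    L.Iso L' ↔ (QuotientAddGroup.mk τ : InvH T 1) = QuotientAddGroup.mk τ' := by
  rw [LineBundle.iso_iff, Cohomologous.iff_exists hj.twoTermRes h h' L.map_dlog_add_delta
    L'.map_dlog_add_delta, eq_comm, QuotientAddGroup.eq, AddSubgroup.mem_addSubgroupOf]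
  rw [neg_add_eq_sub]
  rfl

/-- Changing `τ` by the differential of an invariant section changes only `β`. Conversely two
sections representing the same `L` have equal classes by `iso_iff` for the identity of `L`. -/
theorem RepresentedBy.iff_mk_eq (hj : IsInjRes j) {L : LineBundle G} {τ τ' : invZ T 1}
    (h : L.RepresentedBy j τ.1) :
    (QuotientAddGroup.mk τ : InvH T 1) = QuotientAddGroup.mk τ' ↔ L.RepresentedBy j τ'.1 := by
  refine ⟨fun e => ?_, fun h' => (h.iso_iff hj h').1 (G.lineBundleSetoid.refl L)⟩
  rw [eq_comm, QuotientAddGroup.eq, AddSubgroup.mem_addSubgroupOf, neg_add_eq_sub] at e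
  obtain ⟨σ, hσ⟩ : ∃ σ, invSections.map (T.d 0 1) σ = τ.1 - τ'.1 := e
  have := Cohomologous.sub_map h σ
  rwa [hσ, sub_sub_cancel] at this

/-- Isomorphism classes of line bundles with connection are classified by hypercohomology. -/
theorem exists_equiv [T2Space G₀] [ParacompactSpace G₀] (hG : G.IsLeray) (hj : IsInjRes j) :
    ∃ Φ : G.LineBundleClass ≃ InvH T 1,
      (∀ L L' : LineBundle G, Φ (Quotient.mk _ (L.tensor L')) =
        Φ (Quotient.mk _ L) + Φ (Quotient.mk _ L')) ∧
      ∀ (L : LineBundle G) (τ : invZ T 1),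
        Φ (Quotient.mk _ L) = QuotientAddGroup.mk τ ↔ L.RepresentedBy j τ.1 := by
  choose t ht using exists_representedBy (G := G) hj
  let φ : G.LineBundleClass → InvH T 1 := Quotient.lift (fun L => QuotientAddGroup.mk (t L))
    fun L L' h => ((ht L).iso_iff hj (ht L')).1 h
  have hφ : Function.Bijective φ := by
    constructor
    · rintro ⟨L⟩ ⟨L'⟩ h
      exact Quotient.sound (((ht L).iso_iff hj (ht L')).2 h)
    · intro q
      obtain ⟨τ, rfl⟩ := QuotientAddGroup.mk_surjective q
      obtain ⟨L, hL⟩ := exists_of_invZ hG hj τ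
      exact ⟨Quotient.mk _ L, ((ht L).iff_mk_eq hj).2 hL⟩
  refine ⟨Equiv.ofBijective φ hφ, fun L L' => ?_, fun L τ => (ht L).iff_mk_eq hj⟩
  -- The representative chosen for the tensor product need not be `t L + t L'`, but the latter also
  -- represents it, so the classes agree.
  exact ((ht _).iff_mk_eq hj (τ' := t L + t L')).2 ((ht L).tensor (ht L'))

end LineBundle

end EtaleGroupoid

theorem mainTheorem6 {n : ℕ} {G₀ G₁ : Type u}
    [TopologicalSpace G₀] [ChartedSpace (EuclideanSpace ℝ (Fin n)) G₀] [IsManifold (𝓡 n) ∞ G₀]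
    [T2Space G₀] [ParacompactSpace G₀]
    [TopologicalSpace G₁] [ChartedSpace (EuclideanSpace ℝ (Fin n)) G₁] [IsManifold (𝓡 n) ∞ G₁]
    (G : EtaleGroupoid n G₀ G₁) (hG : G.IsLeray) :
    (∀ L : G.LineBundle, EtaleGroupoid.Tot.D G.units2 1 L.cochain = 0) ∧
    (∀ c : EtaleGroupoid.Tot G.units2 1, EtaleGroupoid.Tot.D G.units2 1 c = 0 → ∃! L : G.LineBundle, L.cochain = c) ∧
    (∀ L L' : G.LineBundle, L.Iso L' ↔
      ∃ b : EtaleGroupoid.Tot G.units2 0, EtaleGroupoid.Tot.D G.units2 0 b = L'.cochain - L.cochain) ∧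
    (∃ (T : CochainComplex G.Shf ℕ) (j : G.units2 ⟶ T), EtaleGroupoid.IsInjRes j) ∧
    ∀ (T : CochainComplex G.Shf ℕ) (j : G.units2 ⟶ T), EtaleGroupoid.IsInjRes j →
      ∃ Φ : G.LineBundleClass ≃ EtaleGroupoid.InvH T 1,
        (∀ L L' : G.LineBundle, Φ (Quotient.mk _ (L.tensor L')) =
          Φ (Quotient.mk _ L) + Φ (Quotient.mk _ L')) ∧
        ∀ (L : G.LineBundle) (τ : EtaleGroupoid.invZ T 1),
          Φ (Quotient.mk _ L) = QuotientAddGroup.mk τ ↔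
            ∃ b : EtaleGroupoid.Tot T 0, EtaleGroupoid.Tot.D T 0 b =
              EtaleGroupoid.Tot.pair 0 (EtaleGroupoid.invSections.toCochain τ.1) -
                EtaleGroupoid.Tot.map j L.cochain := by
  refine ⟨fun L => L.D_cochain, fun c hc => ?_, fun L L' => L.iso_iff_cohomologous L',
    EtaleGroupoid.exists_isInjRes _ EtaleGroupoid.subsingleton_units2_stalk, fun T j hj => ?_⟩
  · obtain ⟨L, rfl⟩ := EtaleGroupoid.LineBundle.exists_cochain_eq c hc
    exact ⟨L, rfl, fun L' h => EtaleGroupoid.LineBundle.cochain_injective h⟩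
  · obtain ⟨Φ, h1, h2⟩ := EtaleGroupoid.LineBundle.exists_equiv hG hj
    exact ⟨Φ, h1, fun L τ => (h2 L τ).trans EtaleGroupoid.LineBundle.representedBy_iff⟩
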